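/- **Setting.** A classical oracle is a function $\mathcal O:\{0,1\}^*\to\{0,1\}$; a promise problem is a pair $L=(L_{\mathrm{YES}},L_{\mathrm{NO}})$ of disjoint subsets of $\{0,1\}^*$. Fix a finite set $S$ of one- and two-qubit unitary gates (for example any of the usual universal gate sets) whose matrix entries are polynomial-time computable: from $1^k$ one can compute, in time polynomial in $k$, the real and imaginary parts up to error $2^{-k}$. An oracle circuit is a finite sequence of gates from $S$ and oracle gates $|x\rangle\mapsto(-1)^{\mathcal O(x)}|x\rangle$, each gate being applied to an ordered list of distinct qubits (an oracle gate to a list of any length). $L\in\mathsf{BQP}^{\mathcal O}$ means: there is a family $(C_n)_{n\ge 0}$ of oracle circuits whose descriptions are computed from $1^n$ by a deterministic polynomial-time algorithm, where $C_n$ has at least $\max(n,1)$ qubits, such that for every $x\in\{0,1\}^n$, if $C_n$ is run on $|x\rangle|0\cdots0\rangle$ and the first qubit is measured, the outcome is $0$ with probability at least $2/3$ if $x\in L_{\mathrm{YES}}$ and at most $1/3$ if $x\in L_{\mathrm{NO}}$. For $s,c:\mathbb N\to\mathbb R$ and $p,q,r:\mathbb N\to\mathbb N$, $L\in\mathsf{adPCP}^{\mathcal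 O}_{s,c}[p,q,r]$ means: there is a classical probabilistic polynomial-time algorithm $V$ that is given $x\in\{0,1\}^n$, random access to a string $\pi\in\{0,1\}^*$ and access to $\mathcal O$, and that for all $x\in\{0,1\}^n$ and all $\pi$ uses at most $r(n)$ random coins, at most $p(n)$ adaptive queries to locations of $\pi$ and at most $q(n)$ adaptive queries to $\mathcal O$, such that * if $x\in L_{\mathrm{YES}}$, there is a proof $\pi$ with $\Pr[V^{\pi,\mathcal O}(x)=\mathrm{acc}]\ge c(n)$; * if $x\in L_{\mathrm{NO}}$, then $\Pr[V^{\pi,\mathcal O}(x)=\mathrm{acc}]\le s(n)$ for all $\pi\in\{0,1\}^*$. (Queries to $\pi$ beyond its end are answered by $0$.) **Theorem.** For every such gate set $S$, every classical oracle $\mathcal O$, every promise problem $L\in\mathsf{BQP}^{\mathcal O}$ and every polynomial $e$ with natural-number coefficients, there are polynomials $p,q,r,\ell$ with natural-number coefficients such that $$L\in\mathsf{adPCP}^{\mathcal O}_{s,c}[p(n),q(n),r(n)]\qquad\text{with } c(n)=1 \text{ and } s(n)=2^{-e(n)},$$ and the proofs $\pi$ in the completeness condition can be taken to have length at most $2^{\ell(n)}$.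 -/

import Mathlib

namespace OraclePCP

/-! ### Strings, oracles, promise problems -/

/-- A classical oracle: a Boolean function on all finite bit strings. -/
abbrev Oracle := List Bool → Bool

/-- A promise problem: disjoint sets of YES-instances and NO-instances. -/
structure PromiseProblem where
  yes : Set (List Bool)
  no : Set (List Bool)
  disjoint : Disjoint yes no

/-- A bit string as the content of a register: the binary expansion of the number is the string
(first letter least significant) topped by a leading `1`. -/
def encodeStr (w : List Bool) : ℕ := w.foldr Nat.bit 1

/-- The bit string held by a register (inverse to `encodeStr`). -/
def decodeStr (m : ℕ) : List Bool := m.bits.dropLast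

theorem encodeStr_pos (w : List Bool) : encodeStr w ≠ 0 := by
  induction w with
  | nil => simp [encodeStr]
  | cons b w ih => simpa [encodeStr, Nat.bit_eq_zero_iff] using fun h => absurd h ih

theorem decodeStr_encodeStr (w : List Bool) : decodeStr (encodeStr w) = w := by
  have key : ∀ w : List Bool, (encodeStr w).bits = w ++ [true] := by
    intro w
    induction w with
    | nil => simp [encodeStr]
    | cons b w ih =>
      have h : encodeStr (b :: w) = Nat.bit b (encodeStr w) := rfl
      rw [h, Nat.bits_append_bit _ _ (fun h0 => absurd h0 (encodeStr_pos w)), ih, List.cons_append]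
  simp [decodeStr, key]

/-! ### The machine model

Register machines with finitely many registers holding natural numbers, under the logarithmic cost
criterion (an instruction costs one plus the bit lengths of the numbers it touches), in the form of
structured programs. They simulate Turing machines, and are simulated by them, with polynomial
overhead. A program may flip coins, query a classical oracle, and query a proof string. -/

/-- Arithmetic instructions. Subtraction is truncated, division rounds down. -/
inductive Op where
  | add | sub | mul | div

/-- The function computed by an arithmetic instruction. -/
def Op.eval : Op → ℕ → ℕ → ℕ
  | .add, a, b => a + b
  | .sub, a, b => a - b
  | .mul, a, b => a * b
  | .div, a, b => a / b

/-- Programs. Registers are named by natural numbers; a program mentions finitely many of them. -/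
inductive Prog where
  /-- `r_i := c` -/
  | const (i c : ℕ)
  /-- `r_i := r_j op r_k` -/
  | op (o : Op) (i j k : ℕ)
  /-- `r_i := ` a fresh random bit -/
  | coin (i : ℕ)
  /-- `r_i := ` the oracle's answer on the string held by `r_j` -/
  | oracle (i j : ℕ)
  /-- `r_i := ` the bit of the proof string at location `r_j` -/
  | proof (i j : ℕ)
  /-- run `P`, then `Q` -/
  | seq (P Q : Prog)
  /-- run `P` if `r_i ≠ 0`, and `Q` otherwise -/
  | ite (i : ℕ) (P Q : Prog)
  /-- repeat `P` as long as `r_i ≠ 0` -/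
  | loop (i : ℕ) (P : Prog)

/-- A state of the machine: registers, coins not yet flipped, and counters for the running time and
for the queries made so far. Programs cannot see the counters. -/
structure State where
  reg : ℕ → ℕ
  coins : List Bool
  time : ℕ
  proofQueries : ℕ
  oracleQueries : ℕ

/-- The initial state: the input in register `0`, all other registers `0`. -/
def State.start (input : ℕ) (coins : List Bool) : State where
  reg := Function.update (fun _ => 0) 0 input
  coins := coins
  time := 0
  proofQueries := 0
  oracleQueries := 0

/-- `Exec O π P s t`: with oracle `O` and proof string `π`, program `P` started in state `s` halts
in state `t`. A coin flip with no coin left has no successor state. A proof query beyond the end of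
`π` is answered by `0`. -/
inductive Exec (O : Oracle) (π : List Bool) : Prog → State → State → Prop where
  | const (s : State) (i c : ℕ) :
      Exec O π (.const i c) s
        { s with
          reg := Function.update s.reg i c
          time := s.time + 1 + c.size }
  | op (s : State) (o : Op) (i j k : ℕ) :
      Exec O π (.op o i j k) s
        { s with
          reg := Function.update s.reg i (o.eval (s.reg j) (s.reg k))
          time := s.time + 1 + (s.reg j).size + (s.reg k).size }
  | coin (s : State) (i : ℕ) (b : Bool) (ρ : List Bool) (h : s.coins = b :: ρ) :
      Exec O π (.coin i) s
        { s with
          reg := Function.update s.reg i b.toNat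
          coins := ρ
          time := s.time + 1 }
  | oracle (s : State) (i j : ℕ) :
      Exec O π (.oracle i j) s
        { s with
          reg := Function.update s.reg i (O (decodeStr (s.reg j))).toNat
          time := s.time + 1 + (s.reg j).size
          oracleQueries := s.oracleQueries + 1 }
  | proof (s : State) (i j : ℕ) :
      Exec O π (.proof i j) s
        { s with
          reg := Function.update s.reg i (π.getD (s.reg j) false).toNat
          time := s.time + 1 + (s.reg j).size
          proofQueries := s.proofQueries + 1 }
  | seq {P Q : Prog} {s t u : State} (hP : Exec O π P s t) (hQ : Exec O π Q t u) :
      Exec O π (.seq P Q) s u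
  | ite_true {i : ℕ} {P Q : Prog} {s t : State} (h : s.reg i ≠ 0)
      (hP : Exec O π P { s with time := s.time + 1 + (s.reg i).size } t) :
      Exec O π (.ite i P Q) s t
  | ite_false {i : ℕ} {P Q : Prog} {s t : State} (h : s.reg i = 0)
      (hQ : Exec O π Q { s with time := s.time + 1 + (s.reg i).size } t) :
      Exec O π (.ite i P Q) s t
  | loop_step {i : ℕ} {P : Prog} {s t u : State} (h : s.reg i ≠ 0)
      (hP : Exec O π P { s with time := s.time + 1 + (s.reg i).size } t)
      (hL : Exec O π (.loop i P) t u) :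
      Exec O π (.loop i P) s u
  | loop_done {i : ℕ} {P : Prog} {s : State} (h : s.reg i = 0) :
      Exec O π (.loop i P) s { s with time := s.time + 1 + (s.reg i).size }

/-- The deterministic program `P` (no coins, a trivial oracle, an empty proof string), run on the
unary input `1ⁿ`, halts in state `t` within polynomially many steps, for `t` as described by
`post n`. -/
def PolyTimeUnary (P : Prog) (post : ℕ → State → Prop) : Prop :=
  ∃ T : Polynomial ℕ, ∀ n : ℕ, ∃ t : State,
    Exec (fun _ => false) [] P (State.start (encodeStr (List.replicate n true)) []) t ∧
      t.time ≤ T.eval n ∧ post n t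

/-! ### Quantum circuits with oracle gates -/

/-- A finite set of one- and two-qubit gates. -/
structure GateSet where
  size : ℕ
  arity : Fin size → ℕ
  arity_eq : ∀ g, arity g = 1 ∨ arity g = 2
  mat : (g : Fin size) → Matrix (Fin (arity g) → Bool) (Fin (arity g) → Bool) ℂ
  unitary : ∀ g, mat g ∈ Matrix.unitaryGroup (Fin (arity g) → Bool) ℂ

/-- A real number is polynomial-time computable if, given `1ᵏ`, one can compute in time polynomial
in `k` an integer `a - b` with `|v - (a - b) / 2ᵏ| ≤ 1 / 2ᵏ`. -/
def PolyTimeReal (v : ℝ) : Prop :=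
  ∃ P : Prog, PolyTimeUnary P fun k t =>
    |v - ((t.reg 0 : ℝ) - (t.reg 1 : ℝ)) / 2 ^ k| ≤ 1 / 2 ^ k

/-- All entries of all gates are polynomial-time computable complex numbers. -/
def GateSet.PolyTimeComputable (S : GateSet) : Prop :=
  ∀ (g : Fin S.size) (a b : Fin (S.arity g) → Bool),
    PolyTimeReal (S.mat g a b).re ∧ PolyTimeReal (S.mat g a b).im

/-- A gate of a circuit on `w` qubits: a gate of `S` applied to distinct qubits in a given order, or
an oracle gate applied to any number of distinct qubits in a given order. -/
inductive Gate (S : GateSet) (w : ℕ) where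
  | unitary (g : Fin S.size) (q : Fin (S.arity g) ↪ Fin w)
  | oracle (k : ℕ) (q : Fin k ↪ Fin w)

/-- A quantum circuit with oracle gates: the number of qubits, and the gates in order of
application. -/
structure Circuit (S : GateSet) where
  width : ℕ
  gates : List (Gate S width)

/-- The action of a gate on a vector of amplitudes. An oracle gate maps `|x⟩` to `(-1)^{O(x)} |x⟩`,
with `x` read off the qubits that it is applied to. -/
noncomputable def Gate.apply {S : GateSet} {w : ℕ} (O : Oracle) :
    Gate S w → ((Fin w → Bool) → ℂ) → ((Fin w → Bool) → ℂ)
  | .unitary g q, ψ => fun x =>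
      ∑ y : Fin (S.arity g) → Bool, S.mat g (x ∘ q) y * ψ (Function.extend q y x)
  | .oracle _ q, ψ => fun x =>
      (if O (List.ofFn (x ∘ q)) then -1 else 1) * ψ x

/-- The initial state `|x 0 ⋯ 0⟩` on `w` qubits. -/
noncomputable def initialVec (w : ℕ) (x : List Bool) : (Fin w → Bool) → ℂ :=
  fun y => if ∀ j : Fin w, y j = x.getD j false then 1 else 0

/-- The final state of a circuit on input `x`. -/
noncomputable def Circuit.finalVec {S : GateSet} (O : Oracle) (C : Circuit S) (x : List Bool) :
    (Fin C.width → Bool) → ℂ :=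
  C.gates.foldl (fun ψ G => G.apply O ψ) (initialVec C.width x)

/-- The probability that measuring the first qubit of the final state yields `0`. -/
noncomputable def Circuit.acceptProb {S : GateSet} (O : Oracle) (C : Circuit S) (x : List Bool) :
    ℝ :=
  ∑ y : Fin C.width → Bool with ∀ j : Fin C.width, (j : ℕ) = 0 → y j = false,
    ‖C.finalVec O x y‖ ^ 2

/-- A gate as a sequence of numbers. -/
def Gate.tokens {S : GateSet} {w : ℕ} : Gate S w → List ℕ
  | .unitary g q => ((g : ℕ) + 1) :: List.ofFn fun i => (q i : ℕ)
  | .oracle k q => 0 :: k :: List.ofFn fun i => (q i : ℕ)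

/-- The description of a circuit as a bit string: the number of qubits and the gates in order, all
numbers in unary, `k` being written as `1ᵏ0`. -/
def Circuit.encode {S : GateSet} (C : Circuit S) : List Bool :=
  (C.width :: C.gates.flatMap Gate.tokens).flatMap fun k => List.replicate k true ++ [false]

/-- A family of circuits is (polynomial-time) uniform if a deterministic polynomial-time program
computes the description of the `n`-th circuit from `1ⁿ`. -/
def Uniform {S : GateSet} (C : ℕ → Circuit S) : Prop :=
  ∃ P : Prog, PolyTimeUnary P fun n t => t.reg 0 = encodeStr (C n).encode

/-- Oracle `BQP` over the gate set `S`. The `n`-th circuit has room for the `n` input bits and at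
least one qubit to be measured. -/
def BQP (S : GateSet) (O : Oracle) : Set PromiseProblem :=
  { L | ∃ C : ℕ → Circuit S, Uniform C ∧
      (∀ n, n ≤ (C n).width ∧ 0 < (C n).width) ∧
      (∀ x ∈ L.yes, 2 / 3 ≤ (C x.length).acceptProb O x) ∧
      (∀ x ∈ L.no, (C x.length).acceptProb O x ≤ 1 / 3) }

/-! ### Adaptive probabilistically checkable proofs -/

/-- `Runs O π V x ρ t`: the verifier `V` on input `x` with coins `ρ` halts in state `t`. -/
def Runs (O : Oracle) (π : List Bool) (V : Prog) (x : List Bool) {r : ℕ} (ρ : Fin r → Bool)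
    (t : State) : Prop :=
  Exec O π V (State.start (encodeStr x) (List.ofFn ρ)) t

/-- The probability, over `r` uniform coins, that `V` halts on input `x` with output `1` (accept) in
register `0`. -/
noncomputable def verifierAcceptProb (O : Oracle) (π : List Bool) (V : Prog) (x : List Bool)
    (r : ℕ) : ℝ :=
  (Nat.card { ρ : Fin r → Bool // ∃ t : State, Runs O π V x ρ t ∧ t.reg 0 = 1 } : ℝ) / 2 ^ r

/-- Promise problems with an adaptive PCP relative to `O` with soundness `s` and completeness `c`:
there is a polynomial-time program `V` that on every input of length `n`, with every proof string,
uses at most `r n` coins and makes at most `p n` queries to the proof and at most `q n` queries to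
`O`; YES-instances have a proof, of length at most `2 ^ ℓ n`, that is accepted with probability at
least `c n`; on NO-instances every string (of any length) is accepted with probability at most
`s n`. -/
def AdPCP (O : Oracle) (s c : ℕ → ℝ) (p q r ℓ : ℕ → ℕ) : Set PromiseProblem :=
  { L | ∃ (V : Prog) (T : Polynomial ℕ),
      (∀ (x π : List Bool) (ρ : Fin (r x.length) → Bool), ∃ t : State,
        Runs O π V x ρ t ∧ t.time ≤ T.eval x.length ∧
          t.proofQueries ≤ p x.length ∧ t.oracleQueries ≤ q x.length) ∧
      (∀ x ∈ L.yes, ∃ π : List Bool, π.length ≤ 2 ^ ℓ x.length ∧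
        c x.length ≤ verifierAcceptProb O π V x (r x.length)) ∧
      (∀ x ∈ L.no, ∀ π : List Bool,
        verifierAcceptProb O π V x (r x.length) ≤ s x.length) }

end OraclePCP

namespace OraclePCP

/-! ### Polynomial-time computable functions -/

/-! The proof string is an exponentially long table of the history of the quantum computation.
Separating real and imaginary parts turns the state after `t` gates into a real unit vector indexed
by `Idx w`, and each gate into a real isometry whose rows have at most eight nonzero entries. For
every time the table lists fixed-point amplitudes, a binary tree of weights with the squared
amplitudes at its leaves and the total `M = 2 ^ h * 2 ^ h` at its root, and a division of the
numbers below `M` into intervals whose lengths are the leaf weights. A random `R < M` then selects,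
at each time, a basis state with probability about its squared amplitude.

One round (`RoundOK`) draws one `R`. At the state selected at each time it checks the tree path, the
interval, and one row of the gate equation. The state selected at time `0` has to be the input, and
at the end the numbers below `3 / 5 * M` have to select states with first qubit `0`.

Completeness is perfect (`exists_roundOK`): the tolerances absorb rounding, and rounded cumulative
sums (`exists_intervals`) give integer weights with total exactly `M`. States with first qubit `0`
come first in the order used, so they cover all numbers below `3 / 5 * M`.

Soundness (`acceptProb_gt_of_roundOK`): let `θ t` be the claimed amplitudes where the path checks
hold, and zero elsewhere. By `tree_sum_le`, `θ t` has squared norm at most `1 + η`. If a fraction `1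
- δ` of the `R` passes, the states selected by them carry all but `δ + η` of the weight, and on them
`θ (t + 1)` agrees with the image of `θ t` under the gate. Two vectors of norm about one that agree
where one of them has nearly all its weight are close (`sum_sq_sub_le_of_good`). Isometries do not
amplify errors, so these add up linearly in time (`history_sound`); for `δ` of order `1 / T ^ 2` the
last vector is close to a multiple of the true final state, and the circuit accepts with probability
above `1 / 3`. Hence on a NO-instance each round fails with inverse polynomial probability, and
independent repetition brings the error down to `2 ^ (-e)`.

That the checks are carried out by a polynomial-time program is shown with a calculus of computable
functions (`PT`) and decidable properties (`PD`), which `PD.exists_verifier` turns into a verifier.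
The bounds on queries follow from the bound on the running time. -/

theorem polyEval_mono (p : Polynomial ℕ) : Monotone fun n => p.eval n := by
  induction p using Polynomial.induction_on' with
  | add p q hp hq =>
    intro a b h
    simpa using add_le_add (hp h) (hq h)
  | monomial n c =>
    intro a b h
    simpa using Nat.mul_le_mul_left c (Nat.pow_le_pow_left h n)

/-- A type of parameters of a computation: an oracle, a proof string, and the input length. -/
class World (X : Type) where
  orc : X → Oracle
  prf : X → List Bool
  len : X → ℕ

open World

variable {X : Type} [World X]

/-- Bounded by a polynomial in the input length. -/
def PolyB (f : X → ℕ) : Prop := ∃ T : Polynomial ℕ, ∀ x, f x ≤ T.eval (len x)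

theorem PolyB.mono {f g : X → ℕ} (hg : PolyB g) (h : ∀ x, f x ≤ g x) : PolyB f :=
  let ⟨T, hT⟩ := hg
  ⟨T, fun x => (h x).trans (hT x)⟩

theorem PolyB.const (c : ℕ) : PolyB fun _ : X => c := ⟨Polynomial.C c, fun x => by simp⟩

theorem PolyB.len : PolyB fun x : X => World.len x := ⟨Polynomial.X, fun x => by simp⟩

theorem PolyB.add {f g : X → ℕ} (hf : PolyB f) (hg : PolyB g) : PolyB fun x => f x + g x :=
  let ⟨T, hT⟩ := hf
  let ⟨U, hU⟩ := hg
  ⟨T + U, fun x => by simpa using add_le_add (hT x) (hU x)⟩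

theorem PolyB.mul {f g : X → ℕ} (hf : PolyB f) (hg : PolyB g) : PolyB fun x => f x * g x :=
  let ⟨T, hT⟩ := hf
  let ⟨U, hU⟩ := hg
  ⟨T * U, fun x => by simpa using Nat.mul_le_mul (hT x) (hU x)⟩

theorem PolyB.eval {f : X → ℕ} (hf : PolyB f) (p : Polynomial ℕ) :
    PolyB fun x => p.eval (f x) :=
  let ⟨T, hT⟩ := hf
  ⟨p.comp T, fun x => by simpa [Polynomial.eval_comp] using polyEval_mono p (hT x)⟩

/-- The state `t` results from `s` by storing `v` in register `d` within time `τ`, leaving the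
registers below `d` as they are. -/
structure Evals (s : State) (d v τ : ℕ) (t : State) : Prop where
  low : ∀ i < d, t.reg i = s.reg i
  val : t.reg d = v
  coins : t.coins = s.coins
  time : t.time ≤ s.time + τ

/-- `f` is computed in polynomial time from the variables `V`. The program is given the locations
of the variables and the first register that it may use, where it leaves the result. -/
def PT (V : ℕ → X → ℕ) (f : X → ℕ) : Prop :=
  ∃ (T : Polynomial ℕ) (P : (ℕ → ℕ) → ℕ → Prog), ∀ x : X, (f x).size ≤ T.eval (len x) ∧
    ∀ (loc : ℕ → ℕ) (d : ℕ) (s : State), (∀ i, loc i < d ∧ s.reg (loc i) = V i x) →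
      ∃ t, Exec (orc x) (prf x) (P loc d) s t ∧ Evals s d (f x) (T.eval (len x)) t

/-! ### Effect and cost of single instructions. -/

section Instructions

variable {O : Oracle} {π : List Bool}

theorem exec_const (s : State) (i c : ℕ) : ∃ t, Exec O π (.const i c) s t ∧
    t.reg = Function.update s.reg i c ∧ t.coins = s.coins ∧ t.time = s.time + (1 + c.size) :=
  ⟨_, .const s i c, rfl, rfl, by simp only; omega⟩

theorem exec_op (s : State) (o : Op) (i j k : ℕ) : ∃ t, Exec O π (.op o i j k) s t ∧
    t.reg = Function.update s.reg i (o.eval (s.reg j) (s.reg k)) ∧ t.coins = s.coins ∧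
    t.time = s.time + (1 + (s.reg j).size + (s.reg k).size) :=
  ⟨_, .op s o i j k, rfl, rfl, by simp only; omega⟩

theorem exec_oracle (s : State) (i j : ℕ) : ∃ t, Exec O π (.oracle i j) s t ∧
    t.reg = Function.update s.reg i (O (decodeStr (s.reg j))).toNat ∧ t.coins = s.coins ∧
    t.time = s.time + (1 + (s.reg j).size) :=
  ⟨_, .oracle s i j, rfl, rfl, by simp only; omega⟩

theorem exec_proof (s : State) (i j : ℕ) : ∃ t, Exec O π (.proof i j) s t ∧
    t.reg = Function.update s.reg i (π.getD (s.reg j) false).toNat ∧ t.coins = s.coins ∧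
    t.time = s.time + (1 + (s.reg j).size) :=
  ⟨_, .proof s i j, rfl, rfl, by simp only; omega⟩

theorem size_op_le (o : Op) (a b : ℕ) : (o.eval a b).size ≤ a.size + b.size + 1 := by
  have ha := Nat.lt_size_self a
  have hb := Nat.lt_size_self b
  cases o with
  | add =>
    rw [Nat.size_le]
    have h1 : 2 ^ a.size ≤ 2 ^ (a.size + b.size) := Nat.pow_le_pow_right (by norm_num) (by omega)
    have h2 : 2 ^ b.size ≤ 2 ^ (a.size + b.size) := Nat.pow_le_pow_right (by norm_num) (by omega)
    simp only [Op.eval, pow_succ]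
    omega
  | sub => exact (Nat.size_le_size (Nat.sub_le a b)).trans (by omega)
  | mul =>
    rw [Nat.size_le]
    simp only [Op.eval]
    calc a * b < 2 ^ a.size * 2 ^ b.size := Nat.mul_lt_mul'' ha hb
      _ = 2 ^ (a.size + b.size) := (pow_add ..).symm
      _ ≤ _ := Nat.pow_le_pow_right (by norm_num) (by omega)
  | div => exact (Nat.size_le_size (Nat.div_le_self a b)).trans (by omega)

theorem size_toNat_le (b : Bool) : b.toNat.size ≤ 1 := by cases b <;> simp

end Instructions

/-! ### Closure of `PT` under instructions, branching and change of variables. -/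

namespace PT

variable {V : ℕ → X → ℕ} {f g h : X → ℕ}

theorem polyB_size (hf : PT V f) : PolyB fun x => (f x).size :=
  let ⟨T, _, h⟩ := hf
  ⟨T, fun x => (h x).1⟩

theorem congr (hf : PT V f) (h : ∀ x, f x = g x) : PT V g := by
  rwa [show g = f from funext fun x => (h x).symm]

theorem const (V : ℕ → X → ℕ) (c : ℕ) : PT V fun _ => c := by
  refine ⟨Polynomial.C (1 + c.size), fun _ d => .const d c, fun _ => ⟨by simp, ?_⟩⟩
  intro loc d s _
  obtain ⟨t, ht, hr, hc, hτ⟩ := exec_const s d c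
  refine ⟨t, ht, fun i hi => ?_, ?_, hc, by simp [hτ]⟩
  · simp [hr, Function.update, hi.ne]
  · simp [hr]

theorem op (o : Op) (hf : PT V f) (hg : PT V g) : PT V fun x => o.eval (f x) (g x) := by
  obtain ⟨Tf, Pf, hf⟩ := hf
  obtain ⟨Tg, Pg, hg⟩ := hg
  refine ⟨Tf + Tf + Tg + Tg + 1,
    fun loc d => .seq (Pf loc d) (.seq (Pg loc (d + 1)) (.op o d d (d + 1))), fun x => ⟨?_, ?_⟩⟩
  · have := size_op_le o (f x) (g x)
    have h1 := (hf x).1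
    have h2 := (hg x).1
    simp only [Polynomial.eval_add, Polynomial.eval_one]
    omega
  · intro loc d s hs
    obtain ⟨t1, e1, r1⟩ := (hf x).2 loc d s hs
    obtain ⟨t2, e2, r2⟩ := (hg x).2 loc (d + 1) t1 fun i =>
      ⟨(hs i).1.trans (Nat.lt_succ_self d), by rw [r1.low _ (hs i).1, (hs i).2]⟩
    obtain ⟨t3, e3, hr, hc, hτ⟩ := exec_op (O := orc x) (π := prf x) t2 o d d (d + 1)
    have hd : t2.reg d = f x := by rw [r2.low _ (Nat.lt_succ_self d), r1.val]
    refine ⟨t3, .seq e1 (.seq e2 e3), fun i hi => ?_, ?_, ?_, ?_⟩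
    · simp [hr, Function.update, hi.ne, r2.low i (hi.trans (Nat.lt_succ_self d)), r1.low i hi]
    · simp [hr, hd, r2.val]
    · rw [hc, r2.coins, r1.coins]
    · have h1 := (hf x).1
      have h2 := (hg x).1
      have h3 := r1.time
      have h4 := r2.time
      rw [hd, r2.val] at hτ
      simp only [Polynomial.eval_add, Polynomial.eval_one]
      omega

theorem add (hf : PT V f) (hg : PT V g) : PT V fun x => f x + g x := op .add hf hg

theorem sub (hf : PT V f) (hg : PT V g) : PT V fun x => f x - g x := op .sub hf hg

theorem mul (hf : PT V f) (hg : PT V g) : PT V fun x => f x * g x := op .mul hf hg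

theorem div (hf : PT V f) (hg : PT V g) : PT V fun x => f x / g x := op .div hf hg

theorem mod (hf : PT V f) (hg : PT V g) : PT V fun x => f x % g x :=
  (hf.sub (hg.mul (hf.div hg))).congr fun _ => (Nat.mod_eq_sub_mul_div ..).symm

theorem oracle (hf : PT V f) : PT V fun x => (orc x (decodeStr (f x))).toNat := by
  obtain ⟨Tf, Pf, hf⟩ := hf
  refine ⟨Tf + Tf + 1, fun loc d => .seq (Pf loc d) (.oracle d d), fun x => ⟨?_, ?_⟩⟩
  · refine (size_toNat_le _).trans ?_
    simp only [Polynomial.eval_add, Polynomial.eval_one]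
    omega
  · intro loc d s hs
    obtain ⟨t1, e1, r1⟩ := (hf x).2 loc d s hs
    obtain ⟨t2, e2, hr, hc, hτ⟩ := exec_oracle (O := orc x) (π := prf x) t1 d d
    refine ⟨t2, .seq e1 e2, fun i hi => ?_, ?_, ?_, ?_⟩
    · simp [hr, Function.update, hi.ne, r1.low i hi]
    · simp [hr, r1.val]
    · rw [hc, r1.coins]
    · have h1 := (hf x).1
      have h3 := r1.time
      rw [r1.val] at hτ
      simp only [Polynomial.eval_add, Polynomial.eval_one]
      omega

theorem proof (hf : PT V f) : PT V fun x => ((prf x).getD (f x) false).toNat := by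
  obtain ⟨Tf, Pf, hf⟩ := hf
  refine ⟨Tf + Tf + 1, fun loc d => .seq (Pf loc d) (.proof d d), fun x => ⟨?_, ?_⟩⟩
  · refine (size_toNat_le _).trans ?_
    simp only [Polynomial.eval_add, Polynomial.eval_one]
    omega
  · intro loc d s hs
    obtain ⟨t1, e1, r1⟩ := (hf x).2 loc d s hs
    obtain ⟨t2, e2, hr, hc, hτ⟩ := exec_proof (O := orc x) (π := prf x) t1 d d
    refine ⟨t2, .seq e1 e2, fun i hi => ?_, ?_, ?_, ?_⟩
    · simp [hr, Function.update, hi.ne, r1.low i hi]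
    · simp only [hr, r1.val, Function.update_self]
    · rw [hc, r1.coins]
    · have h1 := (hf x).1
      have h3 := r1.time
      rw [r1.val] at hτ
      simp only [Polynomial.eval_add, Polynomial.eval_one]
      omega

theorem ite_ne (hf : PT V f) (hg : PT V g) (hh : PT V h) :
    PT V fun x => if f x ≠ 0 then g x else h x := by
  obtain ⟨Tf, Pf, hf⟩ := hf
  obtain ⟨Tg, Pg, hg⟩ := hg
  obtain ⟨Th, Ph, hh⟩ := hh
  refine ⟨Tf + Tf + Tg + Th + 1,
    fun loc d => .seq (Pf loc d) (.ite d (Pg loc d) (Ph loc d)), fun x => ⟨?_, ?_⟩⟩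
  · have h1 := (hg x).1
    have h2 := (hh x).1
    simp only [Polynomial.eval_add, Polynomial.eval_one]
    split_ifs <;> omega
  · intro loc d s hs
    obtain ⟨t1, e1, r1⟩ := (hf x).2 loc d s hs
    have hs' : ∀ i, loc i < d ∧ t1.reg (loc i) = V i x := fun i =>
      ⟨(hs i).1, by rw [r1.low _ (hs i).1, (hs i).2]⟩
    have h1 := (hf x).1
    have h3 := r1.time
    by_cases h0 : f x = 0
    · obtain ⟨t2, e2, r2⟩ := (hh x).2 loc d
        { t1 with time := t1.time + 1 + (t1.reg d).size } hs'
      refine ⟨t2, .seq e1 (.ite_false (by rw [r1.val, h0]) e2), fun i hi => ?_, ?_, ?_, ?_⟩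
      · rw [r2.low i hi, ← r1.low i hi]
      · simp [r2.val, h0]
      · rw [r2.coins, ← r1.coins]
      · have h4 := r2.time
        rw [r1.val] at h4
        simp only [Polynomial.eval_add, Polynomial.eval_one] at h4 ⊢
        omega
    · obtain ⟨t2, e2, r2⟩ := (hg x).2 loc d
        { t1 with time := t1.time + 1 + (t1.reg d).size } hs'
      refine ⟨t2, .seq e1 (.ite_true (by rwa [r1.val]) e2), fun i hi => ?_, ?_, ?_, ?_⟩
      · rw [r2.low i hi, ← r1.low i hi]
      · simp [r2.val, h0]
      · rw [r2.coins, ← r1.coins]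
      · have h4 := r2.time
        rw [r1.val] at h4
        simp only [Polynomial.eval_add, Polynomial.eval_one] at h4 ⊢
        omega

theorem var (V : ℕ → X → ℕ) (i : ℕ) (hi : PolyB fun x => (V i x).size) : PT V (V i) := by
  obtain ⟨T, hT⟩ := hi
  -- There is no copy instruction; a register is copied by adding it to zero.
  refine ⟨T + 2, fun loc d => .seq (.const d 0) (.op .add d (loc i) d), fun x => ⟨?_, ?_⟩⟩
  · exact (hT x).trans (by simp)
  · intro loc d s hs
    obtain ⟨t1, e1, hr1, hc1, hτ1⟩ := exec_const (O := orc x) (π := prf x) s d 0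
    obtain ⟨t2, e2, hr2, hc2, hτ2⟩ := exec_op (O := orc x) (π := prf x) t1 .add d (loc i) d
    have hl : t1.reg (loc i) = V i x := by simp [hr1, Function.update, (hs i).1.ne, (hs i).2]
    have hd : t1.reg d = 0 := by simp [hr1]
    refine ⟨t2, .seq e1 e2, fun i hi => ?_, ?_, ?_, ?_⟩
    · simp [hr2, hr1, Function.update, hi.ne]
    · simp [hr2, hl, hd, Op.eval]
    · rw [hc2, hc1]
    · rw [hl, hd] at hτ2
      have h1 : (V i x).size ≤ T.eval (len x) := hT x
      have h2 : (T + 2).eval (len x) = T.eval (len x) + 2 := by simp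
      rw [hτ2, hτ1, h2, Nat.size_zero]
      omega

/-- Change of variables along a map of worlds. -/
theorem pullback {Y : Type} [World Y] {V' : ℕ → Y → ℕ} (φ : Y → X)
    (ho : ∀ y, orc (φ y) = orc y) (hp : ∀ y, prf (φ y) = prf y) (hl : ∀ y, len (φ y) = len y)
    (r : ℕ → ℕ) (hr : ∀ i y, V' (r i) y = V i (φ y)) (hf : PT V f) :
    PT V' fun y => f (φ y) := by
  obtain ⟨T, P, h⟩ := hf
  refine ⟨T, fun loc d => P (loc ∘ r) d, fun y => ⟨by rw [← hl]; exact (h _).1, ?_⟩⟩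
  intro loc d s hs
  have := (h (φ y)).2 (loc ∘ r) d s fun i => ⟨(hs (r i)).1, by simp [(hs (r i)).2, hr]⟩
  rwa [ho, hp, hl] at this

end PT

/-- The parameters of the body of a loop: those of the loop, and the number of the round. -/
structure Ext {X : Type} (cnt : X → ℕ) where
  base : X
  idx : ℕ
  lt : idx < cnt base

instance {cnt : X → ℕ} : World (Ext cnt) where
  orc p := orc p.base
  prf p := prf p.base
  len p := len p.base

/-- The variables in the body of a loop: the number of the round, the state, and those of the
loop. -/
def extVars {cnt : X → ℕ} (V : ℕ → X → ℕ) (σ : X → ℕ → ℕ) : ℕ → Ext cnt → ℕ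
  | 0, p => p.idx
  | 1, p => σ p.base p.idx
  | i + 2, p => V i p.base

theorem PolyB.ext {f : X → ℕ} (hf : PolyB f) {cnt : X → ℕ} :
    PolyB fun p : Ext cnt => f p.base :=
  let ⟨T, hT⟩ := hf
  ⟨T, fun p => hT p.base⟩

theorem PolyB.idx {cnt : X → ℕ} (hc : PolyB cnt) : PolyB fun p : Ext cnt => p.idx :=
  hc.ext.mono fun p => p.lt.le

theorem size_le_self (n : ℕ) : n.size ≤ n := Nat.size_le.2 Nat.lt_two_pow_self

/-- The number of rounds needs only a polynomial bound and is not computed beforehand: the guard `G`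
ends the loop. The size of the state is bounded in all rounds by hypothesis, since repeated squaring
would make it exponential. Quantifying over `V'` in `hs` hides where the body keeps its variables;
it may use the round, the state and lifted computations. -/
theorem PT.whileLoop {V : ℕ → X → ℕ} {cnt : X → ℕ} (σ G : X → ℕ → ℕ) (hc : PolyB cnt)
    (hσ : ∃ T : Polynomial ℕ, ∀ x, ∀ i ≤ cnt x, (σ x i).size ≤ T.eval (len x))
    (hG : ∀ x, ∀ i < cnt x, G x i ≠ 0) (hG' : ∀ x, G x (cnt x) = 0)
    (h0 : PT V fun x => σ x 0) (g0 : PT V fun x => G x 0)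
    (hs : ∀ V' : ℕ → Ext cnt → ℕ, PT V' Ext.idx → PT V' (fun p => σ p.base p.idx) →
      (∀ f, PT V f → PT V' fun p => f p.base) →
      PT V' (fun p => σ p.base (p.idx + 1)) ∧ PT V' (fun p => G p.base (p.idx + 1))) :
    PT V fun x => σ x (cnt x) := by
  obtain ⟨h1, g1⟩ := hs (extVars V σ)
    (PT.var (extVars V σ) 0 (hc.idx.mono fun p => size_le_self _))
    (PT.var (extVars V σ) 1 (let ⟨T, hT⟩ := hσ; ⟨T, fun p => hT p.base p.idx p.lt.le⟩))
    (fun f hf => hf.pullback Ext.base (fun _ => rfl) (fun _ => rfl) (fun _ => rfl)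
      (fun i => i + 2) fun _ _ => rfl)
  obtain ⟨Tc, hTc⟩ := hc
  obtain ⟨Tσ, hTσ⟩ := hσ
  obtain ⟨T0, P0, h0⟩ := h0
  obtain ⟨U0, Q0, g0⟩ := g0
  obtain ⟨T1, P1, h1⟩ := h1
  obtain ⟨U1, Q1, g1⟩ := g1
  -- Registers: state in `d`, guard in `d + 1`, round in `d + 2`. The new state and guard are first
  -- put into `d + 3` and `d + 4`, so that both are computed from the old state; `d + 5` holds
  -- constants.
  let loc' : (ℕ → ℕ) → ℕ → ℕ → ℕ := fun loc d i =>
    match i with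
    | 0 => d + 2
    | 1 => d
    | i + 2 => loc i
  let body : (ℕ → ℕ) → ℕ → Prog := fun loc d =>
    .seq (P1 (loc' loc d) (d + 3)) (.seq (Q1 (loc' loc d) (d + 4)) (.seq (.const (d + 5) 0)
      (.seq (.op .add d (d + 3) (d + 5)) (.seq (.op .add (d + 1) (d + 4) (d + 5))
        (.seq (.const (d + 5) 1) (.op .add (d + 2) (d + 2) (d + 5)))))))
  -- The cost of a round together with the guard test before it. The size of the first guard is
  -- bounded by `U0`, that of the later ones by `U1`.
  let B : X → ℕ := fun x => 2 * T1.eval (len x) + 3 * U1.eval (len x) + Tc.eval (len x) + 20 +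
    U0.eval (len x)
  have hbody : ∀ x i, i < cnt x → ∀ loc d s, (∀ i, loc i < d ∧ s.reg (loc i) = V i x) →
      s.reg d = σ x i → s.reg (d + 2) = i →
      ∃ t, Exec (orc x) (prf x) (body loc d) s t ∧ (∀ j < d, t.reg j = s.reg j) ∧
        t.reg d = σ x (i + 1) ∧ t.reg (d + 1) = G x (i + 1) ∧ t.reg (d + 2) = i + 1 ∧
        t.coins = s.coins ∧ t.time + (1 + (G x i).size) ≤ s.time + B x := by
    intro x i hi loc d s hs hsσ hsi
    have hp1 := h1 ⟨x, i, hi⟩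
    have hq1 := g1 ⟨x, i, hi⟩
    simp only [show (orc (⟨x, i, hi⟩ : Ext cnt)) = orc x from rfl,
      show (prf (⟨x, i, hi⟩ : Ext cnt)) = prf x from rfl,
      show (len (⟨x, i, hi⟩ : Ext cnt)) = len x from rfl] at hp1 hq1
    obtain ⟨t1, e1, r1⟩ := hp1.2 (loc' loc d) (d + 3) s (by
      rintro (_ | _ | j)
      · exact ⟨by simp [loc'], hsi⟩
      · exact ⟨by simp [loc'], hsσ⟩
      · exact ⟨by have := (hs j).1; simp only [loc']; omega, (hs j).2⟩)
    obtain ⟨t2, e2, r2⟩ := hq1.2 (loc' loc d) (d + 4) t1 (by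
      rintro (_ | _ | j)
      · exact ⟨by simp [loc'], (r1.low _ (by simp [loc'])).trans hsi⟩
      · exact ⟨by simp [loc'], (r1.low _ (by simp [loc'])).trans hsσ⟩
      · have := (hs j).1
        exact ⟨by simp only [loc']; omega, (r1.low _ (by simp only [loc']; omega)).trans (hs j).2⟩)
    obtain ⟨t3, e3, m3, c3, τ3⟩ := exec_const (O := orc x) (π := prf x) t2 (d + 5) 0
    obtain ⟨t4, e4, m4, c4, τ4⟩ := exec_op (O := orc x) (π := prf x) t3 .add d (d + 3) (d + 5)
    obtain ⟨t5, e5, m5, c5, τ5⟩ :=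
      exec_op (O := orc x) (π := prf x) t4 .add (d + 1) (d + 4) (d + 5)
    obtain ⟨t6, e6, m6, c6, τ6⟩ := exec_const (O := orc x) (π := prf x) t5 (d + 5) 1
    obtain ⟨t7, e7, m7, c7, τ7⟩ :=
      exec_op (O := orc x) (π := prf x) t6 .add (d + 2) (d + 2) (d + 5)
    have v3 : t2.reg (d + 3) = σ x (i + 1) := (r2.low _ (by omega)).trans r1.val
    have v4 : t2.reg (d + 4) = G x (i + 1) := r2.val
    have v2 : t2.reg (d + 2) = i := (r2.low _ (by omega)).trans ((r1.low _ (by omega)).trans hsi)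
    have low : ∀ j < d, t2.reg j = s.reg j := fun j hj =>
      (r2.low _ (by omega)).trans (r1.low _ (by omega))
    refine ⟨t7, .seq e1 (.seq e2 (.seq e3 (.seq e4 (.seq e5 (.seq e6 e7))))), ?_, ?_, ?_, ?_, ?_,
      ?_⟩
    · intro j hj
      rw [← low j hj]
      simp [m7, m6, m5, m4, m3, Function.update, hj.ne, show j ≠ d + 5 by omega,
        show j ≠ d + 1 by omega, show j ≠ d + 2 by omega]
    · simp [m7, m6, m5, m4, m3, Function.update, Op.eval, v3]
    · simp [m7, m6, m5, m4, m3, Function.update, Op.eval, v4]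
    · simp [m7, m6, m5, m4, m3, Function.update, Op.eval, v2]
    · rw [c7, c6, c5, c4, c3, r2.coins, r1.coins]
    · have hG1 : (G x i).size ≤ U0.eval (len x) + U1.eval (len x) := by
        cases i with
        | zero => exact (g0 x).1.trans (by omega)
        | succ i => exact (g1 ⟨x, i, by omega⟩).1.trans (Nat.le_add_left _ _)
      have b1 := r1.time
      have b2 := r2.time
      have z1 := hp1.1
      have z2 := hq1.1
      have z3 := (size_le_self i).trans (hi.le.trans (hTc x))
      simp [m6, m5, m4, m3, Function.update, v2, v3, v4] at τ3 τ4 τ5 τ6 τ7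
      simp only [B]
      omega
  have hloop : ∀ x m i, i + m = cnt x → ∀ loc d s, (∀ i, loc i < d ∧ s.reg (loc i) = V i x) →
      s.reg d = σ x i → s.reg (d + 1) = G x i → s.reg (d + 2) = i →
      ∃ t, Exec (orc x) (prf x) (.loop (d + 1) (body loc d)) s t ∧ (∀ j < d, t.reg j = s.reg j) ∧
        t.reg d = σ x (cnt x) ∧ t.coins = s.coins ∧ t.time ≤ s.time + m * B x + 1 := by
    intro x m
    induction m with
    | zero =>
      intro i hi loc d s hs hsσ hsG hsi
      obtain rfl : i = cnt x := by omega
      rw [hG'] at hsG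
      exact ⟨_, .loop_done hsG, fun _ _ => rfl, hsσ, rfl, by simp [hsG]⟩
    | succ m ih =>
      intro i hi loc d s hs hsσ hsG hsi
      have hne : s.reg (d + 1) ≠ 0 := by rw [hsG]; exact hG x i (by omega)
      obtain ⟨t1, e1, l1, a1, b1, d1, c1, τ1⟩ := hbody x i (by omega) loc d
        { s with time := s.time + 1 + (s.reg (d + 1)).size } hs hsσ hsi
      obtain ⟨t2, e2, l2, a2, c2, τ2⟩ := ih (i + 1) (by omega) loc d t1
        (fun j => ⟨(hs j).1, (l1 _ (hs j).1).trans (hs j).2⟩) a1 b1 d1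
      refine ⟨t2, .loop_step hne e1 e2, fun j hj => (l2 j hj).trans (l1 j hj), a2, c2.trans c1, ?_⟩
      simp only [hsG] at τ1
      rw [Nat.add_mul]
      omega
  refine ⟨T0 + U0 + Tσ + 4 +
      Tc * (2 * T1 + 3 * U1 + Tc + 20 + U0),
    fun loc d => .seq (P0 loc d) (.seq (Q0 loc (d + 1)) (.seq (.const (d + 2) 0)
      (.loop (d + 1) (body loc d)))), fun x => ⟨?_, ?_⟩⟩
  · have := hTσ x (cnt x) le_rfl
    simp only [Polynomial.eval_add]
    omega
  · intro loc d s hs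
    obtain ⟨t1, e1, r1⟩ := (h0 x).2 loc d s hs
    obtain ⟨t2, e2, r2⟩ := (g0 x).2 loc (d + 1) t1 fun i =>
      ⟨(hs i).1.trans (Nat.lt_succ_self d), by rw [r1.low _ (hs i).1, (hs i).2]⟩
    obtain ⟨t3, e3, m3, c3, τ3⟩ := exec_const (O := orc x) (π := prf x) t2 (d + 2) 0
    have low : ∀ j < d, t3.reg j = s.reg j := fun j hj => by
      rw [m3, Function.update_of_ne (by omega), r2.low _ (by omega), r1.low _ hj]
    obtain ⟨t4, e4, l4, a4, c4, τ4⟩ := hloop x (cnt x) 0 (by omega) loc d t3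
      (fun j => ⟨(hs j).1, (low _ (hs j).1).trans (hs j).2⟩)
      (by rw [m3, Function.update_of_ne (by omega), r2.low _ (by omega), r1.val])
      (by rw [m3, Function.update_of_ne (by omega), r2.val]) (by simp [m3])
    refine ⟨t4, .seq e1 (.seq e2 (.seq e3 e4)), fun j hj => (l4 j hj).trans (low j hj), a4,
      by rw [c4, c3, r2.coins, r1.coins], ?_⟩
    have b1 := r1.time
    have b2 := r2.time
    have b3 := Nat.mul_le_mul_right (B x) (hTc x)
    simp only [Nat.size_zero] at τ3
    simp only [Polynomial.eval_add, Polynomial.eval_mul, Polynomial.eval_ofNat, B] at b3 τ4 ⊢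
    omega

end OraclePCP

namespace OraclePCP
open World
variable {X : Type} [World X]

/-! ### Counted loops, powers of two, bit lengths, sums and polynomials. -/

namespace PT

variable {V : ℕ → X → ℕ}

theorem forLoop {cnt : X → ℕ} (σ : X → ℕ → ℕ) (hcnt : PT V cnt) (hc : PolyB cnt)
    (hσ : ∃ T : Polynomial ℕ, ∀ x, ∀ i ≤ cnt x, (σ x i).size ≤ T.eval (len x))
    (h0 : PT V fun x => σ x 0)
    (hs : ∀ V' : ℕ → Ext cnt → ℕ, PT V' Ext.idx → PT V' (fun p => σ p.base p.idx) →
      (∀ f, PT V f → PT V' fun p => f p.base) → PT V' (fun p => σ p.base (p.idx + 1))) :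
    PT V fun x => σ x (cnt x) :=
  whileLoop σ (fun x i => cnt x - i) hc hσ (fun x i hi => by omega) (fun x => by simp) h0 hcnt
    fun V' hi hst lift => ⟨hs V' hi hst lift, (lift _ hcnt).sub (hi.add (const V' 1))⟩

theorem two_pow {k : X → ℕ} (hk : PT V k) (hc : PolyB k) : PT V fun x => 2 ^ k x :=
  forLoop (fun _ i => 2 ^ i) hk hc
    (let ⟨T, hT⟩ := hc
    ⟨T + 1, fun x i hi => by
      have := hT x
      simp only [Nat.size_pow, Polynomial.eval_add, Polynomial.eval_one]
      omega⟩)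
    (const V _) fun V' _ hst _ => (hst.add hst).congr fun p => by rw [pow_succ]; omega

/-- The bit length is the number of halvings that lead to zero, so here the guard determines the
number of rounds. -/
theorem size {f : X → ℕ} (hf : PT V f) : PT V fun x => (f x).size :=
  whileLoop (fun _ i => i) (fun x i => f x / 2 ^ i) hf.polyB_size
    (let ⟨T, hT⟩ := hf.polyB_size
    ⟨T, fun x _ hi => (size_le_self _).trans (hi.trans (hT x))⟩)
    (fun x i hi => by
      have : 2 ^ i ≤ f x := Nat.lt_size.1 hi
      exact (Nat.div_pos this (by positivity)).ne')
    (fun x => Nat.div_eq_of_lt (Nat.lt_size_self _)) (const V 0) (hf.congr fun x => by simp)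
    fun V' hi _ lift => ⟨hi.add (const V' 1),
      (lift _ hf).div (two_pow (hi.add (const V' 1))
        ((hf.polyB_size.idx).add (PolyB.const 1)))⟩

theorem bsum {cnt : X → ℕ} (f : X → ℕ → ℕ) (hcnt : PT V cnt) (hc : PolyB cnt)
    (hf : ∀ V' : ℕ → Ext cnt → ℕ, PT V' Ext.idx → (∀ g, PT V g → PT V' fun p => g p.base) →
      PT V' (fun p => f p.base p.idx)) :
    PT V fun x => ∑ i ∈ Finset.range (cnt x), f x i := by
  refine forLoop (fun x i => ∑ j ∈ Finset.range i, f x j) hcnt hc ?_ (const V 0) ?_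
  -- A size bound common to all summands comes from computing them over `Ext cnt`; the state is
  -- irrelevant there and is set to zero.
  · obtain ⟨T, hT⟩ := (hf (extVars V fun _ _ => 0)
      (PT.var (extVars V fun _ _ => 0) 0 (hc.idx.mono fun p => size_le_self _))
      (fun f hf => hf.pullback Ext.base (fun _ => rfl) (fun _ => rfl) (fun _ => rfl)
        (fun i => i + 2) fun _ _ => rfl)).polyB_size
    obtain ⟨U, hU⟩ := hc
    refine ⟨T + U, fun x i hi => ?_⟩
    have h1 : ∀ j ∈ Finset.range i, f x j ≤ 2 ^ T.eval (len x) := fun j hj =>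
      (Nat.size_le.1 (hT ⟨x, j, (Finset.mem_range.1 hj).trans_le hi⟩)).le
    have h2 : f x |> fun g => ∑ j ∈ Finset.range i, g j ≤ i * 2 ^ T.eval (len x) := by
      simpa using Finset.sum_le_card_nsmul _ _ _ h1
    rw [Nat.size_le, Polynomial.eval_add, pow_add, mul_comm]
    refine h2.trans_lt (Nat.mul_lt_mul_of_pos_right ?_ (by positivity))
    exact (hi.trans (hU x)).trans_lt Nat.lt_two_pow_self
  · intro V' hi hst lift
    exact (hst.add (hf V' hi lift)).congr fun p => (Finset.sum_range_succ _ _).symm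

theorem fintypeSum {ι : Type*} (s : Finset ι) (f : ι → X → ℕ) (h : ∀ i ∈ s, PT V (f i)) :
    PT V fun x => ∑ i ∈ s, f i x := by
  classical
  induction s using Finset.induction_on with
  | empty => exact const V 0
  | insert a s ha ih =>
    exact ((h a (by simp)).add (ih fun i hi => h i (by simp [hi]))).congr fun x =>
      (Finset.sum_insert (f := fun i => f i x) ha).symm

theorem pow_const {f : X → ℕ} (hf : PT V f) (n : ℕ) : PT V fun x => f x ^ n := by
  induction n with
  | zero => exact const V 1
  | succ n ih => exact (ih.mul hf).congr fun x => (pow_succ _ _).symm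

theorem eval {f : X → ℕ} (hf : PT V f) (p : Polynomial ℕ) : PT V fun x => p.eval (f x) := by
  induction p using Polynomial.induction_on' with
  | add p q hp hq => exact (hp.add hq).congr fun x => by simp
  | monomial n c => exact ((const V c).mul (hf.pow_const n)).congr fun x => by simp

end PT

/-- The property `p` is decided in polynomial time from the variables `V`. -/
def PD (V : ℕ → X → ℕ) (p : X → Prop) : Prop := ∃ f, PT V f ∧ ∀ x, f x ≠ 0 ↔ p x

namespace PD

variable {V : ℕ → X → ℕ} {p q : X → Prop} {f g : X → ℕ}

theorem congr (hp : PD V p) (h : ∀ x, p x ↔ q x) : PD V q :=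
  let ⟨f, hf, e⟩ := hp
  ⟨f, hf, fun x => (e x).trans (h x)⟩

theorem le (hf : PT V f) (hg : PT V g) : PD V fun x => f x ≤ g x :=
  ⟨_, (PT.const V 1).sub (hf.sub hg), fun x => by omega⟩

theorem not (hp : PD V p) : PD V fun x => ¬ p x :=
  let ⟨_, hf, e⟩ := hp
  ⟨_, (PT.const V 1).sub hf, fun x => by have := e x; simp only [← this]; omega⟩

theorem and (hp : PD V p) (hq : PD V q) : PD V fun x => p x ∧ q x :=
  let ⟨_, hf, e⟩ := hp
  let ⟨_, hg, e'⟩ := hq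
  ⟨_, hf.mul hg, fun x => by simp only [← e x, ← e' x]; exact mul_ne_zero_iff⟩

theorem imp (hp : PD V p) (hq : PD V q) : PD V fun x => p x → q x :=
  (hp.and hq.not).not.congr fun x => by tauto

theorem lt (hf : PT V f) (hg : PT V g) : PD V fun x => f x < g x :=
  (le hg hf).not.congr fun x => by omega

theorem eq (hf : PT V f) (hg : PT V g) : PD V fun x => f x = g x :=
  ((le hf hg).and (le hg hf)).congr fun x => by omega

theorem ite (hp : PD V p) [DecidablePred p] (hf : PT V f) (hg : PT V g) :
    PT V fun x => if p x then f x else g x :=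
  let ⟨_, hb, e⟩ := hp
  (hb.ite_ne hf hg).congr fun x => by simp only [e]

/-- The number of counterexamples is a bounded sum, and the property holds when this sum vanishes.
-/
theorem ball {cnt : X → ℕ} (r : X → ℕ → Prop) (hcnt : PT V cnt) (hc : PolyB cnt)
    (hr : ∀ V' : ℕ → Ext cnt → ℕ, PT V' Ext.idx → (∀ g, PT V g → PT V' fun p => g p.base) →
      PD V' (fun p => r p.base p.idx)) :
    PD V fun x => ∀ i < cnt x, r x i := by
  classical
  refine ((eq (PT.bsum (fun x i => if r x i then 0 else 1) hcnt hc fun V' hi lift =>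
    (hr V' hi lift).ite (PT.const V' 0) (PT.const V' 1)) (PT.const V 0))).congr fun x => ?_
  simp [Finset.sum_eq_zero_iff]

theorem finsetAll {ι : Type*} (s : Finset ι) (r : ι → X → Prop) (h : ∀ i ∈ s, PD V (r i)) :
    PD V fun x => ∀ i ∈ s, r i x := by
  classical
  induction s using Finset.induction_on with
  | empty => exact ⟨_, PT.const V 1, fun x => by simp⟩
  | insert a s ha ih =>
    exact ((h a (by simp)).and (ih fun i hi => h i (by simp [hi]))).congr fun x => by simp

end PD

/-! ### Programs on unary inputs as subprograms -/

/-- The program that mentions only registers below the returned bound. -/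
def Prog.bound : Prog → ℕ
  | .const i _ => i + 1
  | .op _ i j k => i + j + k + 1
  | .coin i => i + 1
  | .oracle i j => i + j + 1
  | .proof i j => i + j + 1
  | .seq P Q => P.bound + Q.bound
  | .ite i P Q => i + 1 + P.bound + Q.bound
  | .loop i P => i + 1 + P.bound

/-- The program with all registers moved up by `d` and all queries answered by `0`. -/
def Prog.shift (d : ℕ) : Prog → Prog
  | .const i c => .const (i + d) c
  | .op o i j k => .op o (i + d) (j + d) (k + d)
  | .coin i => .coin (i + d)
  | .oracle i _ => .const (i + d) 0
  | .proof i _ => .const (i + d) 0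
  | .seq P Q => .seq (P.shift d) (Q.shift d)
  | .ite i P Q => .ite (i + d) (P.shift d) (Q.shift d)
  | .loop i P => .loop (i + d) (P.shift d)

theorem Exec.coins_nil {O : Oracle} {π : List Bool} {P : Prog} {s t : State} (h : Exec O π P s t)
    (hs : s.coins = []) : t.coins = [] := by
  induction h with
  | coin s i b ρ h => simp [hs] at h
  | seq _ _ ih1 ih2 => exact ih2 (ih1 hs)
  | ite_true _ _ ih => exact ih hs
  | ite_false _ _ ih => exact ih hs
  | loop_step _ _ _ ih1 ih2 => exact ih2 (ih1 hs)
  | _ => exact hs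

/-- A query costs at least one unit of time, so a time bound is also a bound on the number of
queries. -/
theorem Exec.proofQueries_le {O : Oracle} {π : List Bool} {P : Prog} {s t : State}
    (h : Exec O π P s t) : t.proofQueries + s.time ≤ s.proofQueries + t.time := by
  induction h with
  | seq _ _ ih1 ih2 => omega
  | ite_true _ _ ih => simp only at ih; omega
  | ite_false _ _ ih => simp only at ih; omega
  | loop_step _ _ _ ih1 ih2 => simp only at ih1; omega
  | _ => simp only; omega

theorem Exec.oracleQueries_le {O : Oracle} {π : List Bool} {P : Prog} {s t : State}
    (h : Exec O π P s t) : t.oracleQueries + s.time ≤ s.oracleQueries + t.time := by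
  induction h with
  | seq _ _ ih1 ih2 => omega
  | ite_true _ _ ih => simp only at ih; omega
  | ite_false _ _ ih => simp only at ih; omega
  | loop_step _ _ _ ih1 ih2 => simp only at ih1; omega
  | _ => simp only; omega

/-- Registers grow at most by one bit per unit of time. -/
theorem Exec.size_le {O : Oracle} {π : List Bool} {P : Prog} {s t : State} (h : Exec O π P s t)
    (c : ℕ) (hs : ∀ j, (s.reg j).size ≤ c + s.time) : ∀ j, (t.reg j).size ≤ c + t.time := by
  have upd : ∀ (s : State) (i v τ : ℕ), (∀ j, (s.reg j).size ≤ c + s.time) →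
      v.size ≤ c + s.time + τ →
      ∀ j, (Function.update s.reg i v j).size ≤ c + (s.time + τ) := by
    intro s i v τ hs hv j
    by_cases hj : j = i
    · subst hj
      simpa [add_assoc] using hv
    · rw [Function.update_of_ne hj]
      exact (hs j).trans (by omega)
  induction h with
  | const s i a => simpa [add_assoc] using upd s i a (1 + a.size) hs (by omega)
  | op s o i j k =>
    have := size_op_le o (s.reg j) (s.reg k)
    simpa [add_assoc] using upd s i _ (1 + ((s.reg j).size + (s.reg k).size)) hs (by omega)
  | coin s i b ρ h => exact upd s i _ 1 hs ((size_toNat_le _).trans (by omega))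
  | oracle s i j =>
    simpa [add_assoc] using upd s i _ (1 + (s.reg j).size) hs ((size_toNat_le _).trans (by omega))
  | proof s i j =>
    simpa [add_assoc] using upd s i _ (1 + (s.reg j).size) hs ((size_toNat_le _).trans (by omega))
  | seq _ _ ih1 ih2 => exact ih2 (ih1 hs)
  | ite_true _ _ ih => exact ih fun j => (hs j).trans (by simp only; omega)
  | ite_false _ _ ih => exact ih fun j => (hs j).trans (by simp only; omega)
  | loop_step _ _ _ ih1 ih2 => exact ih2 (ih1 fun j => (hs j).trans (by simp only; omega))
  | loop_done _ => exact fun j => (hs j).trans (by simp only; omega)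

/-- A run without coins and with trivial answers is simulated by the shifted program. -/
theorem Exec.shift {P : Prog} {s t : State} (h : Exec (fun _ => false) [] P s t)
    (hc : s.coins = []) (O : Oracle) (π : List Bool) (d B : ℕ) (hB : P.bound ≤ B) (s' : State)
    (hs : ∀ i < B, s'.reg (i + d) = s.reg i) :
    ∃ t', Exec O π (P.shift d) s' t' ∧ (∀ i < B, t'.reg (i + d) = t.reg i) ∧
      (∀ i < d, t'.reg i = s'.reg i) ∧ t'.coins = s'.coins ∧
      t'.time + s.time ≤ s'.time + t.time := by
  have upd : ∀ (r r' : ℕ → ℕ) (i v : ℕ), (∀ i < B, r' (i + d) = r i) →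
      (∀ j < B, Function.update r' (i + d) v (j + d) = Function.update r i v j) ∧
      ∀ j < d, Function.update r' (i + d) v j = r' j := by
    intro r r' i v hr
    refine ⟨fun j hj => ?_, fun j hj => Function.update_of_ne (by omega) _ _⟩
    by_cases h : j = i
    · simp [h]
    · rw [Function.update_of_ne (by omega), Function.update_of_ne h, hr j hj]
  induction h generalizing s' with
  | const s i c =>
    exact ⟨_, .const s' _ c, (upd _ _ i c hs).1, (upd _ _ i c hs).2, rfl, by simp only; omega⟩
  | op s o i j k =>
    simp only [Prog.bound] at hB
    have hj := hs j (by omega)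
    have hk := hs k (by omega)
    have := upd _ _ i (o.eval (s.reg j) (s.reg k)) hs
    refine ⟨_, .op s' o _ _ _, ?_, ?_, rfl, ?_⟩
    · rw [hj, hk]; exact this.1
    · rw [hj, hk]; exact this.2
    · simp only [hj, hk]; omega
  | coin s i b ρ h => simp [hc] at h
  | oracle s i j =>
    have := upd _ _ i 0 hs
    exact ⟨_, .const s' _ 0, this.1, this.2, rfl, by simp only [Nat.size_zero]; omega⟩
  | proof s i j =>
    have := upd _ _ i 0 hs
    exact ⟨_, .const s' _ 0, by simpa using this.1, this.2, rfl, by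
      simp only [Nat.size_zero]; omega⟩
  | seq h1 _ ih1 ih2 =>
    simp only [Prog.bound] at hB
    obtain ⟨t1, e1, a1, b1, c1, τ1⟩ := ih1 hc (by omega) s' hs
    obtain ⟨t2, e2, a2, b2, c2, τ2⟩ := ih2 (h1.coins_nil hc) (by omega) t1 a1
    exact ⟨t2, .seq e1 e2, a2, fun i hi => (b2 i hi).trans (b1 i hi), c2.trans c1, by omega⟩
  | @ite_true i _ _ s t h _ ih =>
    simp only [Prog.bound] at hB
    have hi := hs i (by omega)
    obtain ⟨t1, e1, a1, b1, c1, τ1⟩ :=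
      ih hc (by omega) { s' with time := s'.time + 1 + (s'.reg (i + d)).size } hs
    exact ⟨t1, .ite_true (by rwa [hi]) e1, a1, b1, c1, by simp only [hi] at τ1; omega⟩
  | @ite_false i _ _ s t h _ ih =>
    simp only [Prog.bound] at hB
    have hi := hs i (by omega)
    obtain ⟨t1, e1, a1, b1, c1, τ1⟩ :=
      ih hc (by omega) { s' with time := s'.time + 1 + (s'.reg (i + d)).size } hs
    exact ⟨t1, .ite_false (by rwa [hi]) e1, a1, b1, c1, by simp only [hi] at τ1; omega⟩
  | @loop_step i _ s t u h h1 _ ih1 ih2 =>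
    have hB' := hB
    simp only [Prog.bound] at hB
    have hi := hs i (by omega)
    obtain ⟨t1, e1, a1, b1, c1, τ1⟩ :=
      ih1 hc (by omega) { s' with time := s'.time + 1 + (s'.reg (i + d)).size } hs
    obtain ⟨t2, e2, a2, b2, c2, τ2⟩ := ih2 (h1.coins_nil hc) hB' t1 a1
    exact ⟨t2, .loop_step (by rwa [hi]) e1 e2, a2, fun i hi => (b2 i hi).trans (b1 i hi),
      c2.trans c1, by simp only [hi] at τ1; omega⟩
  | @loop_done i _ s h =>
    simp only [Prog.bound] at hB
    have hi := hs i (by omega)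
    exact ⟨_, .loop_done (by rwa [hi]), hs, fun _ _ => rfl, rfl, by simp only [hi]; omega⟩

/-- The program that sets the registers from `d` to `d + m - 1` to zero. -/
def Prog.clear (d : ℕ) : ℕ → Prog
  | 0 => .const d 0
  | m + 1 => .seq (Prog.clear d m) (.const (d + m) 0)

theorem exec_clear (O : Oracle) (π : List Bool) (d m : ℕ) (s : State) :
    ∃ t, Exec O π (.clear d m) s t ∧ (∀ i < m, t.reg (d + i) = 0) ∧ (∀ i < d, t.reg i = s.reg i) ∧
      t.coins = s.coins ∧ t.time = s.time + (m + 1) := by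
  induction m with
  | zero =>
    obtain ⟨t, e, r, c, τ⟩ := exec_const (O := O) (π := π) s d 0
    exact ⟨t, e, by simp, fun i hi => by rw [r, Function.update_of_ne hi.ne], c, by simp [τ]⟩
  | succ m ih =>
    obtain ⟨t1, e1, z1, l1, c1, τ1⟩ := ih
    obtain ⟨t, e, r, c, τ⟩ := exec_const (O := O) (π := π) t1 (d + m) 0
    refine ⟨t, .seq e1 e, fun i hi => ?_, fun i hi => ?_, c.trans c1, by simp [τ, τ1]; omega⟩
    · by_cases h : i = m
      · simp [r, h]
      · rw [r, Function.update_of_ne (by omega), z1 i (by omega)]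
    · rw [r, Function.update_of_ne (by omega), l1 i hi]

/-- The numerical function `f` may be used in polynomial-time computations, on arguments bounded by
a polynomial in the input length. -/
def UnaryPT (f : ℕ → ℕ) : Prop :=
  ∀ {X : Type} [World X] (V : ℕ → X → ℕ) (k : X → ℕ), PT V k → PolyB k → PT V fun x => f (k x)

theorem encodeStr_replicate (n : ℕ) : encodeStr (List.replicate n true) = 2 ^ (n + 1) - 1 := by
  induction n with
  | zero => rfl
  | succ n ih =>
    have h : encodeStr (List.replicate (n + 1) true) =
      Nat.bit true (encodeStr (List.replicate n true)) := rfl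
    have : 0 < 2 ^ (n + 1) := by positivity
    rw [h, ih, Nat.bit_val, pow_succ _ (n + 1)]
    simp only [Bool.toNat_true]
    omega

theorem PolyTimeUnary.exists_unaryPT {P : Prog} {post : ℕ → State → Prop}
    (h : PolyTimeUnary P post) : ∃ F : ℕ → State, (∀ n, post n (F n)) ∧
      (∀ j, UnaryPT fun n => (F n).reg j) ∧
      ∃ T : Polynomial ℕ, ∀ n j, ((F n).reg j).size ≤ T.eval n := by
  obtain ⟨T, hT⟩ := h
  choose F hF hτ hpost using hT
  have hsz : ∀ n j, ((F n).reg j).size ≤ (Polynomial.X + 1 + T : Polynomial ℕ).eval n := by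
    intro n j
    have := (hF n).size_le (n + 1) (fun j => by
      rw [State.start, encodeStr_replicate]
      by_cases hj : j = 0
      · subst hj
        simp only [Function.update_self, Nat.size_le, add_zero]
        have : 0 < 2 ^ (n + 1) := by positivity
        exact (Nat.sub_lt this one_pos).trans_le (Nat.pow_le_pow_right (by norm_num) (by omega))
      · simp [Function.update_of_ne hj]) j
    have h2 := hτ n
    simp only [Polynomial.eval_add, Polynomial.eval_X, Polynomial.eval_one]
    omega
  refine ⟨F, hpost, fun j X _ V k hk hkb => ?_, _, hsz⟩
  -- The unary input is the number `2 ^ (k x + 1) - 1`, which is of polynomial size because `k` is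
  -- polynomially bounded.
  have hin : PT V fun x => encodeStr (List.replicate (k x) true) :=
    ((PT.two_pow (hk.add (.const V 1)) (hkb.add (.const 1))).sub (.const V 1)).congr fun x =>
      (encodeStr_replicate _).symm
  obtain ⟨U, Q, hQ⟩ := hin
  obtain ⟨K, hK⟩ := hkb
  have hev : ∀ x, (F (k x)).time ≤ (T.comp K).eval (len x) := fun x => by
    rw [Polynomial.eval_comp]
    exact (hτ _).trans (polyEval_mono T (hK x))
  have hsz' : ∀ x, ((F (k x)).reg j).size ≤ ((Polynomial.X + 1 + T).comp K).eval (len x) :=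
    fun x => by
      rw [Polynomial.eval_comp]
      exact (hsz _ j).trans (polyEval_mono (Polynomial.X + 1 + T) (hK x))
  -- The window of simulated registers contains `j` even if `P` does not mention it. It is cleared
  -- first because `P` expects zeros outside its input register.
  let B := P.bound + j + 1
  refine ⟨U + U + T.comp K + (Polynomial.X + 1 + T).comp K + (Polynomial.C B + 6),
    fun loc d => .seq (Q loc d) (.seq (.clear (d + 1) (B + 1)) (.seq (.op .add (d + 1) d (d + 2))
      (.seq (P.shift (d + 1)) (.seq (.const d 0) (.op .add d (j + (d + 1)) d))))),
    fun x => ⟨?_, ?_⟩⟩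
  · have := hsz' x
    simp only [Polynomial.eval_add] at this ⊢
    omega
  · intro loc d s hs
    obtain ⟨z0, hQ⟩ := hQ x
    obtain ⟨t1, e1, r1⟩ := hQ loc d s hs
    obtain ⟨t2, e2, m2, l2, c2, τ2⟩ := exec_clear (orc x) (prf x) (d + 1) (B + 1) t1
    obtain ⟨t3, e3, m3, c3, τ3⟩ :=
      exec_op (O := orc x) (π := prf x) t2 .add (d + 1) d (d + 2)
    have v2 : t2.reg d = encodeStr (List.replicate (k x) true) := by
      rw [l2 d (by omega), r1.val]
    have v2' : t2.reg (d + 2) = 0 := m2 1 (by omega)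
    obtain ⟨t4, e4, m4, l4, c4, τ4⟩ := (hF (k x)).shift rfl (orc x) (prf x) (d + 1) B
      (by simp only [B]; omega) t3 (fun i hi => by
        simp only [State.start, m3, v2, v2', Op.eval, add_zero]
        by_cases h : i = 0
        · simp [h]
        · rw [Function.update_of_ne (by omega), Function.update_of_ne h,
            show i + (d + 1) = d + 1 + i by omega, m2 i (by omega)])
    obtain ⟨t5, e5, m5, c5, τ5⟩ := exec_const (O := orc x) (π := prf x) t4 d 0
    obtain ⟨t6, e6, m6, c6, τ6⟩ :=
      exec_op (O := orc x) (π := prf x) t5 .add d (j + (d + 1)) d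
    have v5 : t5.reg (j + (d + 1)) = (F (k x)).reg j := by
      rw [m5, Function.update_of_ne (by omega), m4 j (by simp only [B]; omega)]
    have v5' : t5.reg d = 0 := by simp [m5]
    refine ⟨t6, .seq e1 (.seq e2 (.seq e3 (.seq e4 (.seq e5 e6)))), fun i hi => ?_, ?_, ?_, ?_⟩
    · rw [m6, Function.update_of_ne hi.ne, m5, Function.update_of_ne hi.ne, l4 i (by omega), m3,
        Function.update_of_ne (by omega), l2 i (by omega), r1.low i hi]
    · simp [m6, v5, v5', Op.eval]
    · rw [c6, c5, c4, c3, c2, r1.coins]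
    · have w1 := r1.time
      have w2 := hev x
      have w3 := hsz' x
      rw [v2, v2'] at τ3
      rw [v5, v5'] at τ6
      simp only [State.start, Nat.size_zero, Polynomial.eval_add, Polynomial.eval_C,
        Polynomial.eval_ofNat] at *
      omega

end OraclePCP

namespace OraclePCP
open World
variable {X : Type} [World X]

/-! ### Strings in unary and circuit descriptions -/

theorem encodeStr_cons (b : Bool) (l : List Bool) :
    encodeStr (b :: l) = 2 * encodeStr l + b.toNat := Nat.bit_val ..

theorem two_pow_le_encodeStr (l : List Bool) :
    2 ^ l.length ≤ encodeStr l ∧ encodeStr l < 2 ^ (l.length + 1) := by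
  induction l with
  | nil => simp [encodeStr]
  | cons b l ih =>
    rw [encodeStr_cons, List.length_cons, pow_succ, pow_succ _ (l.length + 1)]
    cases b <;> (simp; omega)

theorem size_encodeStr (l : List Bool) : (encodeStr l).size = l.length + 1 := by
  have := two_pow_le_encodeStr l
  exact le_antisymm (Nat.size_le.2 this.2) (Nat.lt_size.2 this.1)

theorem encodeStr_bit (l : List Bool) {j : ℕ} (hj : j < l.length) :
    encodeStr l / 2 ^ j % 2 = (l.getD j false).toNat := by
  induction l generalizing j with
  | nil => simp at hj
  | cons b l ih =>
    rw [encodeStr_cons]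
    cases j with
    | zero => cases b <;> simp [Nat.add_mod]
    | succ j =>
      have h : (2 * encodeStr l + b.toNat) / 2 = encodeStr l := by
        cases b <;> simp
        omega
      rw [pow_succ', ← Nat.div_div_eq_div_mul, h, ih (by simpa using hj)]
      simp

/-- The number of zeros among the first `j` letters. -/
def zerosBefore (l : List Bool) (j : ℕ) : ℕ :=
  ∑ m ∈ Finset.range j, if l.getD m false = true then 0 else 1

/-- The length of the run of ones after the `i`-th zero. -/
def runAt (l : List Bool) (i : ℕ) : ℕ :=
  ∑ j ∈ Finset.range l.length, if l.getD j false = true ∧ zerosBefore l j = i then 1 else 0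

theorem zerosBefore_cons_succ (b : Bool) (l : List Bool) (j : ℕ) :
    zerosBefore (b :: l) (j + 1) = zerosBefore l j + if b = true then 0 else 1 := by
  simp [zerosBefore, Finset.sum_range_succ']

theorem runAt_true_zero (l : List Bool) : runAt (true :: l) 0 = runAt l 0 + 1 := by
  simp only [runAt, List.length_cons, Finset.sum_range_succ', zerosBefore_cons_succ]
  simp [zerosBefore]

theorem runAt_true_succ (l : List Bool) (i : ℕ) :
    runAt (true :: l) (i + 1) = runAt l (i + 1) := by
  simp only [runAt, List.length_cons, Finset.sum_range_succ', zerosBefore_cons_succ]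
  simp [zerosBefore]

theorem runAt_false_zero (l : List Bool) : runAt (false :: l) 0 = 0 := by
  simp only [runAt, List.length_cons, Finset.sum_range_succ', zerosBefore_cons_succ]
  simp

theorem runAt_false_succ (l : List Bool) (i : ℕ) : runAt (false :: l) (i + 1) = runAt l i := by
  simp only [runAt, List.length_cons, Finset.sum_range_succ', zerosBefore_cons_succ]
  simp

/-- A sequence of numbers in unary. -/
def unaryEnc (L : List ℕ) : List Bool := L.flatMap fun k => List.replicate k true ++ [false]

/-- An entry of the list is a run of ones between zeros, and counting the ones that have `i` zeros
before them is a bounded sum; this makes entries computable without a parser. Past the end both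
sides are zero. -/
theorem runAt_unaryEnc (L : List ℕ) (i : ℕ) : runAt (unaryEnc L) i = L.getD i 0 := by
  induction L generalizing i with
  | nil => simp [unaryEnc, runAt]
  | cons k L ih =>
    have h : unaryEnc (k :: L) = List.replicate k true ++ false :: unaryEnc L := by
      simp [unaryEnc]
    rw [h]
    clear h
    induction k with
    | zero =>
      cases i with
      | zero => simp [runAt_false_zero]
      | succ i => simp [runAt_false_succ, ih]
    | succ k ihk =>
      rw [List.replicate_succ, List.cons_append]
      cases i with
      | zero => rw [runAt_true_zero, ihk]; simp
      | succ i => rw [runAt_true_succ, ihk]; simp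

theorem zerosBefore_unaryEnc (L : List ℕ) :
    zerosBefore (unaryEnc L) (unaryEnc L).length = L.length := by
  induction L with
  | nil => simp [unaryEnc, zerosBefore]
  | cons k L ih =>
    have h : unaryEnc (k :: L) = List.replicate k true ++ false :: unaryEnc L := by
      simp [unaryEnc]
    rw [h]
    clear h
    induction k with
    | zero => simp [zerosBefore_cons_succ, ih]
    | succ k ihk =>
      rw [List.replicate_succ, List.cons_append, List.length_cons, zerosBefore_cons_succ, ihk]
      simp

theorem runAt_le (l : List Bool) (i : ℕ) : runAt l i ≤ l.length := by
  refine (Finset.sum_le_card_nsmul _ _ 1 fun j _ => ?_).trans (by simp)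
  split_ifs <;> simp

theorem le_unaryEnc_length (L : List ℕ) : L.length ≤ (unaryEnc L).length := by
  simp only [unaryEnc, List.length_flatMap]
  exact List.length_le_sum_of_one_le _ (by simp) |>.trans' (by simp)

section

variable {V : ℕ → X → ℕ} {c : X → List Bool}

theorem PT.strLength (hc : PT V fun x => encodeStr (c x)) : PT V fun x => (c x).length :=
  (hc.size.sub (.const V 1)).congr fun x => by rw [size_encodeStr]; omega

theorem PolyB.strLength (hc : PT V fun x => encodeStr (c x)) : PolyB fun x => (c x).length :=
  hc.polyB_size.mono fun x => by rw [size_encodeStr]; omega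

theorem PT.bit {f q : X → ℕ} (hf : PT V f) (hq : PT V q) (hqb : PolyB q) :
    PT V fun x => f x / 2 ^ q x % 2 :=
  (hf.div (hq.two_pow hqb)).mod (.const V 2)

theorem PD.strBit {j : X → ℕ} (hc : PT V fun x => encodeStr (c x)) (hj : PT V j) (hjb : PolyB j) :
    PD V fun x => (c x).getD (j x) false = true :=
  ((PD.lt hj hc.strLength).and (PD.eq (hc.bit hj hjb) (.const V 1))).congr fun x => by
    by_cases h : j x < (c x).length
    · rw [encodeStr_bit _ h]
      cases (c x).getD (j x) false <;> simp [h]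
    · simp [h]

theorem PT.zerosBefore {j : X → ℕ} (hc : PT V fun x => encodeStr (c x)) (hj : PT V j)
    (hjb : PolyB j) : PT V fun x => zerosBefore (c x) (j x) :=
  PT.bsum (fun x m => if (c x).getD m false = true then 0 else 1) hj hjb fun V' hi lift =>
    (PD.strBit (lift _ hc) hi hjb.idx).ite (.const V' 0) (.const V' 1)

theorem PT.runAt {i : X → ℕ} (hc : PT V fun x => encodeStr (c x)) (hi : PT V i) :
    PT V fun x => runAt (c x) (i x) :=
  PT.bsum (fun x j => if (c x).getD j false = true ∧ OraclePCP.zerosBefore (c x) j = i x then 1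
    else 0) hc.strLength (.strLength hc) fun V' hj lift =>
    ((PD.strBit (lift _ hc) hj (PolyB.strLength hc).idx).and
      (PD.eq ((lift _ hc).zerosBefore hj (PolyB.strLength hc).idx) (lift _ hi))).ite
      (.const V' 1) (.const V' 0)

end

variable {S : GateSet}

/-- The numbers in the description of a circuit. -/
def Circuit.tokens (C : Circuit S) : List ℕ := C.width :: C.gates.flatMap Gate.tokens

theorem Circuit.encode_eq (C : Circuit S) : C.encode = unaryEnc C.tokens := rfl

/-- The position of the `t`-th gate in the description; past the last gate, positions go up in steps
of two. -/
def Circuit.pos (C : Circuit S) (t : ℕ) : ℕ :=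
  1 + ((C.gates.take t).flatMap Gate.tokens).length + 2 * (t - C.gates.length)

theorem Circuit.tokens_getD (C : Circuit S) {t : ℕ} {G : Gate S C.width} (hG : C.gates[t]? = some G)
    {i : ℕ} (hi : i < G.tokens.length) : C.tokens.getD (C.pos t + i) 0 = G.tokens.getD i 0 := by
  obtain ⟨ht, rfl⟩ := List.getElem?_eq_some_iff.1 hG
  have h : C.gates = C.gates.take t ++ C.gates[t] :: C.gates.drop (t + 1) := by simp
  have h2 : C.gates.flatMap Gate.tokens = (C.gates.take t).flatMap Gate.tokens ++
      (C.gates[t].tokens ++ (C.gates.drop (t + 1)).flatMap Gate.tokens) := by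
    conv_lhs => rw [h]
    rw [List.flatMap_append, List.flatMap_cons]
  rw [Circuit.tokens, Circuit.pos, h2, Nat.sub_eq_zero_of_le ht.le,
    show 1 + ((C.gates.take t).flatMap Gate.tokens).length + 2 * 0 + i =
      ((C.gates.take t).flatMap Gate.tokens).length + i + 1 by omega, List.getD_cons_succ,
    List.getD_append_right _ _ _ _ (by omega), Nat.add_sub_cancel_left,
    List.getD_append _ _ _ _ hi]

theorem Gate.length_tokens {w : ℕ} (G : Gate S w) : 0 < G.tokens.length := by
  cases G <;> simp [Gate.tokens]

theorem Circuit.pos_succ (C : Circuit S) {t : ℕ} {G : Gate S C.width}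
    (hG : C.gates[t]? = some G) : C.pos (t + 1) = C.pos t + G.tokens.length := by
  obtain ⟨ht, rfl⟩ := List.getElem?_eq_some_iff.1 hG
  rw [pos, pos, List.take_succ_eq_append_getElem ht, List.flatMap_append, List.length_append]
  simp only [List.flatMap_cons, List.flatMap_nil, List.append_nil]
  omega

theorem Circuit.pos_succ_of_le (C : Circuit S) {t : ℕ} (ht : C.gates.length ≤ t) :
    C.pos (t + 1) = C.pos t + 2 := by
  rw [pos, pos, List.take_of_length_le ht, List.take_of_length_le (by omega)]
  omega

theorem Circuit.length_tokens_le_pos (C : Circuit S) {t : ℕ} (ht : C.gates.length ≤ t) :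
    C.tokens.length ≤ C.pos t := by
  rw [pos, List.take_of_length_le ht, tokens, List.length_cons]
  omega

theorem length_flatMap_take_le {α β : Type*} (f : α → List β) (l : List α) (t : ℕ) :
    ((l.take t).flatMap f).length ≤ (l.flatMap f).length := by
  conv_rhs => rw [← List.take_append_drop t l, List.flatMap_append, List.length_append]
  omega

theorem Circuit.pos_lt (C : Circuit S) {t : ℕ} (ht : t < C.gates.length) :
    C.pos t < C.tokens.length := by
  have h1 := C.pos_succ (List.getElem?_eq_getElem ht)
  have h2 := (C.gates[t]).length_tokens
  have h3 := length_flatMap_take_le Gate.tokens C.gates (t + 1)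
  have h4 : C.pos (t + 1) = 1 + ((C.gates.take (t + 1)).flatMap Gate.tokens).length := by
    rw [pos]; omega
  rw [tokens, List.length_cons]
  omega

theorem Circuit.pos_le (C : Circuit S) (t : ℕ) : C.pos t ≤ C.tokens.length + 2 * t := by
  have h3 := length_flatMap_take_le Gate.tokens C.gates t
  rw [tokens, List.length_cons, pos]
  omega

theorem Circuit.gates_length_lt (C : Circuit S) : C.gates.length < C.tokens.length := by
  have : C.gates.length ≤ (C.gates.flatMap Gate.tokens).length := by
    rw [List.length_flatMap]
    refine (List.length_le_sum_of_one_le _ ?_).trans' (by simp)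
    intro i hi
    obtain ⟨G, _, rfl⟩ := List.mem_map.1 hi
    exact G.length_tokens
  rw [tokens, List.length_cons]
  omega

theorem Circuit.width_le (C : Circuit S) : C.width ≤ C.encode.length := by
  have := runAt_le C.encode 0
  rwa [encode_eq, runAt_unaryEnc] at this

theorem Circuit.length_tokens_le (C : Circuit S) : C.tokens.length ≤ C.encode.length :=
  le_unaryEnc_length _

/-- The length of the description of a gate, as read off from a sequence of numbers. -/
def gateLen (S : GateSet) (tok : ℕ → ℕ) (p : ℕ) : ℕ :=
  if tok p = 0 then 2 + tok (p + 1)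
  else ∑ g : Fin S.size, if tok p = (g : ℕ) + 1 then S.arity g + 1 else 0

/-- The length of a gate depends on its first two tokens only, so the position of each gate is found
by stepping through the description. -/
theorem Circuit.pos_add_gateLen (C : Circuit S) (t : ℕ) :
    C.pos t + gateLen S (fun i => C.tokens.getD i 0) (C.pos t) = C.pos (t + 1) := by
  by_cases ht : t < C.gates.length
  · have hG := List.getElem?_eq_getElem ht
    rw [C.pos_succ hG]
    congr 1
    have h0 := C.tokens_getD hG (i := 0) (Gate.length_tokens _)
    have h1 := C.tokens_getD hG (i := 1)
    generalize C.gates[t] = G at h0 h1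
    cases G with
    | unitary g q =>
      rw [add_zero] at h0
      simp only [gateLen, h0]
      simp [Gate.tokens, Fin.val_inj]
    | oracle k q =>
      rw [add_zero] at h0
      simp only [gateLen, h0, h1 (by simp [Gate.tokens])]
      simp [Gate.tokens]
      omega
  -- Past the end all tokens read as `0`, which looks like an oracle gate on no qubits: two tokens,
  -- the step built into `Circuit.pos`.
  · have h1 := C.length_tokens_le_pos (not_lt.1 ht)
    rw [C.pos_succ_of_le (not_lt.1 ht), gateLen, List.getD_eq_default _ _ h1,
      List.getD_eq_default _ _ (by omega)]
    simp

section

variable {V : ℕ → X → ℕ} {C : X → Circuit S}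

theorem PT.token {i : X → ℕ} (hC : PT V fun x => encodeStr (C x).encode) (hi : PT V i) :
    PT V fun x => (C x).tokens.getD (i x) 0 :=
  (hC.runAt hi).congr fun x => by rw [Circuit.encode_eq, runAt_unaryEnc]

theorem PolyB.token (hC : PT V fun x => encodeStr (C x).encode) (i : X → ℕ) :
    PolyB fun x => (C x).tokens.getD (i x) 0 :=
  (PolyB.strLength hC).mono fun x => by
    rw [← runAt_unaryEnc, ← Circuit.encode_eq]
    exact runAt_le _ _

theorem PT.width (hC : PT V fun x => encodeStr (C x).encode) : PT V fun x => (C x).width :=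
  (hC.token (.const V 0)).congr fun x => by simp [Circuit.tokens]

theorem PolyB.width (hC : PT V fun x => encodeStr (C x).encode) : PolyB fun x => (C x).width :=
  (PolyB.strLength hC).mono fun x => (C x).width_le

theorem PT.length_tokens (hC : PT V fun x => encodeStr (C x).encode) :
    PT V fun x => (C x).tokens.length :=
  (hC.zerosBefore hC.strLength (.strLength hC)).congr fun x => by
    rw [Circuit.encode_eq, zerosBefore_unaryEnc]

theorem PolyB.length_tokens (hC : PT V fun x => encodeStr (C x).encode) :
    PolyB fun x => (C x).tokens.length :=
  (PolyB.strLength hC).mono fun x => (C x).length_tokens_le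

theorem PT.gateLen {p : X → ℕ} (hC : PT V fun x => encodeStr (C x).encode) (hp : PT V p) :
    PT V fun x => gateLen S (fun i => (C x).tokens.getD i 0) (p x) :=
  (PD.eq (hC.token hp) (.const V 0)).ite
    ((PT.const V 2).add (hC.token (hp.add (.const V 1))))
    (PT.fintypeSum _ _ fun g _ => (PD.eq (hC.token hp) (.const V (g + 1))).ite
      (.const V (S.arity g + 1)) (.const V 0))

theorem PT.pos {t : X → ℕ} (hC : PT V fun x => encodeStr (C x).encode) (ht : PT V t)
    (htb : PolyB t) : PT V fun x => (C x).pos (t x) :=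
  PT.forLoop (fun x i => (C x).pos i) ht htb
    (let ⟨T, hT⟩ := (PolyB.length_tokens hC).add ((PolyB.const 2).mul htb)
    ⟨T, fun x i hi => (size_le_self _).trans (((C x).pos_le i).trans
      ((by simp only; omega : _ ≤ _).trans (hT x)))⟩)
    ((PT.const V 1).congr fun x => by simp [Circuit.pos])
    fun V' _ hst lift => (hst.add ((lift _ hC).gateLen hst)).congr fun p =>
      (C p.base).pos_add_gateLen _

/-- Position `t` lies inside the description exactly if there is a `t`-th gate. Each gate has at
least one token, so it suffices to try the `t` below the number of tokens. -/
theorem PT.gates_length (hC : PT V fun x => encodeStr (C x).encode) :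
    PT V fun x => (C x).gates.length := by
  refine (PT.bsum (fun x t => if (C x).pos t < (C x).tokens.length then 1 else 0) hC.length_tokens
    (.length_tokens hC) fun V' hi lift => (PD.lt ((lift _ hC).pos hi (PolyB.length_tokens hC).idx)
      (lift _ hC.length_tokens)).ite (.const V' 1) (.const V' 0)).congr fun x => ?_
  have h : ∀ t, (C x).pos t < (C x).tokens.length ↔ t < (C x).gates.length := fun t =>
    ⟨fun h => by by_contra h'; exact absurd ((C x).length_tokens_le_pos (not_lt.1 h')) (by omega),
      (C x).pos_lt⟩
  simp only [h, Finset.sum_boole, Nat.cast_id]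
  rw [show (Finset.range (C x).tokens.length).filter (· < (C x).gates.length) =
    Finset.range (C x).gates.length from ?_, Finset.card_range]
  ext t
  have := (C x).gates_length_lt
  simp only [Finset.mem_filter, Finset.mem_range]
  omega

theorem PolyB.gates_length (hC : PT V fun x => encodeStr (C x).encode) :
    PolyB fun x => (C x).gates.length :=
  (PolyB.length_tokens hC).mono fun x => (C x).gates_length_lt.le

end

end OraclePCP

namespace OraclePCP
open World
variable {X : Type} [World X]

/-! ### Basis states as numbers -/

/-- The number with the given first `n` binary digits. -/
def binNum (n : ℕ) (b : ℕ → Bool) : ℕ := ∑ j ∈ Finset.range n, (b j).toNat * 2 ^ j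

theorem binNum_succ (n : ℕ) (b : ℕ → Bool) :
    binNum (n + 1) b = binNum n b + (b n).toNat * 2 ^ n := Finset.sum_range_succ _ _

theorem binNum_lt (n : ℕ) (b : ℕ → Bool) : binNum n b < 2 ^ n := by
  induction n with
  | zero => simp [binNum]
  | succ n ih =>
    rw [binNum_succ, pow_succ]
    cases b n <;> simp <;> omega

theorem testBit_binNum {n : ℕ} (b : ℕ → Bool) {j : ℕ} (hj : j < n) :
    (binNum n b).testBit j = b j := by
  induction n with
  | zero => simp at hj
  | succ n ih =>
    rw [binNum_succ, add_comm, mul_comm, Nat.testBit_two_pow_mul_add _ (binNum_lt n b)]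
    rcases Nat.lt_succ_iff_lt_or_eq.1 hj with h | rfl
    · simp [h, ih h]
    · cases b j <;> simp

theorem binNum_testBit {n z : ℕ} (hz : z < 2 ^ n) : binNum n z.testBit = z := by
  refine Nat.eq_of_testBit_eq fun j => ?_
  by_cases hj : j < n
  · exact testBit_binNum _ hj
  · have h : 2 ^ n ≤ 2 ^ j := Nat.pow_le_pow_right (by norm_num) (by omega)
    rw [Nat.testBit_lt_two_pow ((binNum_lt _ _).trans_le h), Nat.testBit_lt_two_pow (hz.trans_le h)]

theorem toNat_testBit_eq (z j : ℕ) : (z.testBit j).toNat = z / 2 ^ j % 2 := by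
  rw [Nat.testBit_eq_decide_div_mod_eq]
  rcases Nat.mod_two_eq_zero_or_one (z / 2 ^ j) with h | h <;> simp [h]

theorem toNat_injective : Function.Injective Bool.toNat := by decide

theorem encodeStr_eq_sum (l : List Bool) :
    encodeStr l = binNum l.length (fun i => l.getD i false) + 2 ^ l.length := by
  induction l with
  | nil => rfl
  | cons b l ih =>
    rw [encodeStr_cons, ih]
    simp only [binNum, List.length_cons, Finset.sum_range_succ', List.getD_cons_succ,
      List.getD_cons_zero, pow_succ]
    rw [mul_add, Finset.mul_sum]
    have : ∀ i, (l.getD i false).toNat * (2 ^ i * 2) = 2 * ((l.getD i false).toNat * 2 ^ i) :=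
      fun i => by ring
    simp only [this]
    ring

theorem encodeStr_ofFn {k : ℕ} (f : Fin k → Bool) :
    encodeStr (List.ofFn f) = ∑ i : Fin k, (f i).toNat * 2 ^ (i : ℕ) + 2 ^ k := by
  rw [encodeStr_eq_sum, List.length_ofFn, binNum, Finset.sum_range]
  simp

/-- Basis states of `w` qubits, with a flag that selects the real part (`false`) or the imaginary
part of the amplitude. -/
abbrev Idx (w : ℕ) := (Fin w → Bool) × Bool

/-- The binary digits of a basis state. -/
def Idx.digits {w : ℕ} (i : Idx w) (j : ℕ) : Bool := if h : j < w then i.1 ⟨j, h⟩ else i.2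

/-- A basis state as a number. -/
def Idx.num {w : ℕ} (i : Idx w) : ℕ := binNum (w + 1) i.digits

/-- The basis state given by a number. -/
def Idx.ofNum (w z : ℕ) : Idx w := (fun j => z.testBit j, z.testBit w)

theorem Idx.num_lt {w : ℕ} (i : Idx w) : i.num < 2 ^ (w + 1) := binNum_lt _ _

theorem Idx.ofNum_num {w : ℕ} (i : Idx w) : ofNum w i.num = i := by
  refine Prod.ext (funext fun j => ?_) ?_
  · simp only [ofNum, num]
    rw [testBit_binNum _ (by omega)]
    simp [digits]
  · simp only [ofNum, num]
    rw [testBit_binNum _ (by omega)]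
    simp [digits]

theorem Idx.num_ofNum {w z : ℕ} (hz : z < 2 ^ (w + 1)) : (ofNum w z).num = z := by
  rw [num, ← binNum_testBit hz]
  refine Finset.sum_congr rfl fun j hj => ?_
  rw [binNum_testBit hz]
  congr 2
  by_cases h : j < w
  · simp [digits, h, ofNum]
  · obtain rfl : j = w := by have := Finset.mem_range.1 hj; omega
    simp [digits, ofNum]

theorem Idx.num_eq {w : ℕ} (i : Idx w) :
    i.num = ∑ j : Fin w, (i.1 j).toNat * 2 ^ (j : ℕ) + i.2.toNat * 2 ^ w := by
  rw [num, binNum_succ, binNum, Finset.sum_range]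
  simp [digits]

/-- The basis state with the qubits `q` and the flag replaced. -/
noncomputable def Idx.subst {w k : ℕ} (q : Fin k ↪ Fin w) (i : Idx w) (p : Idx k) : Idx w :=
  (Function.extend q p.1 i.1, p.2)

/-- The part of a basis state on the qubits `q`, with the flag. -/
def Idx.restrict {w k : ℕ} (q : Fin k ↪ Fin w) (i : Idx w) : Idx k := (i.1 ∘ q, i.2)

/-- Only the digits at `q` and the flag change, so the numbers differ by the contributions of these
digits. The identity lets a program find the neighbours of a basis state from the positions of the
qubits; it is written additively to avoid truncated subtraction. -/
theorem Idx.num_subst {w k : ℕ} (q : Fin k ↪ Fin w) (i : Idx w) (p : Idx k) :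
    (i.subst q p).num + (∑ j, (i.1 (q j)).toNat * 2 ^ (q j : ℕ) + i.2.toNat * 2 ^ w) =
      i.num + (∑ j, (p.1 j).toNat * 2 ^ (q j : ℕ) + p.2.toNat * 2 ^ w) := by
  have key : ∀ b : Fin w → Bool, ∑ j, (b j).toNat * 2 ^ (j : ℕ) =
      ∑ j, (b (q j)).toNat * 2 ^ (q j : ℕ) +
        ∑ j ∈ (Finset.univ.map q)ᶜ, (b j).toNat * 2 ^ (j : ℕ) := fun b => by
    rw [← Finset.sum_add_sum_compl (Finset.univ.map q), Finset.sum_map]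
  rw [num_eq, num_eq, key, key i.1]
  have h1 : ∀ j, Function.extend q p.1 i.1 (q j) = p.1 j := fun j => q.injective.extend_apply _ _ _
  have h2 : ∑ j ∈ (Finset.univ.map q)ᶜ, (Function.extend q p.1 i.1 j).toNat * 2 ^ (j : ℕ) =
      ∑ j ∈ (Finset.univ.map q)ᶜ, (i.1 j).toNat * 2 ^ (j : ℕ) := by
    refine Finset.sum_congr rfl fun j hj => ?_
    rw [Function.extend_apply']
    simpa using hj
  simp only [subst, h1, h2]
  omega

/-! ### The checks made by the verifier -/

/-- A number read from the proof: fields consist of `κ` bits and are addressed by three numbers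
below `2 ^ κ`. -/
def field (π : List Bool) (κ a b c : ℕ) : ℕ :=
  binNum κ fun i => π.getD (((a * 2 ^ κ + b) * 2 ^ κ + c) * 2 ^ κ + i) false

/-- The claimed amplitude of the basis state `z` at time `t`, shifted by `2 ^ h` and in units of
`2 ^ (-h)`. -/
def ampl (π : List Bool) (h t z : ℕ) : ℕ := field π (2 * h + 1) 0 t z

/-- The claimed start of the interval of random numbers that lead to the basis state `z`. -/
def start (π : List Bool) (h t z : ℕ) : ℕ := field π (2 * h + 1) 1 t z

/-- The basis state claimed to belong to the random number `R`. -/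
def sample (π : List Bool) (h t R : ℕ) : ℕ := field π (2 * h + 1) 2 t R

/-- The claimed weight, in units of `2 ^ (-2 * h)`, of the basis states with first `d` digits `p`. -/
def weight (π : List Bool) (h d t p : ℕ) : ℕ := field π (2 * h + 1) (3 + d) t p

/-- Two numbers differ at most by `τ`. -/
def Near (τ a b : ℕ) : Prop := a ≤ b + τ ∧ b ≤ a + τ

/-- The weights are consistent along the path to `z`, and the weight of `z` is close to the square
of the amplitude. -/
def Verified (π : List Bool) (h W t z : ℕ) : Prop :=
  weight π h 0 t 0 = 2 ^ h * 2 ^ h ∧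
  (∀ d < W, weight π h d t (z % 2 ^ d) =
    weight π h (d + 1) t (z % 2 ^ d) + weight π h (d + 1) t (z % 2 ^ d + 2 ^ d)) ∧
  -- With `H = 2 ^ h` and `A` the stored amplitude, this bounds the difference of `(A - H) ^ 2` and
  -- the leaf weight by `4 * H`, without using subtraction.
  Near (4 * 2 ^ h) (ampl π h t z * ampl π h t z + 2 ^ h * 2 ^ h)
    (weight π h W t z + 2 * (2 ^ h * ampl π h t z))

/-- Approximations to the entries of the gates, viewed as real matrices, as differences of two
numbers, in dependence on the precision. -/
structure Entries (S : GateSet) where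
  pos : (g : Fin S.size) → Idx (S.arity g) → Idx (S.arity g) → ℕ → ℕ
  neg : (g : Fin S.size) → Idx (S.arity g) → Idx (S.arity g) → ℕ → ℕ

variable {S : GateSet}

/-- The amplitude of `i` after the gate is consistent with the amplitudes before the gate. -/
def Gate.RowOK {w : ℕ} (O : Oracle) (E : Entries S) (h : ℕ) (A A' : Idx w → ℕ)
    (v : Idx w → Prop) (i : Idx w) : Gate S w → Prop
  | .unitary g q => (∀ p, v (i.subst q p)) ∧
      -- With `H = 2 ^ h`, this bounds the difference of `H * (A' i - H)` and the sum of all `(pos -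
      -- neg) * (A (i.subst q p) - H)` by `32 * H`; negative terms are moved to the other side.
      Near (32 * 2 ^ h)
        (2 ^ h * A' i + ∑ p, (E.pos g (i.restrict q) p h * 2 ^ h +
          E.neg g (i.restrict q) p h * A (i.subst q p)))
        (2 ^ h * 2 ^ h + ∑ p, (E.pos g (i.restrict q) p h * A (i.subst q p) +
          E.neg g (i.restrict q) p h * 2 ^ h))
  | .oracle _ q => v i ∧
      Near (32 * 2 ^ h)
        (2 ^ h * A' i + if O (List.ofFn (i.1 ∘ q)) = true then 2 ^ h * A i else 2 ^ h * 2 ^ h)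
        (2 ^ h * 2 ^ h + if O (List.ofFn (i.1 ∘ q)) = true then 2 ^ h * 2 ^ h else 2 ^ h * A i)

/-- The checks made for one random number `R`, on the circuit `C` with initial basis state `z₀`. -/
def RoundOK (O : Oracle) (π : List Bool) (E : Entries S) (h : ℕ) (C : Circuit S) (z₀ R : ℕ) :
    Prop :=
  -- Reduction modulo `2 ^ (C.width + 1)` turns every answer of a dishonest proof into a basis
  -- state. One `R` serves all times, since soundness uses the distribution of the sample at each
  -- time and no independence between times.
  (∀ t < C.gates.length + 1,
    Verified π h (C.width + 1) t (sample π h t R % 2 ^ (C.width + 1)) ∧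
    start π h t (sample π h t R % 2 ^ (C.width + 1)) ≤ R ∧
    R < start π h t (sample π h t R % 2 ^ (C.width + 1)) +
      weight π h (C.width + 1) t (sample π h t R % 2 ^ (C.width + 1)) ∧
    (t = 0 → sample π h t R % 2 ^ (C.width + 1) = z₀) ∧
    -- The threshold `3 / 5` lies between the acceptance probabilities `1 / 3` and `2 / 3`, with
    -- room for errors on both sides.
    (t = C.gates.length → 10 * R < 6 * (2 ^ h * 2 ^ h) →
      sample π h t R % 2 ^ (C.width + 1) % 2 = 0)) ∧
  ∀ t < C.gates.length, ∀ G ∈ C.gates[t]?,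
    G.RowOK O E h (fun i => ampl π h t i.num) (fun i => ampl π h (t + 1) i.num)
      (fun i => Verified π h (C.width + 1) t i.num)
      (Idx.ofNum C.width (sample π h (t + 1) R % 2 ^ (C.width + 1)))

/-! ### The checks of one round are decided in polynomial time. -/

section

variable {V : ℕ → X → ℕ} {h t z R : X → ℕ}

theorem PT.field {κ a b c : X → ℕ} (hκ : PT V κ) (hκb : PolyB κ) (ha : PT V a) (hb : PT V b)
    (hc : PT V c) : PT V fun x => field (prf x) (κ x) (a x) (b x) (c x) :=
  PT.bsum (fun x i => ((prf x).getD (((a x * 2 ^ κ x + b x) * 2 ^ κ x + c x) * 2 ^ κ x + i)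
    false).toNat * 2 ^ i) hκ hκb fun _ hi lift =>
    have hD := lift _ (hκ.two_pow hκb)
    (PT.proof ((((((lift _ ha).mul hD).add (lift _ hb)).mul hD).add (lift _ hc)).mul hD |>.add
      hi)).mul (hi.two_pow hκb.idx)

theorem PT.ampl (hh : PT V h) (hhb : PolyB h) (ht : PT V t) (hz : PT V z) :
    PT V fun x => ampl (prf x) (h x) (t x) (z x) :=
  PT.field (((PT.const V 2).mul hh).add (.const V 1)) (((PolyB.const 2).mul hhb).add (.const 1))
    (.const V 0) ht hz

theorem PT.start (hh : PT V h) (hhb : PolyB h) (ht : PT V t) (hz : PT V z) :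
    PT V fun x => start (prf x) (h x) (t x) (z x) :=
  PT.field (((PT.const V 2).mul hh).add (.const V 1)) (((PolyB.const 2).mul hhb).add (.const 1))
    (.const V 1) ht hz

theorem PT.sample (hh : PT V h) (hhb : PolyB h) (ht : PT V t) (hz : PT V z) :
    PT V fun x => sample (prf x) (h x) (t x) (z x) :=
  PT.field (((PT.const V 2).mul hh).add (.const V 1)) (((PolyB.const 2).mul hhb).add (.const 1))
    (.const V 2) ht hz

theorem PT.weight {d : X → ℕ} (hh : PT V h) (hhb : PolyB h) (hd : PT V d) (ht : PT V t)
    (hz : PT V z) : PT V fun x => weight (prf x) (h x) (d x) (t x) (z x) :=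
  PT.field (((PT.const V 2).mul hh).add (.const V 1)) (((PolyB.const 2).mul hhb).add (.const 1))
    ((PT.const V 3).add hd) ht hz

theorem PD.near {τ a b : X → ℕ} (hτ : PT V τ) (ha : PT V a) (hb : PT V b) :
    PD V fun x => Near (τ x) (a x) (b x) :=
  (PD.le ha (hb.add hτ)).and (PD.le hb (ha.add hτ))

theorem PD.verified {W : X → ℕ} (hh : PT V h) (hhb : PolyB h) (hW : PT V W) (hWb : PolyB W)
    (ht : PT V t) (hz : PT V z) : PD V fun x => Verified (prf x) (h x) (W x) (t x) (z x) := by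
  have hH := hh.two_pow hhb
  have hA := PT.ampl hh hhb ht hz
  refine (PD.eq (PT.weight hh hhb (.const V 0) ht (.const V 0)) (hH.mul hH)).and
    ((PD.ball (fun x d => OraclePCP.weight (prf x) (h x) d (t x) (z x % 2 ^ d) =
      OraclePCP.weight (prf x) (h x) (d + 1) (t x) (z x % 2 ^ d) +
      OraclePCP.weight (prf x) (h x) (d + 1) (t x) (z x % 2 ^ d + 2 ^ d)) hW hWb
      fun V' hi lift => ?_).and
    (PD.near ((PT.const V 4).mul hH) ((hA.mul hA).add (hH.mul hH))
      ((PT.weight hh hhb hW ht hz).add ((PT.const V 2).mul (hH.mul hA)))))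
  have h2 := hi.two_pow hWb.idx
  have hp := (lift _ hz).mod h2
  have hi1 := hi.add (.const V' 1)
  exact PD.eq (PT.weight (lift _ hh) hhb.ext hi (lift _ ht) hp)
    ((PT.weight (lift _ hh) hhb.ext hi1 (lift _ ht) hp).add
      (PT.weight (lift _ hh) hhb.ext hi1 (lift _ ht) (hp.add h2)))

/-- A program sees the gate only through its tokens. The check therefore becomes a finite
conjunction over all gates `g` of the gate set and all local patterns `r`, each part being
conditional on the tokens naming `g` and on the relevant digits of `z` forming `r`. For fixed `g`,
`r`, `p` an entry is a function of the precision alone. -/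
theorem PD.rowOK {C : X → Circuit S} {E : Entries S}
    (hE : ∀ g r p, UnaryPT (E.pos g r p) ∧ UnaryPT (E.neg g r p))
    (hC : PT V fun x => encodeStr (C x).encode)
    (hh : PT V h) (hhb : PolyB h) (ht : PT V t) (htb : PolyB t) (hz : PT V z)
    (hzl : ∀ x, z x < 2 ^ ((C x).width + 1)) :
    PD V fun x => ∀ G ∈ (C x).gates[t x]?,
      G.RowOK (orc x) E (h x) (fun i => OraclePCP.ampl (prf x) (h x) (t x) i.num)
        (fun i => OraclePCP.ampl (prf x) (h x) (t x + 1) i.num)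
        (fun i => Verified (prf x) (h x) ((C x).width + 1) (t x) i.num)
        (Idx.ofNum (C x).width (z x)) := by
  classical
  have hH := hh.two_pow hhb
  have hW := hC.width.add (.const V 1)
  have hWb : PolyB fun x => (C x).width + 1 := (PolyB.width hC).add (.const 1)
  have hpos := hC.pos ht htb
  let tok : ℕ → X → ℕ := fun i x => (C x).tokens.getD ((C x).pos (t x) + i) 0
  have htok : ∀ i, PT V (tok i) := fun i => hC.token (hpos.add (.const V i))
  have htokb : ∀ i, PolyB (tok i) := fun i => PolyB.token hC _
  have hA' : PT V fun x => OraclePCP.ampl (prf x) (h x) (t x + 1) (z x) :=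
    PT.ampl hh hhb (ht.add (.const V 1)) hz
  -- The neighbour of `z` with local pattern `p`, as given by `Idx.num_subst`; its value matters
  -- only if the tokens describe a gate on `k` qubits.
  let nb : (k : ℕ) → Idx k → X → ℕ := fun k p x =>
    z x + (∑ j, (p.1 j).toNat * 2 ^ tok (1 + j) x + p.2.toNat * 2 ^ (C x).width) -
      (∑ j : Fin k, z x / 2 ^ tok (1 + j) x % 2 * 2 ^ tok (1 + j) x +
        z x / 2 ^ (C x).width % 2 * 2 ^ (C x).width)
  have hnb : ∀ k p, PT V (nb k p) := fun k p =>
    (hz.add ((PT.fintypeSum _ _ fun j _ => (PT.const V _).mul ((htok _).two_pow (htokb _))).add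
      ((PT.const V _).mul (hC.width.two_pow (.width hC))))).sub
    ((PT.fintypeSum _ _ fun j _ => (hz.bit (htok _) (htokb _)).mul
      ((htok _).two_pow (htokb _))).add
      ((hz.bit hC.width (.width hC)).mul (hC.width.two_pow (.width hC))))
  let A : (k : ℕ) → Idx k → X → ℕ := fun k p x => OraclePCP.ampl (prf x) (h x) (t x) (nb k p x)
  have hA : ∀ k p, PT V (A k p) := fun k p => PT.ampl hh hhb ht (hnb k p)
  let uni : Fin S.size → X → Prop := fun g x => tok 0 x = g + 1 →
    ∀ r ∈ (Finset.univ : Finset (Idx (S.arity g))),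
    ((∀ j ∈ (Finset.univ : Finset (Fin (S.arity g))), z x / 2 ^ tok (1 + j) x % 2 = (r.1 j).toNat) ∧
      z x / 2 ^ (C x).width % 2 = r.2.toNat) →
    (∀ p ∈ (Finset.univ : Finset (Idx (S.arity g))),
      Verified (prf x) (h x) ((C x).width + 1) (t x) (nb _ p x)) ∧
      Near (32 * 2 ^ h x)
        (2 ^ h x * OraclePCP.ampl (prf x) (h x) (t x + 1) (z x) +
          ∑ p, (E.pos g r p (h x) * 2 ^ h x + E.neg g r p (h x) * A _ p x))
        (2 ^ h x * 2 ^ h x + ∑ p, (E.pos g r p (h x) * A _ p x + E.neg g r p (h x) * 2 ^ h x))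
  have huni : ∀ g, PD V (uni g) := fun g =>
    (PD.eq (htok 0) (.const V _)).imp (PD.finsetAll _ _ fun r _ =>
      ((PD.finsetAll _ _ fun j _ => PD.eq (hz.bit (htok _) (htokb _)) (.const V _)).and
        (PD.eq (hz.bit hC.width (.width hC)) (.const V _))).imp
      ((PD.finsetAll _ _ fun p _ => PD.verified hh hhb hW hWb ht (hnb _ p)).and
        (PD.near ((PT.const V 32).mul hH)
          ((hH.mul hA').add (PT.fintypeSum _ _ fun p _ =>
            (((hE g r p).1 V h hh hhb).mul hH).add (((hE g r p).2 V h hh hhb).mul (hA _ p))))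
          ((hH.mul hH).add (PT.fintypeSum _ _ fun p _ =>
            (((hE g r p).1 V h hh hhb).mul (hA _ p)).add
              (((hE g r p).2 V h hh hhb).mul hH))))))
  -- The register content that encodes the oracle query, by `encodeStr_ofFn`; the last summand is
  -- the leading `1`.
  let str : X → ℕ := fun x => ∑ i ∈ Finset.range (tok 1 x),
    z x / 2 ^ ((C x).tokens.getD ((C x).pos (t x) + (2 + i)) 0) % 2 * 2 ^ i + 2 ^ tok 1 x
  have hstr : PT V str := (PT.bsum (fun x i =>
    z x / 2 ^ ((C x).tokens.getD ((C x).pos (t x) + (2 + i)) 0) % 2 * 2 ^ i) (htok 1) (htokb 1)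
      fun V' hi lift => ((lift _ hz).bit ((lift _ hC).token ((lift _ hpos).add
        ((PT.const V' 2).add hi))) (PolyB.token (lift _ hC) _)).mul
        (hi.two_pow (htokb 1).idx)).add ((htok 1).two_pow (htokb 1))
  have hans : PD V fun x => orc x (decodeStr (str x)) = true :=
    (PD.eq hstr.oracle (.const V 1)).congr fun x => by
      cases orc x (decodeStr (str x)) <;> simp
  have hAz : PT V fun x => OraclePCP.ampl (prf x) (h x) (t x) (z x) := PT.ampl hh hhb ht hz
  have hora : PD V fun x => tok 0 x = 0 →
      Verified (prf x) (h x) ((C x).width + 1) (t x) (z x) ∧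
      Near (32 * 2 ^ h x)
        (2 ^ h x * OraclePCP.ampl (prf x) (h x) (t x + 1) (z x) +
          if orc x (decodeStr (str x)) = true then
            2 ^ h x * OraclePCP.ampl (prf x) (h x) (t x) (z x) else 2 ^ h x * 2 ^ h x)
        (2 ^ h x * 2 ^ h x + if orc x (decodeStr (str x)) = true then 2 ^ h x * 2 ^ h x else
          2 ^ h x * OraclePCP.ampl (prf x) (h x) (t x) (z x)) :=
    (PD.eq (htok 0) (.const V 0)).imp ((PD.verified hh hhb hW hWb ht hz).and
      (PD.near ((PT.const V 32).mul hH)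
        ((hH.mul hA').add (hans.ite (hH.mul hAz) (hH.mul hH)))
        ((hH.mul hH).add (hans.ite (hH.mul hH) (hH.mul hAz)))))
  refine ((PD.lt ht hC.gates_length).imp
    ((PD.finsetAll Finset.univ uni fun g _ => huni g).and hora)).congr fun x => ?_
  by_cases hT : t x < (C x).gates.length
  swap
  · simp [hT]
  have hG := List.getElem?_eq_getElem hT
  have htk : ∀ i < (C x).gates[t x].tokens.length,
      tok i x = (C x).gates[t x].tokens.getD i 0 := fun i hi => (C x).tokens_getD hG hi
  simp only [hT, forall_const, hG, Option.mem_some_iff, forall_eq']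
  have htk' : ∀ i, i < (C x).gates[t x].tokens.length →
      (C x).tokens.getD ((C x).pos (t x) + i) 0 = (C x).gates[t x].tokens.getD i 0 := htk
  generalize (C x).gates[t x] = G at htk htk'
  have hzn := Idx.num_ofNum (hzl x)
  cases G with
  | oracle k q =>
    have h0 : tok 0 x = 0 := htk 0 (by simp [Gate.tokens])
    have h1 : tok 1 x = k := htk 1 (by simp [Gate.tokens])
    have hs : str x = encodeStr (List.ofFn ((Idx.ofNum (C x).width (z x)).1 ∘ q)) := by
      simp only [str]
      rw [encodeStr_ofFn, h1, Finset.sum_range]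
      congr 1
      refine Finset.sum_congr rfl fun i _ => ?_
      rw [htk' _ (by simp [Gate.tokens]; omega)]
      rw [show 2 + (i : ℕ) = i + 1 + 1 by omega]
      simp [Gate.tokens, Idx.ofNum, toNat_testBit_eq]
    have hu : ∀ g, uni g x := fun g hg => by simp [h0] at hg
    simp only [hu, implies_true, true_and, forall_const, h0, Gate.RowOK, hs,
      decodeStr_encodeStr, hzn]
  | unitary g q =>
    have h0 : tok 0 x = g + 1 := htk 0 (by simp [Gate.tokens])
    have hq : ∀ j : Fin (S.arity g), tok (1 + j) x = q j := fun j => by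
      rw [htk _ (by simp [Gate.tokens]; omega), add_comm]
      simp [Gate.tokens]
    have hu : (∀ g' ∈ (Finset.univ : Finset (Fin S.size)), uni g' x) ↔ uni g x :=
      ⟨fun h => h g (Finset.mem_univ _), fun h g' _ hg' => by
        have : g' = g := Fin.ext (by omega)
        exact this ▸ h (this ▸ hg')⟩
    have hnb' : ∀ p, nb _ p x = ((Idx.ofNum (C x).width (z x)).subst q p).num := fun p => by
      have := Idx.num_subst q (Idx.ofNum (C x).width (z x)) p
      simp only [nb, hq]
      rw [hzn] at this
      simp only [Idx.ofNum, toNat_testBit_eq] at this ⊢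
      omega
    rw [hu]
    simp only [h0, uni, forall_const, Nat.add_one_ne_zero, false_imp_iff, and_true, Gate.RowOK,
      A, hnb', Finset.mem_univ, hzn]
    constructor
    · intro H
      exact H ((Idx.ofNum (C x).width (z x)).restrict q)
        ⟨fun j => by simp [hq, Idx.restrict, Idx.ofNum, toNat_testBit_eq],
          by simp [Idx.restrict, Idx.ofNum, toNat_testBit_eq]⟩
    · rintro H r ⟨h1, h2⟩
      have : r = (Idx.ofNum (C x).width (z x)).restrict q := by
        refine Prod.ext (funext fun j => ?_) ?_
        · have := h1 j
          rw [hq, ← toNat_testBit_eq] at this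
          exact (toNat_injective this).symm
        · rw [← toNat_testBit_eq] at h2
          exact (toNat_injective h2).symm
      rw [this]
      exact H

theorem PD.roundOK {C : X → Circuit S} {E : Entries S}
    (hE : ∀ g r p, UnaryPT (E.pos g r p) ∧ UnaryPT (E.neg g r p))
    (hC : PT V fun x => encodeStr (C x).encode)
    (hh : PT V h) (hhb : PolyB h) (hz : PT V z) (hR : PT V R) :
    PD V fun x => RoundOK (orc x) (prf x) E (h x) (C x) (z x) (R x) := by
  have hW := hC.width.add (.const V 1)
  have hWb : PolyB fun x => (C x).width + 1 := (PolyB.width hC).add (.const 1)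
  have hT := hC.gates_length
  have hTb := PolyB.gates_length hC
  have hH := hh.two_pow hhb
  refine PD.and (PD.ball (fun x t => _) (hT.add (.const V 1)) (hTb.add (.const 1))
    fun V' hi lift => ?_)
    (PD.ball (fun x t => ∀ G ∈ (C x).gates[t]?, _) hT hTb fun V' hi lift => ?_)
  · have hz' := (PT.sample (lift _ hh) hhb.ext hi (lift _ hR)).mod
      (lift _ (hW.two_pow hWb))
    have hs := PT.start (lift _ hh) hhb.ext hi hz'
    exact (PD.verified (lift _ hh) hhb.ext (lift _ hW) hWb.ext hi hz').and
      ((PD.le hs (lift _ hR)).and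
      ((PD.lt (lift _ hR) (hs.add (PT.weight (lift _ hh) hhb.ext (lift _ hW) hi hz'))).and
      (((PD.eq hi (.const V' 0)).imp (PD.eq hz' (lift _ hz))).and
      ((PD.eq hi (lift _ hT)).imp ((PD.lt ((PT.const V' 10).mul (lift _ hR))
        ((PT.const V' 6).mul ((lift _ hH).mul (lift _ hH)))).imp
          (PD.eq (hz'.mod (.const V' 2)) (.const V' 0)))))))
  · exact PD.rowOK hE (lift _ hC) (lift _ hh) hhb.ext hi hTb.idx
      ((PT.sample (lift _ hh) hhb.ext (hi.add (.const V' 1)) (lift _ hR)).mod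
        (lift _ (hW.two_pow hWb))) fun p => Nat.mod_lt _ (by positivity)

end

end OraclePCP

namespace OraclePCP
variable {S : GateSet}

/-! ### Gates as real isometries -/

theorem extend_comp_self {k w : ℕ} (q : Fin k ↪ Fin w) (b : Fin k → Bool) (x : Fin w → Bool) :
    Function.extend q b x ∘ q = b := funext fun _ => q.injective.extend_apply _ _ _

theorem extend_extend {k w : ℕ} (q : Fin k ↪ Fin w) (b c : Fin k → Bool) (x : Fin w → Bool) :
    Function.extend q b (Function.extend q c x) = Function.extend q b x := by
  funext j
  by_cases h : ∃ a, q a = j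
  · obtain ⟨a, rfl⟩ := h
    simp [q.injective.extend_apply]
  · rw [Function.extend_apply' _ _ _ h, Function.extend_apply' _ _ _ h,
      Function.extend_apply' _ _ _ h]

theorem extend_restrict {k w : ℕ} (q : Fin k ↪ Fin w) (x : Fin w → Bool) :
    Function.extend q (x ∘ q) x = x := by
  funext j
  by_cases h : ∃ a, q a = j
  · obtain ⟨a, rfl⟩ := h
    simp [q.injective.extend_apply]
  · rw [Function.extend_apply' _ _ _ h]

/-- Exchanging the content of the qubits `q` with the separate string `b` is an involution on pairs,
so the sum over pairs does not change if the substituted string is replaced by the original one. -/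
theorem sum_extend {k w : ℕ} (q : Fin k ↪ Fin w) (F : (Fin w → Bool) → ℝ) :
    ∑ x, ∑ b, F (Function.extend q b x) = 2 ^ k * ∑ x, F x := by
  let e : (Fin w → Bool) × (Fin k → Bool) → (Fin w → Bool) × (Fin k → Bool) :=
    fun p => (Function.extend q p.2 p.1, p.1 ∘ q)
  have he : Function.Involutive e := fun p => by
    simp only [e, extend_comp_self, extend_extend, extend_restrict]
  rw [← Fintype.sum_prod_type' fun x b => F (Function.extend q b x)]
  calc ∑ p : (Fin w → Bool) × (Fin k → Bool), F (Function.extend q p.2 p.1)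
      = ∑ p : (Fin w → Bool) × (Fin k → Bool), F (e p).1 := rfl
    _ = ∑ p : (Fin w → Bool) × (Fin k → Bool), F p.1 :=
        Equiv.sum_comp he.toPerm fun p => F p.1
    _ = _ := by
        rw [Fintype.sum_prod_type]
        simp [Finset.mul_sum]

theorem sum_norm_sq_mulVec {n : Type*} [Fintype n] [DecidableEq n] {U : Matrix n n ℂ}
    (hU : U ∈ Matrix.unitaryGroup n ℂ) (v : n → ℂ) :
    ∑ a, ‖∑ b, U a b * v b‖ ^ 2 = ∑ b, ‖v b‖ ^ 2 := by
  have key : ∀ u : n → ℂ, ((∑ a, ‖u a‖ ^ 2 : ℝ) : ℂ) = star u ⬝ᵥ u := fun u => by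
    simp only [dotProduct, Pi.star_apply, Complex.ofReal_sum]
    refine Finset.sum_congr rfl fun a _ => ?_
    rw [Complex.star_def, ← Complex.normSq_eq_conj_mul_self, Complex.normSq_eq_norm_sq]
  have h : star (U.mulVec v) ⬝ᵥ U.mulVec v = star v ⬝ᵥ v := by
    rw [Matrix.star_mulVec, Matrix.dotProduct_mulVec, Matrix.vecMul_vecMul,
      ← Matrix.star_eq_conjTranspose, Matrix.mem_unitaryGroup_iff'.1 hU, Matrix.vecMul_one]
  rw [← key, ← key] at h
  exact_mod_cast h

/-- For fixed content of the other qubits the gate acts by its unitary matrix. Summing over these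
fibres by `sum_extend` counts each basis state `2 ^ S.arity g` times on both sides. -/
theorem Gate.sum_norm_sq_apply {w : ℕ} (O : Oracle) (G : Gate S w) (ψ : (Fin w → Bool) → ℂ) :
    ∑ x, ‖G.apply O ψ x‖ ^ 2 = ∑ x, ‖ψ x‖ ^ 2 := by
  cases G with
  | oracle k q =>
    refine Finset.sum_congr rfl fun x _ => ?_
    simp only [Gate.apply]
    split_ifs <;> simp
  | unitary g q =>
    have h : (2 : ℝ) ^ S.arity g ≠ 0 := by positivity
    refine mul_left_cancel₀ h ?_
    rw [← sum_extend q, ← sum_extend q]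
    refine Finset.sum_congr rfl fun x _ => ?_
    simp only [Gate.apply, extend_comp_self, extend_extend]
    exact sum_norm_sq_mulVec (S.unitary g) fun b => ψ (Function.extend q b x)

/-- A complex vector as a real vector. -/
def toReal {w : ℕ} (ψ : (Fin w → Bool) → ℂ) (i : Idx w) : ℝ :=
  if i.2 = true then (ψ i.1).im else (ψ i.1).re

/-- A real vector as a complex vector. -/
def toComplex {w : ℕ} (v : Idx w → ℝ) (x : Fin w → Bool) : ℂ := ⟨v (x, false), v (x, true)⟩

theorem toReal_toComplex {w : ℕ} (v : Idx w → ℝ) : toReal (toComplex v) = v := by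
  funext ⟨x, c⟩
  cases c <;> simp [toReal, toComplex]

theorem sum_toReal_sq {w : ℕ} (ψ : (Fin w → Bool) → ℂ) (p : (Fin w → Bool) → Prop)
    [DecidablePred p] :
    ∑ i : Idx w with p i.1, toReal ψ i ^ 2 = ∑ x with p x, ‖ψ x‖ ^ 2 := by
  rw [Finset.sum_filter, Fintype.sum_prod_type, Finset.sum_filter]
  refine Finset.sum_congr rfl fun x _ => ?_
  by_cases h : p x
  · simp only [h, if_true, Fintype.sum_bool, toReal, Bool.false_eq_true, if_false]
    rw [← Complex.normSq_eq_norm_sq, Complex.normSq_apply]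
    ring
  · simp [h]

/-- The entries of a gate, viewed as a real matrix. -/
def GateSet.realEntry (S : GateSet) (g : Fin S.size) (r p : Idx (S.arity g)) : ℝ :=
  -- A complex entry `a + b * I` becomes the real block with rows `a, -b` and `b, a`.
  if r.2 = p.2 then (S.mat g r.1 p.1).re
  else if r.2 = true then (S.mat g r.1 p.1).im else -(S.mat g r.1 p.1).im

/-- The action of a gate on real vectors. -/
noncomputable def Gate.realMap {w : ℕ} (O : Oracle) : Gate S w → (Idx w → ℝ) →ₗ[ℝ] (Idx w → ℝ)
  | .unitary g q =>
    { toFun := fun v i => ∑ p, S.realEntry g (i.restrict q) p * v (i.subst q p)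
      map_add' := fun u v => funext fun i => by simp [mul_add, Finset.sum_add_distrib]
      map_smul' := fun a v => funext fun i => by
        simp only [Pi.smul_apply, smul_eq_mul, RingHom.id_apply, Finset.mul_sum]
        exact Finset.sum_congr rfl fun p _ => by ring }
  | .oracle _ q =>
    { toFun := fun v i => (if O (List.ofFn (i.1 ∘ q)) = true then -1 else 1) * v i
      map_add' := fun u v => funext fun i => by simp [mul_add]
      map_smul' := fun a v => funext fun i => by
        simp only [Pi.smul_apply, smul_eq_mul, RingHom.id_apply]
        ring }

theorem Gate.realMap_toReal {w : ℕ} (O : Oracle) (G : Gate S w) (ψ : (Fin w → Bool) → ℂ) :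
    G.realMap O (toReal ψ) = toReal (G.apply O ψ) := by
  funext ⟨x, c⟩
  cases G with
  | oracle k q =>
    simp only [Gate.realMap, Gate.apply, LinearMap.coe_mk, AddHom.coe_mk, toReal]
    cases c <;> split_ifs <;> simp
  | unitary g q =>
    simp only [Gate.realMap, Gate.apply, LinearMap.coe_mk, AddHom.coe_mk, toReal,
      Fintype.sum_prod_type, Fintype.sum_bool, GateSet.realEntry, Idx.restrict, Idx.subst]
    cases c
    · simp only [Bool.false_eq_true, if_false, if_true, Complex.re_sum, Complex.mul_re]
      exact Finset.sum_congr rfl fun b _ => by ring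
    · simp only [Bool.true_eq_false, Bool.false_eq_true, if_false, if_true, Complex.im_sum, Complex.mul_im]

theorem Gate.sum_realMap_sq {w : ℕ} (O : Oracle) (G : Gate S w) (v : Idx w → ℝ) :
    ∑ i, G.realMap O v i ^ 2 = ∑ i, v i ^ 2 := by
  have h1 := sum_toReal_sq (G.apply O (toComplex v)) fun _ => True
  have h2 := sum_toReal_sq (toComplex v) fun _ => True
  simp only [Finset.filter_true, ← Gate.realMap_toReal, toReal_toComplex,
    Gate.sum_norm_sq_apply] at h1 h2
  rw [h1, h2]

theorem GateSet.abs_realEntry_le (S : GateSet) (g : Fin S.size) (r p : Idx (S.arity g)) :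
    |S.realEntry g r p| ≤ 1 := by
  have h := entry_norm_bound_of_unitary (S.unitary g) r.1 p.1
  have h1 := (Complex.abs_re_le_norm _).trans h
  have h2 := (Complex.abs_im_le_norm _).trans h
  unfold realEntry
  split_ifs
  · exact h1
  · exact h2
  · rwa [abs_neg]

/-- The state of the circuit, as a real vector, after the first `t` gates. -/
noncomputable def Circuit.stateAt (O : Oracle) (C : Circuit S) (x : List Bool) (t : ℕ) :
    Idx C.width → ℝ :=
  toReal ((C.gates.take t).foldl (fun ψ G => G.apply O ψ) (initialVec C.width x))

theorem Circuit.stateAt_succ (O : Oracle) (C : Circuit S) (x : List Bool) {t : ℕ}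
    {G : Gate S C.width} (hG : C.gates[t]? = some G) :
    C.stateAt O x (t + 1) = G.realMap O (C.stateAt O x t) := by
  obtain ⟨ht, rfl⟩ := List.getElem?_eq_some_iff.1 hG
  rw [stateAt, List.take_succ_eq_append_getElem ht, List.foldl_append, List.foldl_cons,
    List.foldl_nil, stateAt, Gate.realMap_toReal]

/-- The initial basis state. -/
def initIdx (w : ℕ) (x : List Bool) : Idx w := (fun j => x.getD j false, false)

theorem Circuit.stateAt_zero (O : Oracle) (C : Circuit S) (x : List Bool) :
    C.stateAt O x 0 = Pi.single (initIdx C.width x) 1 := by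
  funext ⟨y, c⟩
  simp only [stateAt, List.take_zero, List.foldl_nil, toReal, initialVec, initIdx, Pi.single_apply,
    Prod.mk.injEq, funext_iff]
  cases c <;> split_ifs <;> simp_all

theorem Circuit.acceptProb_eq (O : Oracle) (C : Circuit S) (x : List Bool) :
    C.acceptProb O x = ∑ i : Idx C.width with (∀ j : Fin C.width, (j : ℕ) = 0 → i.1 j = false),
      C.stateAt O x C.gates.length i ^ 2 := by
  rw [acceptProb, stateAt, List.take_length, ← sum_toReal_sq]
  rfl

theorem Circuit.sum_stateAt_sq (O : Oracle) (C : Circuit S) (x : List Bool) (t : ℕ) :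
    ∑ i, C.stateAt O x t i ^ 2 = 1 := by
  induction t with
  | zero => simp [stateAt_zero, Pi.single_apply]
  | succ t ih =>
    by_cases ht : t < C.gates.length
    · rw [C.stateAt_succ O x (List.getElem?_eq_getElem ht), Gate.sum_realMap_sq, ih]
    · rw [← ih, stateAt, stateAt, List.take_of_length_le (by omega),
        List.take_of_length_le (by omega)]

/-! ### Approximate histories of isometries -/

section

variable {ι : Type*} [Fintype ι]

theorem sum_sq_eq_norm_sq (v : ι → ℝ) :
    ∑ i, v i ^ 2 = ‖(WithLp.toLp 2 v : EuclideanSpace ℝ ι)‖ ^ 2 := by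
  rw [EuclideanSpace.norm_sq_eq]
  simp

/-- Outside `G` the vector `v` has weight at most `δ + 2 * η`. On `G` it is close to `u`, so `u` has
nearly all its weight there too and little outside. Outside `G` the squared difference is at most
twice the two weights, about `4 * δ`; the terms in `η` fit into the remaining `δ`. -/
theorem sum_sq_sub_le_of_good [DecidableEq ι] {u v : ι → ℝ} {δ ε η : ℝ} (G : Finset ι)
    (hη : 0 < η) (hηδ : 100 * η ≤ δ) (hδ : δ ≤ 1)
    (hu : ∑ i, u i ^ 2 ≤ 1 + η) (hv : ∑ i, v i ^ 2 ≤ 1 + η)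
    (hG : 1 - δ - η ≤ ∑ i ∈ G, v i ^ 2) (hε : Fintype.card ι * ε ^ 2 ≤ η ^ 2)
    (huv : ∀ i ∈ G, |v i - u i| ≤ ε) : ∑ i, (v i - u i) ^ 2 ≤ 5 * δ := by
  have h1 : ∑ i ∈ G, (v i - u i) ^ 2 ≤ η ^ 2 := by
    refine le_trans ?_ hε
    calc ∑ i ∈ G, (v i - u i) ^ 2 ≤ ∑ i ∈ G, ε ^ 2 :=
          Finset.sum_le_sum fun i hi => sq_le_sq' (by linarith [(abs_le.1 (huv i hi)).1])
            (abs_le.1 (huv i hi)).2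
      _ = G.card * ε ^ 2 := by simp
      _ ≤ _ := by
          gcongr
          exact Finset.card_le_univ G
  -- The weights in this inequality are chosen so that passing from `v` to `u` costs only a multiple
  -- of `η`.
  have h2 : ∑ i ∈ G, v i ^ 2 ≤ (1 + η) * ∑ i ∈ G, u i ^ 2 + (1 + 1 / η) * η ^ 2 := by
    have : ∑ i ∈ G, v i ^ 2 ≤
        (1 + η) * ∑ i ∈ G, u i ^ 2 + (1 + 1 / η) * ∑ i ∈ G, (v i - u i) ^ 2 := by
      rw [Finset.mul_sum, Finset.mul_sum, ← Finset.sum_add_distrib]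
      refine Finset.sum_le_sum fun i _ => ?_
      have h : (1 + η) * u i ^ 2 + (1 + 1 / η) * (v i - u i) ^ 2 - v i ^ 2 =
          (η * u i - (v i - u i)) ^ 2 / η := by
        field_simp
        ring
      have : 0 ≤ (η * u i - (v i - u i)) ^ 2 / η := by positivity
      linarith
    have h3 : 0 ≤ 1 + 1 / η := by positivity
    nlinarith [mul_le_mul_of_nonneg_left h1 h3]
  have h3 : (1 + 1 / η) * η ^ 2 = η ^ 2 + η := by field_simp
  have su : ∑ i ∈ G, u i ^ 2 + ∑ i ∈ Gᶜ, u i ^ 2 = ∑ i, u i ^ 2 := Finset.sum_add_sum_compl _ _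
  have sv : ∑ i ∈ G, v i ^ 2 + ∑ i ∈ Gᶜ, v i ^ 2 = ∑ i, v i ^ 2 := Finset.sum_add_sum_compl _ _
  have sd : ∑ i ∈ G, (v i - u i) ^ 2 + ∑ i ∈ Gᶜ, (v i - u i) ^ 2 = ∑ i, (v i - u i) ^ 2 :=
    Finset.sum_add_sum_compl _ _
  have h4 : ∑ i ∈ Gᶜ, (v i - u i) ^ 2 ≤ 2 * ∑ i ∈ Gᶜ, v i ^ 2 + 2 * ∑ i ∈ Gᶜ, u i ^ 2 := by
    rw [Finset.mul_sum, Finset.mul_sum, ← Finset.sum_add_distrib]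
    exact Finset.sum_le_sum fun i _ => by nlinarith [sq_nonneg (v i + u i)]
  have h5 : 0 ≤ ∑ i ∈ Gᶜ, u i ^ 2 := Finset.sum_nonneg fun i _ => sq_nonneg _
  have h6 : η ^ 2 ≤ η := by nlinarith
  have h7 : η * ∑ i ∈ G, u i ^ 2 ≤ η * (1 + η) := by
    gcongr
    linarith
  nlinarith

/-- If a sequence of vectors follows isometries up to small weight, starts at a basis vector, and
has large weight on a set of coordinates at the end, then the exact sequence has, too. -/
theorem history_sound [DecidableEq ι] {T : ℕ} (U : ℕ → (ι → ℝ) →ₗ[ℝ] (ι → ℝ))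
    (hU : ∀ t < T, ∀ v, ∑ i, U t v i ^ 2 = ∑ i, v i ^ 2) (x₀ : ι) (ψ : ℕ → ι → ℝ)
    (hψ₀ : ψ 0 = Pi.single x₀ 1) (hψ : ∀ t < T, ψ (t + 1) = U t (ψ t)) (θ : ℕ → ι → ℝ)
    (G : ℕ → Finset ι) (acc : Finset ι) {δ ε η : ℝ} (hη : 0 < η) (hηδ : 100 * η ≤ δ)
    (hδ : 1000 * (T + 1) ^ 2 * δ ≤ 1) (h1 : ∀ t ≤ T, ∑ i, θ t i ^ 2 ≤ 1 + η)
    (h2 : ∀ t ≤ T, 1 - δ - η ≤ ∑ i ∈ G t, θ t i ^ 2)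
    (h3 : ∀ t < T, ∀ i ∈ G (t + 1), |θ (t + 1) i - U t (θ t) i| ≤ ε)
    (hε : Fintype.card ι * ε ^ 2 ≤ η ^ 2) (h0 : G 0 ⊆ {x₀})
    (hacc : 3 / 5 - δ - η ≤ ∑ i ∈ acc, θ T i ^ 2) : 1 / 3 < ∑ i ∈ acc, ψ T i ^ 2 := by
  by_contra hcon
  push Not at hcon
  have hδ0 : 0 < δ := by linarith
  have hδ1 : δ ≤ 1 / 1000 := by
    have : (1 : ℝ) ≤ (T + 1) ^ 2 := one_le_pow₀ (by linarith [(Nat.cast_nonneg T : (0 : ℝ) ≤ T)])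
    nlinarith
  let N : (ι → ℝ) → ℝ := fun v => ‖(WithLp.toLp 2 v : EuclideanSpace ℝ ι)‖
  have hN : ∀ v, ∑ i, v i ^ 2 = N v ^ 2 := sum_sq_eq_norm_sq
  have hNU : ∀ t < T, ∀ v, N (U t v) = N v := fun t ht v => by
    have := hU t ht v
    rw [hN, hN] at this
    exact (sq_eq_sq₀ (norm_nonneg _) (norm_nonneg _)).1 this
  have hNadd : ∀ u v, N (u + v) ≤ N u + N v := fun u v => norm_add_le _ _
  let κ := √(5 * δ)
  have hκ : κ ^ 2 = 5 * δ := Real.sq_sqrt (by positivity)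
  have hκ0 : 0 ≤ κ := Real.sqrt_nonneg _
  have hNle : ∀ v : ι → ℝ, ∑ i, v i ^ 2 ≤ 5 * δ → N v ≤ κ := fun v h => by
    rw [hN] at h
    exact Real.le_sqrt_of_sq_le h
  have hstep : ∀ t < T, N (θ (t + 1) - U t (θ t)) ≤ κ := fun t ht => hNle _
    (sum_sq_sub_le_of_good (G (t + 1)) hη hηδ (by linarith)
      ((hU t ht _).trans_le (h1 t ht.le)) (h1 _ ht) (h2 _ ht) hε (h3 t ht))
  -- The claimed history may start with the wrong sign or a slightly wrong length, so it is compared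
  -- with `α • ψ`; in the end only `α ^ 2` enters.
  let α := θ 0 x₀
  have hα : α ^ 2 ≤ 1 + η := (Finset.single_le_sum (f := fun i => θ 0 i ^ 2)
    (fun i _ => sq_nonneg _) (Finset.mem_univ x₀)).trans (h1 0 (Nat.zero_le _))
  -- Isometries preserve the accumulated error. Each step adds `κ`, and so does the start, whence `t
  -- + 1`.
  have hmain : ∀ t ≤ T, N (θ t - α • ψ t) ≤ (t + 1) * κ := by
    intro t
    induction t with
    | zero =>
      intro _
      have ha : 1 - δ - η ≤ α ^ 2 := (h2 0 (Nat.zero_le _)).trans <|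
        (Finset.sum_le_sum_of_subset_of_nonneg h0 fun i _ _ => sq_nonneg _).trans (by simp [α])
      have hb := h1 0 (Nat.zero_le _)
      rw [← Finset.add_sum_erase _ _ (Finset.mem_univ x₀)] at hb
      have hc : ∑ i, (θ 0 - α • ψ 0) i ^ 2 = ∑ i ∈ Finset.univ.erase x₀, θ 0 i ^ 2 := by
        rw [← Finset.add_sum_erase _ _ (Finset.mem_univ x₀)]
        simp only [hψ₀, Pi.sub_apply, Pi.smul_apply, Pi.single_eq_same, smul_eq_mul, mul_one]
        rw [show (θ 0 x₀ - α) ^ 2 = 0 by simp [α], zero_add]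
        refine Finset.sum_congr rfl fun i hi => ?_
        simp [Pi.single_eq_of_ne (Finset.ne_of_mem_erase hi)]
      have := hNle (θ 0 - α • ψ 0) (by
        rw [hc]
        have : α ^ 2 = θ 0 x₀ ^ 2 := rfl
        linarith)
      simpa using this
    | succ t ih =>
      intro ht
      have ht' : t < T := ht
      have e : θ (t + 1) - α • ψ (t + 1) =
          (θ (t + 1) - U t (θ t)) + U t (θ t - α • ψ t) := by
        rw [map_sub, map_smul, hψ t ht']
        abel
      rw [e]
      refine (hNadd _ _).trans ?_
      rw [hNU t ht']
      push_cast
      linarith [hstep t ht', ih ht'.le]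
  let P : (ι → ℝ) → ι → ℝ := fun v i => if i ∈ acc then v i else 0
  have hP : ∀ v, ∑ i ∈ acc, v i ^ 2 = N (P v) ^ 2 := fun v => by
    rw [← hN]
    simp [P, Finset.sum_ite_mem, ite_pow]
  have hPle : ∀ v, N (P v) ≤ N v := fun v => by
    refine le_of_sq_le_sq ?_ (norm_nonneg _)
    rw [← hP, ← hN]
    exact Finset.sum_le_sum_of_subset_of_nonneg (Finset.subset_univ _) fun i _ _ => sq_nonneg _
  have hsplit : P (θ T) = P (θ T - α • ψ T) + α • P (ψ T) := by
    funext i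
    by_cases hi : i ∈ acc <;> simp [P, hi]
  have hsm : N (α • P (ψ T)) ^ 2 = α ^ 2 * N (P (ψ T)) ^ 2 := by
    rw [← hN, ← hN, Finset.mul_sum]
    simp [mul_pow]
  have ha := (hPle _).trans (hmain T le_rfl)
  have hb := hNadd (P (θ T - α • ψ T)) (α • P (ψ T))
  rw [← hsplit] at hb
  rw [hP] at hacc hcon
  have hA : N (P (θ T - α • ψ T)) ^ 2 ≤ 1 / 200 := by
    refine (pow_le_pow_left₀ (norm_nonneg _) ha 2).trans ?_
    rw [mul_pow, hκ]
    linarith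
  have hB : N (α • P (ψ T)) ^ 2 ≤ (1 + η) / 3 := by
    rw [hsm]
    nlinarith [sq_nonneg α, sq_nonneg (N (P (ψ T)))]
  have hC := pow_le_pow_left₀ (norm_nonneg _ : 0 ≤ N (P (θ T))) hb 2
  -- The square yields `(a + b) ^ 2 ≤ 6 * a ^ 2 + 6 / 5 * b ^ 2`, at most `6 / 200 + 2 / 5 * (1 +
  -- η)`, which is less than `3 / 5 - δ - η`.
  nlinarith [sq_nonneg (5 * N (P (θ T - α • ψ T)) - N (α • P (ψ T)))]

end

end OraclePCP

namespace OraclePCP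
variable {S : GateSet}

/-! ### Soundness of one round -/

/-- In a tree of weights that is consistent along the paths to the leaves in `V`, the weights of
these leaves do not exceed the weight of the node that they descend from. -/
theorem tree_sum_le (G : ℕ → ℕ → ℕ) {W : ℕ} (V : Finset ℕ) (hV : ∀ z ∈ V, z < 2 ^ W)
    (hG : ∀ z ∈ V, ∀ d < W, G d (z % 2 ^ d) =
      G (d + 1) (z % 2 ^ d) + G (d + 1) (z % 2 ^ d + 2 ^ d)) {d : ℕ} (hd : d ≤ W) (p : ℕ) :
    ∑ z ∈ V with z % 2 ^ d = p, G W z ≤ G d p := by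
  induction hd using Nat.decreasingInduction generalizing p with
  | self =>
    refine (Finset.sum_le_sum_of_subset (t := {p}) fun z hz => ?_).trans (by simp)
    obtain ⟨h1, h2⟩ := Finset.mem_filter.1 hz
    rw [Nat.mod_eq_of_lt (hV z h1)] at h2
    simp [h2]
  | of_succ d hd ih =>
    -- A node without leaves of `V` below it may be inconsistent, but then the sum is empty;
    -- otherwise any such leaf vouches for the node.
    rcases (V.filter fun z => z % 2 ^ d = p).eq_empty_or_nonempty with h | ⟨z, hz⟩
    · simp [h]
    obtain ⟨h1, h2⟩ := Finset.mem_filter.1 hz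
    have h3 := hG z h1 d hd
    rw [h2] at h3
    rw [h3]
    refine le_trans ?_ (add_le_add (ih p) (ih (p + 2 ^ d)))
    have hp : p < 2 ^ d := h2 ▸ Nat.mod_lt _ (by positivity)
    rw [← Finset.sum_union]
    · refine Finset.sum_le_sum_of_subset fun z hz => ?_
      obtain ⟨h1, h2⟩ := Finset.mem_filter.1 hz
      have h4 := Nat.mod_pow_succ (x := z) (b := 2) (k := d)
      simp only [Finset.mem_union, Finset.mem_filter, h1, true_and]
      rcases Nat.mod_two_eq_zero_or_one (z / 2 ^ d) with h | h
      · left; rw [h4, h2, h]; simp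
      · right; rw [h4, h2, h]; simp
    · rw [Finset.disjoint_left]
      intro z hz hz'
      have e1 := (Finset.mem_filter.1 hz).2
      have e2 := (Finset.mem_filter.1 hz').2
      have : 0 < 2 ^ d := by positivity
      omega

theorem Near.abs_le {τ a b : ℕ} (h : Near τ a b) : |(a : ℝ) - b| ≤ τ := by
  obtain ⟨h1, h2⟩ := h
  refine _root_.abs_le.2 ⟨?_, ?_⟩
  · have : (b : ℝ) ≤ a + τ := by exact_mod_cast h2
    linarith
  · have : (a : ℝ) ≤ b + τ := by exact_mod_cast h1
    linarith

/-- The entries approximate those of the gates with precision `h`. -/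
def Entries.Approx (E : Entries S) : Prop := ∀ g r p h,
  |S.realEntry g r p - ((E.pos g r p h : ℝ) - E.neg g r p h) / 2 ^ h| ≤ 1 / 2 ^ h

theorem GateSet.card_idx_le (S : GateSet) (g : Fin S.size) :
    (Fintype.card (Idx (S.arity g)) : ℝ) ≤ 8 := by
  rcases S.arity_eq g with h | h
  · simp [h]
    norm_num
  · simp [h]

/-- A claimed amplitude as a real number. -/
noncomputable def amp (h a : ℕ) : ℝ := ((a : ℝ) - 2 ^ h) / 2 ^ h

/-- The tolerance of the check contributes `32 / 2 ^ h`, and the approximation of at most eight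
entries, against coordinates of size at most `3`, another `24 / 2 ^ h`. The neighbours have to
satisfy `v`, because only there `θ` is the claimed amplitude. -/
theorem Gate.RowOK.abs_sub_le {w : ℕ} {O : Oracle} {E : Entries S} (hE : E.Approx) {h : ℕ}
    {A A' : Idx w → ℕ} {v : Idx w → Prop} {i : Idx w} {G : Gate S w}
    (hG : G.RowOK O E h A A' v i) {θ : Idx w → ℝ} (hθ : ∀ j, v j → θ j = amp h (A j))
    (hθ' : ∀ j, |θ j| ≤ 3) : |amp h (A' i) - G.realMap O θ i| ≤ 64 / 2 ^ h := by
  have hH : (0 : ℝ) < 2 ^ h := by positivity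
  cases G with
  | oracle k q =>
    obtain ⟨h1, h2⟩ := hG
    have h3 := h2.abs_le
    simp only [Gate.realMap, LinearMap.coe_mk, AddHom.coe_mk, hθ i h1, amp]
    have e : ((A' i : ℝ) - 2 ^ h) / 2 ^ h - (if O (List.ofFn (i.1 ∘ q)) = true then -1 else 1) *
        (((A i : ℝ) - 2 ^ h) / 2 ^ h) = (((2 ^ h * A' i + if O (List.ofFn (i.1 ∘ q)) = true then
          2 ^ h * A i else 2 ^ h * 2 ^ h : ℕ) : ℝ) -
        ((2 ^ h * 2 ^ h + if O (List.ofFn (i.1 ∘ q)) = true then 2 ^ h * 2 ^ h else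
          2 ^ h * A i : ℕ) : ℝ)) / (2 ^ h * 2 ^ h) := by
      split_ifs <;> push_cast <;> field_simp <;> ring
    rw [e, abs_div, abs_of_pos (by positivity : (0 : ℝ) < 2 ^ h * 2 ^ h),
      div_le_div_iff₀ (by positivity) hH]
    refine (mul_le_mul_of_nonneg_right h3 hH.le).trans ?_
    push_cast
    nlinarith [mul_pos hH hH]
  | unitary g q =>
    obtain ⟨h1, h2⟩ := hG
    have h3 := h2.abs_le
    simp only [Gate.realMap, LinearMap.coe_mk, AddHom.coe_mk]
    have e1 : |amp h (A' i) - ∑ p, (((E.pos g (i.restrict q) p h : ℝ) -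
        E.neg g (i.restrict q) p h) / 2 ^ h) * θ (i.subst q p)| ≤ 32 / 2 ^ h := by
      have e : amp h (A' i) - ∑ p, (((E.pos g (i.restrict q) p h : ℝ) -
        E.neg g (i.restrict q) p h) / 2 ^ h) * θ (i.subst q p) =
        (((2 ^ h * A' i + ∑ p, (E.pos g (i.restrict q) p h * 2 ^ h +
          E.neg g (i.restrict q) p h * A (i.subst q p)) : ℕ) : ℝ) -
        ((2 ^ h * 2 ^ h + ∑ p, (E.pos g (i.restrict q) p h * A (i.subst q p) +
          E.neg g (i.restrict q) p h * 2 ^ h) : ℕ) : ℝ)) / (2 ^ h * 2 ^ h) := by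
        have e3 : ∀ p, (((E.pos g (i.restrict q) p h : ℝ) - E.neg g (i.restrict q) p h) / 2 ^ h) *
            θ (i.subst q p) = ((E.pos g (i.restrict q) p h * A (i.subst q p) +
            E.neg g (i.restrict q) p h * 2 ^ h) - (E.pos g (i.restrict q) p h * 2 ^ h +
            E.neg g (i.restrict q) p h * A (i.subst q p))) / (2 ^ h * 2 ^ h) := fun p => by
          rw [hθ _ (h1 p), amp]
          field_simp
          ring
        simp only [e3, ← Finset.sum_div, Finset.sum_sub_distrib]
        push_cast
        rw [amp]
        field_simp
        ring
      rw [e, abs_div, abs_of_pos (by positivity : (0 : ℝ) < 2 ^ h * 2 ^ h),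
        div_le_div_iff₀ (by positivity) hH]
      refine (mul_le_mul_of_nonneg_right h3 hH.le).trans ?_
      push_cast
      nlinarith [mul_pos hH hH]
    have e2 : |∑ p, (((E.pos g (i.restrict q) p h : ℝ) - E.neg g (i.restrict q) p h) / 2 ^ h) *
        θ (i.subst q p) - ∑ p, S.realEntry g (i.restrict q) p * θ (i.subst q p)| ≤ 24 / 2 ^ h := by
      rw [← Finset.sum_sub_distrib]
      refine (Finset.abs_sum_le_sum_abs _ _).trans ?_
      refine (Finset.sum_le_card_nsmul _ _ (3 / 2 ^ h) fun p _ => ?_).trans ?_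
      · rw [← sub_mul, abs_mul, abs_sub_comm]
        calc _ ≤ 1 / 2 ^ h * 3 := mul_le_mul (hE g _ p h) (hθ' _) (abs_nonneg _) (by positivity)
          _ = _ := by ring
      · rw [nsmul_eq_mul, Finset.card_univ]
        calc _ ≤ 8 * (3 / 2 ^ h : ℝ) :=
              mul_le_mul_of_nonneg_right (S.card_idx_le g) (by positivity)
          _ = _ := by ring
    calc _ ≤ _ := _root_.abs_sub_le _ _ _
      _ ≤ 32 / 2 ^ h + 24 / 2 ^ h := add_le_add e1 e2
      _ ≤ _ := by rw [← add_div]; gcongr; norm_num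

theorem Verified.abs_sub_le {π : List Bool} {h W t z : ℕ} (hv : Verified π h W t z) :
    |amp h (ampl π h t z) ^ 2 - weight π h W t z / (2 ^ h * 2 ^ h)| ≤ 4 / 2 ^ h := by
  have hH : (0 : ℝ) < 2 ^ h := by positivity
  have h3 := hv.2.2.abs_le
  have e : amp h (ampl π h t z) ^ 2 - weight π h W t z / (2 ^ h * 2 ^ h) =
      (((ampl π h t z * ampl π h t z + 2 ^ h * 2 ^ h : ℕ) : ℝ) -
      ((weight π h W t z + 2 * (2 ^ h * ampl π h t z) : ℕ) : ℝ)) / (2 ^ h * 2 ^ h) := by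
    rw [amp]
    push_cast
    field_simp
    ring
  rw [e, abs_div, abs_of_pos (by positivity : (0 : ℝ) < 2 ^ h * 2 ^ h),
    div_le_div_iff₀ (by positivity) hH]
  refine (mul_le_mul_of_nonneg_right h3 hH.le).trans (le_of_eq ?_)
  push_cast
  ring

/-- If most random numbers pass the checks, then the circuit accepts with probability more than
`1 / 3`. -/
theorem acceptProb_gt_of_roundOK (O : Oracle) (π : List Bool) (C : Circuit S) (x : List Bool)
    {E : Entries S} (hE : E.Approx) (h : ℕ) {δ η : ℝ} (hη : 0 < η) (hηδ : 100 * η ≤ δ)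
    (hδ : 1000 * (C.gates.length + 1) ^ 2 * δ ≤ 1)
    (hh : 64 * 2 ^ (C.width + 1) ≤ η * 2 ^ h) (P : Finset ℕ)
    (hP : ∀ R ∈ P, R < 2 ^ h * 2 ^ h ∧ RoundOK O π E h C (initIdx C.width x).num R)
    (hcard : (1 - δ) * (2 ^ h * 2 ^ h) ≤ P.card) : 1 / 3 < C.acceptProb O x := by
  classical
  have hH : (0 : ℝ) < 2 ^ h := by positivity
  have hη1 : η ≤ 1 := by
    have : (1 : ℝ) ≤ (C.gates.length + 1) ^ 2 :=
      one_le_pow₀ (by linarith [(Nat.cast_nonneg C.gates.length : (0 : ℝ) ≤ _)])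
    nlinarith
  have hW1 : (1 : ℝ) ≤ 2 ^ (C.width + 1) := one_le_pow₀ (by norm_num)
  have hcardI : (Fintype.card (Idx C.width) : ℝ) = 2 ^ (C.width + 1) := by
    simp [pow_succ]
  have h4H : (4 : ℝ) / 2 ^ h ≤ 1 := by
    rw [div_le_one hH]
    nlinarith
  have hsmall : (Fintype.card (Idx C.width) : ℝ) * (4 / 2 ^ h) ≤ η := by
    rw [hcardI, mul_div_assoc', div_le_iff₀ hH]
    nlinarith
  let v : ℕ → Idx C.width → Prop := fun t i => Verified π h (C.width + 1) t i.num
  let N : ℕ → Idx C.width → ℕ := fun t i => weight π h (C.width + 1) t i.num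
  -- Unverified amplitudes are replaced by zero; the tree then controls the norm of the whole
  -- vector, although almost none of it is ever read.
  let θ : ℕ → Idx C.width → ℝ := fun t i => if v t i then amp h (ampl π h t i.num) else 0
  let smp : ℕ → ℕ → Idx C.width := fun t R =>
    Idx.ofNum C.width (sample π h t R % 2 ^ (C.width + 1))
  have hsmp : ∀ t R, (smp t R).num = sample π h t R % 2 ^ (C.width + 1) := fun t R =>
    Idx.num_ofNum (Nat.mod_lt _ (by positivity))
  have hnum : Function.Injective (Idx.num (w := C.width)) :=
    Function.LeftInverse.injective (g := Idx.ofNum C.width) Idx.ofNum_num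
  have hNsum : ∀ t, ∑ i with v t i, N t i ≤ 2 ^ h * 2 ^ h := by
    intro t
    rcases (Finset.univ.filter (v t)).eq_empty_or_nonempty with he | ⟨i, hi⟩
    · simp [he]
    rw [← (Finset.mem_filter.1 hi).2.1]
    have := tree_sum_le (fun d p => weight π h d t p) (W := C.width + 1)
      ((Finset.univ.filter (v t)).map ⟨Idx.num, hnum⟩) (by
        intro z hz
        obtain ⟨j, _, rfl⟩ := Finset.mem_map.1 hz
        exact j.num_lt) (by
        intro z hz
        obtain ⟨j, hj, rfl⟩ := Finset.mem_map.1 hz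
        exact (Finset.mem_filter.1 hj).2.2.1) (Nat.zero_le _) 0
    simpa [Nat.mod_one] using this
  have hleaf : ∀ t i, v t i → |θ t i ^ 2 - N t i / (2 ^ h * 2 ^ h)| ≤ 4 / 2 ^ h := fun t i hi => by
    simp only [θ, hi, if_true]
    exact Verified.abs_sub_le hi
  have hNsum' : ∀ t, ∑ i with v t i, (N t i : ℝ) / (2 ^ h * 2 ^ h) ≤ 1 := fun t => by
    rw [← Finset.sum_div, div_le_one (by positivity)]
    exact_mod_cast hNsum t
  have hconst : ∀ s : Finset (Idx C.width), ∑ i ∈ s, (4 / 2 ^ h : ℝ) ≤ η := fun s => by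
    rw [Finset.sum_const, nsmul_eq_mul]
    refine le_trans ?_ hsmall
    gcongr
    exact Finset.card_le_univ s
  have h1 : ∀ t, ∑ i, θ t i ^ 2 ≤ 1 + η := by
    intro t
    have : ∑ i, θ t i ^ 2 = ∑ i with v t i, θ t i ^ 2 := by
      rw [Finset.sum_filter]
      refine Finset.sum_congr rfl fun i _ => ?_
      by_cases hi : v t i <;> simp [θ, hi]
    rw [this]
    calc _ ≤ ∑ i with v t i, ((N t i : ℝ) / (2 ^ h * 2 ^ h) + 4 / 2 ^ h) :=
          Finset.sum_le_sum fun i hi => by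
            linarith [(abs_le.1 (hleaf t i (Finset.mem_filter.1 hi).2)).2]
      _ ≤ _ := by
          rw [Finset.sum_add_distrib]
          exact add_le_add (hNsum' t) (hconst _)
  have hθ3 : ∀ t i, |θ t i| ≤ 3 := fun t i => by
    have : θ t i ^ 2 ≤ 1 + η := (Finset.single_le_sum (f := fun i => θ t i ^ 2)
      (fun i _ => sq_nonneg _) (Finset.mem_univ i)).trans (h1 t)
    exact abs_le_of_sq_le_sq (by linarith) (by norm_num)
  -- The passing `R` that select `i` lie in one interval of length `N t i`, so there are at most
  -- that many. Disjointness of the claimed intervals is not needed.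
  have hcount : ∀ t ≤ C.gates.length, ∀ Q ⊆ P,
      (Q.card : ℝ) / (2 ^ h * 2 ^ h) - η ≤ ∑ i ∈ Q.image (smp t), θ t i ^ 2 := by
    intro t ht Q hQ
    have hr : ∀ R ∈ Q, v t (smp t R) ∧ start π h t (smp t R).num ≤ R ∧
        R < start π h t (smp t R).num + N t (smp t R) := fun R hR => by
      have := (hP R (hQ hR)).2.1 t (by omega)
      simp only [v, N, hsmp]
      exact ⟨this.1, this.2.1, this.2.2.1⟩
    have hc : Q.card ≤ ∑ i ∈ Q.image (smp t), N t i := by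
      rw [Finset.card_eq_sum_card_image (smp t)]
      refine Finset.sum_le_sum fun i _ => ?_
      refine (Finset.card_le_card (t := Finset.Ico (start π h t i.num)
        (start π h t i.num + N t i)) fun R hR => ?_).trans (by simp)
      obtain ⟨hRQ, rfl⟩ := Finset.mem_filter.1 hR
      exact Finset.mem_Ico.2 (hr R hRQ).2
    have hc' : (Q.card : ℝ) / (2 ^ h * 2 ^ h) ≤
        ∑ i ∈ Q.image (smp t), (N t i : ℝ) / (2 ^ h * 2 ^ h) := by
      rw [← Finset.sum_div]
      gcongr
      exact_mod_cast hc
    have : ∑ i ∈ Q.image (smp t), (N t i : ℝ) / (2 ^ h * 2 ^ h) ≤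
        ∑ i ∈ Q.image (smp t), (θ t i ^ 2 + 4 / 2 ^ h) := Finset.sum_le_sum fun i hi => by
      obtain ⟨R, hR, rfl⟩ := Finset.mem_image.1 hi
      linarith [(abs_le.1 (hleaf t _ (hr R hR).1)).1]
    rw [Finset.sum_add_distrib] at this
    linarith [hconst (Q.image (smp t))]
  have hPM : 1 - δ ≤ (P.card : ℝ) / (2 ^ h * 2 ^ h) := by
    rwa [le_div_iff₀ (by positivity)]
  let U : ℕ → (Idx C.width → ℝ) →ₗ[ℝ] (Idx C.width → ℝ) := fun t =>
    (C.gates[t]?).elim 0 fun G => G.realMap O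
  have hU : ∀ t, ∀ ht : t < C.gates.length, U t = (C.gates[t]).realMap O := fun t ht => by
    simp [U, List.getElem?_eq_getElem ht]
  rw [C.acceptProb_eq]
  refine history_sound U (fun t ht v => ?_) (initIdx C.width x) (C.stateAt O x)
    (C.stateAt_zero O x) (fun t ht => ?_) θ (fun t => P.image (smp t)) _ (ε := 64 / 2 ^ h) hη hηδ hδ
    (fun t _ => h1 t) (fun t ht => ?_) (fun t ht i hi => ?_) ?_ ?_ ?_
  · rw [hU t ht, Gate.sum_realMap_sq]
  · rw [hU t ht, C.stateAt_succ O x (List.getElem?_eq_getElem ht)]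
  · linarith [hcount t ht P subset_rfl]
  · obtain ⟨R, hR, rfl⟩ := Finset.mem_image.1 hi
    have hv : v (t + 1) (smp (t + 1) R) := by
      have := (hP R hR).2.1 (t + 1) (by omega)
      simp only [v, hsmp]
      exact this.1
    have hrow := (hP R hR).2.2 t ht _ (List.getElem?_eq_getElem ht)
    rw [hU t ht]
    simp only [θ, hv, if_true]
    exact hrow.abs_sub_le hE (fun j hj => by simp only [v]; rw [if_pos hj]) (hθ3 t)
  · rw [hcardI, div_pow, mul_div_assoc', div_le_iff₀ (by positivity), ← mul_pow]
    refine le_trans ?_ (pow_le_pow_left₀ (by positivity) hh 2)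
    nlinarith
  · intro i hi
    obtain ⟨R, hR, rfl⟩ := Finset.mem_image.1 hi
    have := (hP R hR).2.1 0 (by omega)
    rw [Finset.mem_singleton, ← Idx.ofNum_num (initIdx C.width x), ← this.2.2.2.1 rfl]
  · let Q := P.filter fun R => 10 * R < 6 * (2 ^ h * 2 ^ h)
    have hQ := hcount C.gates.length le_rfl Q (Finset.filter_subset _ _)
    -- The quotient is `3 / 5 * M` rounded up; the numbers from there up to `M` are all that `P` can
    -- lose.
    have hQc : P.card + (6 * (2 ^ h * 2 ^ h) + 9) / 10 ≤ Q.card + 2 ^ h * 2 ^ h := by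
      rw [← Finset.card_filter_add_card_filter_not (s := P)
        (fun R => 10 * R < 6 * (2 ^ h * 2 ^ h))]
      have : (P.filter fun R => ¬ 10 * R < 6 * (2 ^ h * 2 ^ h)).card ≤
          2 ^ h * 2 ^ h - (6 * (2 ^ h * 2 ^ h) + 9) / 10 := by
        rw [← Nat.card_Ico]
        refine Finset.card_le_card fun R hR => ?_
        obtain ⟨h1, h2⟩ := Finset.mem_filter.1 hR
        have := (hP R h1).1
        rw [Finset.mem_Ico]
        omega
      have h3 : 4 ≤ 2 ^ h * 2 ^ h := by
        have h5 : (4 : ℝ) ≤ 2 ^ h := by rwa [div_le_one hH] at h4H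
        have h6 : 4 ≤ 2 ^ h := by exact_mod_cast h5
        nlinarith
      simp only [Q]
      omega
    have hQc' : (P.card : ℝ) + 6 * (2 ^ h * 2 ^ h) / 10 ≤ Q.card + 2 ^ h * 2 ^ h := by
      have h3 : 10 * P.card + 6 * (2 ^ h * 2 ^ h) ≤ 10 * Q.card + 10 * (2 ^ h * 2 ^ h) := by omega
      have h4 : 10 * (P.card : ℝ) + 6 * (2 ^ h * 2 ^ h) ≤ 10 * Q.card + 10 * (2 ^ h * 2 ^ h) := by
        exact_mod_cast h3
      linarith
    have hQM : 3 / 5 - δ ≤ (Q.card : ℝ) / (2 ^ h * 2 ^ h) := by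
      rw [le_div_iff₀ (by positivity)]
      linarith
    have hQs : 3 / 5 - δ - η ≤ ∑ i ∈ Q.image (smp C.gates.length), θ C.gates.length i ^ 2 := by
      linarith
    refine hQs.trans (Finset.sum_le_sum_of_subset_of_nonneg
      (fun i hi => ?_) fun i _ _ => sq_nonneg _)
    obtain ⟨R, hR, rfl⟩ := Finset.mem_image.1 hi
    obtain ⟨h1, h2⟩ := Finset.mem_filter.1 hR
    have := ((hP R h1).2.1 C.gates.length (by omega)).2.2.2.2 rfl h2
    simp only [Finset.mem_filter, Finset.mem_univ, true_and]
    intro j hj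
    rw [Nat.mod_mod_of_dvd _ (dvd_pow_self 2 (Nat.succ_ne_zero _))] at this
    simp [smp, Idx.ofNum, hj, this]

end OraclePCP

namespace OraclePCP
variable {S : GateSet}

/-! ### The honest proof -/

/-- Probabilities can be rounded to multiples of `1 / M` that sum to one. The numbers below `M` are
divided into intervals of the corresponding lengths, in the order given by `f`. -/
theorem exists_intervals {ι : Type*} [Fintype ι] {p : ι → ℝ} (hp : ∀ i, 0 ≤ p i)
    (hp1 : ∑ i, p i = 1) (M : ℕ) {f : ι → ℕ} (hf : Function.Injective f) :
    ∃ (F N : ι → ℕ) (s : ℕ → ι), (∑ i, N i = M) ∧ (∀ i, |(N i : ℝ) - M * p i| ≤ 1) ∧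
      (∀ R < M, F (s R) ≤ R ∧ R < F (s R) + N (s R)) ∧ (∀ i, F i ≤ M) ∧ (∀ i, p i = 0 → N i = 0) ∧
      ∀ i, M * ∑ j with f j < f i, p j < F i + 1 := by
  classical
  let c : ℕ → ℝ := fun n => ∑ j with f j < n, p j
  -- Cumulative sums are rounded instead of the probabilities: consecutive intervals fit together,
  -- the total is exactly `M`, each length is off by at most one, and probability zero gives an
  -- empty interval.
  let F : ℕ → ℕ := fun n => ⌊M * c n⌋₊
  have hc0 : ∀ n, 0 ≤ c n := fun n => Finset.sum_nonneg fun i _ => hp i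
  have hcs : ∀ i, c (f i + 1) = c (f i) + p i := fun i => by
    have : (Finset.univ.filter fun j => f j < f i + 1) =
        insert i (Finset.univ.filter fun j => f j < f i) := by
      ext j
      simp only [Finset.mem_filter, Finset.mem_univ, true_and, Finset.mem_insert,
        Nat.lt_succ_iff_lt_or_eq, hf.eq_iff]
      tauto
    simp only [c]
    rw [this, Finset.sum_insert (by simp), add_comm]
  have hcn : ∀ n, (∀ i, f i ≠ n) → c (n + 1) = c n := fun n hn => by
    refine Finset.sum_congr (Finset.filter_congr fun j _ => ?_) fun _ _ => rfl
    have := hn j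
    omega
  have hFmono : ∀ i, F (f i) ≤ F (f i + 1) := fun i => by
    refine Nat.floor_le_floor ?_
    rw [hcs]
    have := hp i
    gcongr
    linarith
  obtain ⟨m, hm⟩ : ∃ m, ∀ i, f i < m := ⟨Finset.univ.sup f + 1, fun i =>
    Nat.lt_succ_of_le (Finset.le_sup (Finset.mem_univ i))⟩
  have hcm : c m = 1 := by simp [c, hm, hp1]
  have hFm : F m = M := by simp [F, hcm]
  have hc1 : ∀ n, c n ≤ 1 := fun n => by
    rw [← hp1]
    exact Finset.sum_le_sum_of_subset_of_nonneg (Finset.subset_univ _) fun i _ _ => hp i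
  have hFs : ∀ n, ∑ i with f i < n, (F (f i + 1) - F (f i)) = F n := by
    intro n
    induction n with
    | zero => simp [F, c]
    | succ n ih =>
      by_cases h : ∃ i, f i = n
      · obtain ⟨i, rfl⟩ := h
        have : (Finset.univ.filter fun j => f j < f i + 1) =
            insert i (Finset.univ.filter fun j => f j < f i) := by
          ext j
          simp only [Finset.mem_filter, Finset.mem_univ, true_and, Finset.mem_insert,
            Nat.lt_succ_iff_lt_or_eq, hf.eq_iff]
          tauto
        rw [this, Finset.sum_insert (by simp), ih]
        have := hFmono i
        omega
      · push Not at h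
        have e : F (n + 1) = F n := by simp only [F, hcn n h]
        rw [e, ← ih]
        refine Finset.sum_congr (Finset.filter_congr fun j _ => ?_) fun _ _ => rfl
        have := h j
        omega
  have hs : ∀ R < M, ∃ i, F (f i) ≤ R ∧ R < F (f i) + (F (f i + 1) - F (f i)) := by
    intro R hR
    have hex : ∃ n, R < F n := ⟨m, by rwa [hFm]⟩
    have h1 := Nat.find_spec hex
    have h0 : Nat.find hex ≠ 0 := fun h => by
      rw [h] at h1
      simp [F, c] at h1
    obtain ⟨n, hn⟩ := Nat.exists_eq_succ_of_ne_zero h0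
    have h2 : F n ≤ R := not_lt.1 (Nat.find_min hex (by omega))
    rw [hn] at h1
    by_cases h : ∃ i, f i = n
    · obtain ⟨i, rfl⟩ := h
      exact ⟨i, h2, by rw [Nat.succ_eq_add_one] at h1; omega⟩
    · push Not at h
      simp only [F, Nat.succ_eq_add_one, hcn n h] at h1 h2
      omega
  have hne : Nonempty ι := by
    by_contra h
    rw [not_nonempty_iff] at h
    simp at hp1
  choose! s hs using hs
  refine ⟨fun i => F (f i), fun i => F (f i + 1) - F (f i), s, ?_, fun i => ?_, hs, fun i => ?_,
    fun i hi => by simp only [F, hcs, hi, add_zero, Nat.sub_self], fun i => Nat.lt_floor_add_one _⟩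
  · have := hFs m
    simpa [hm, hFm] using this
  · have h1 := Nat.floor_le (a := M * c (f i)) (by have := hc0 (f i); positivity)
    have h2 := Nat.lt_floor_add_one (M * c (f i))
    have h3 := Nat.floor_le (a := M * c (f i + 1)) (by have := hc0 (f i + 1); positivity)
    have h4 := Nat.lt_floor_add_one (M * c (f i + 1))
    rw [Nat.cast_sub (hFmono i), abs_le]
    rw [hcs] at h3 h4
    simp only [F, hcs]
    constructor <;> linarith
  · rw [← hFm]
    refine Nat.floor_le_floor ?_
    rw [hcm]
    have := hc1 (f i)
    gcongr

/-- Fields may be prescribed. -/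
theorem exists_proof_of_fields (v : ℕ → ℕ → ℕ → ℕ) (κ : ℕ) :
    ∃ π : List Bool, π.length = 2 ^ (4 * κ) ∧ ∀ a < 2 ^ κ, ∀ b < 2 ^ κ, ∀ c < 2 ^ κ,
      v a b c < 2 ^ κ → field π κ a b c = v a b c := by
  -- An address is split into its four digits in base `2 ^ κ`: the three arguments of the field and
  -- the index of the bit.
  let bit : ℕ → Bool := fun n => (v (n / 2 ^ κ / 2 ^ κ / 2 ^ κ) (n / 2 ^ κ / 2 ^ κ % 2 ^ κ)
    (n / 2 ^ κ % 2 ^ κ)).testBit (n % 2 ^ κ)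
  refine ⟨List.ofFn fun n : Fin (2 ^ (4 * κ)) => bit n, by simp, fun a ha b hb c hc hv => ?_⟩
  conv_rhs => rw [← binNum_testBit hv]
  unfold field binNum
  refine Finset.sum_congr rfl fun i hi => ?_
  have hD : 0 < 2 ^ κ := by positivity
  have hi : i < 2 ^ κ := (Finset.mem_range.1 hi).trans Nat.lt_two_pow_self
  have h1 : a * 2 ^ κ + b < 2 ^ κ * 2 ^ κ := by nlinarith
  have h2 : (a * 2 ^ κ + b) * 2 ^ κ + c < 2 ^ κ * 2 ^ κ * 2 ^ κ := by nlinarith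
  have h3 : ((a * 2 ^ κ + b) * 2 ^ κ + c) * 2 ^ κ + i < 2 ^ κ * 2 ^ κ * 2 ^ κ * 2 ^ κ := by
    nlinarith
  have e : 2 ^ (4 * κ) = 2 ^ κ * 2 ^ κ * 2 ^ κ * 2 ^ κ := by ring
  have key : ∀ m r, r < 2 ^ κ → (m * 2 ^ κ + r) / 2 ^ κ = m ∧ (m * 2 ^ κ + r) % 2 ^ κ = r :=
    fun m r hr => ⟨by rw [mul_comm, Nat.mul_add_div hD, Nat.div_eq_of_lt hr, add_zero], by
      rw [mul_comm, Nat.mul_add_mod, Nat.mod_eq_of_lt hr]⟩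
  beta_reduce
  rw [List.getD_eq_getElem _ _ (by rw [List.length_ofFn, e]; exact h3), List.getElem_ofFn]
  simp only [bit]
  rw [(key _ _ hi).1, (key _ _ hi).2, (key _ _ hc).1, (key _ _ hc).2, (key _ _ hb).1,
    (key _ _ hb).2]

theorem near_of_abs_le {τ a b : ℕ} (h : |(a : ℝ) - b| ≤ τ) : Near τ a b := by
  obtain ⟨h1, h2⟩ := abs_le.1 h
  constructor
  · have : (a : ℝ) ≤ (b + τ : ℕ) := by push_cast; linarith
    exact_mod_cast this
  · have : (b : ℝ) ≤ (a + τ : ℕ) := by push_cast; linarith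
    exact_mod_cast this

/-- In units of `2 ^ h`, rounding the new amplitude contributes at most `1`, and each of the at most
eight terms of the row at most `2`, one for the entry and one for the old amplitude. The total `17`
is within the tolerance `32`. -/
theorem Gate.rowOK_of_close {w : ℕ} {O : Oracle} {E : Entries S} (hE : E.Approx) {h : ℕ}
    {A A' : Idx w → ℕ} {v : Idx w → Prop} (hv : ∀ i, v i) {ψ : Idx w → ℝ} (G : Gate S w)
    (hA : ∀ i, |((A i : ℝ) - 2 ^ h) - 2 ^ h * ψ i| ≤ 1) (hAH : ∀ i, |(A i : ℝ) - 2 ^ h| ≤ 2 ^ h)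
    (hA' : ∀ i, |((A' i : ℝ) - 2 ^ h) - 2 ^ h * G.realMap O ψ i| ≤ 1) (i : Idx w) :
    G.RowOK O E h A A' v i := by
  have hH : (0 : ℝ) < 2 ^ h := by positivity
  have hi' := hA' i
  cases G with
  | oracle k q =>
    refine ⟨hv i, near_of_abs_le ?_⟩
    have hi := hA i
    simp only [Gate.realMap, LinearMap.coe_mk, AddHom.coe_mk] at hi'
    rw [abs_le] at hi hi'
    rw [abs_le]
    push_cast
    split_ifs at hi' ⊢ <;> constructor <;> nlinarith
  | unitary g q =>
    refine ⟨fun p => hv _, near_of_abs_le ?_⟩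
    simp only [Gate.realMap, LinearMap.coe_mk, AddHom.coe_mk] at hi'
    let e : Idx (S.arity g) → ℝ := fun p =>
      (E.pos g (i.restrict q) p h : ℝ) - E.neg g (i.restrict q) p h
    let a : Idx (S.arity g) → ℝ := fun p => (A (i.subst q p) : ℝ) - 2 ^ h
    let W : Idx (S.arity g) → ℝ := fun p => S.realEntry g (i.restrict q) p
    have e1 : ((2 ^ h * A' i + ∑ p, (E.pos g (i.restrict q) p h * 2 ^ h +
          E.neg g (i.restrict q) p h * A (i.subst q p)) : ℕ) : ℝ) -
        ((2 ^ h * 2 ^ h + ∑ p, (E.pos g (i.restrict q) p h * A (i.subst q p) +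
          E.neg g (i.restrict q) p h * 2 ^ h) : ℕ) : ℝ) =
        2 ^ h * (((A' i : ℝ) - 2 ^ h) - 2 ^ h * ∑ p, W p * ψ (i.subst q p)) -
          ∑ p, ((e p - 2 ^ h * W p) * a p + 2 ^ h * (W p * (a p - 2 ^ h * ψ (i.subst q p)))) := by
      have e2 : ∀ p, (e p - 2 ^ h * W p) * a p + 2 ^ h * (W p * (a p - 2 ^ h * ψ (i.subst q p))) =
          ((E.pos g (i.restrict q) p h * A (i.subst q p) + E.neg g (i.restrict q) p h * 2 ^ h) -
          (E.pos g (i.restrict q) p h * 2 ^ h + E.neg g (i.restrict q) p h * A (i.subst q p))) -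
          2 ^ h * (2 ^ h * (W p * ψ (i.subst q p))) := fun p => by
        simp only [e, a]
        ring
      simp only [e2, Finset.sum_sub_distrib, ← Finset.mul_sum]
      push_cast
      ring
    have e3 : |∑ p, ((e p - 2 ^ h * W p) * a p +
        2 ^ h * (W p * (a p - 2 ^ h * ψ (i.subst q p))))| ≤ 16 * 2 ^ h := by
      refine (Finset.abs_sum_le_sum_abs _ _).trans ?_
      refine (Finset.sum_le_card_nsmul _ _ (2 * 2 ^ h) fun p _ => ?_).trans ?_
      · have b1 : |e p - 2 ^ h * W p| ≤ 1 := by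
          have := hE g (i.restrict q) p h
          rw [show S.realEntry g (i.restrict q) p - ((E.pos g (i.restrict q) p h : ℝ) -
            E.neg g (i.restrict q) p h) / 2 ^ h = -(e p - 2 ^ h * W p) / 2 ^ h by
              simp only [e, W]; field_simp; ring, abs_div, abs_neg, abs_of_pos hH] at this
          exact (div_le_div_iff_of_pos_right hH).1 this
        have b2 : |W p| ≤ 1 := S.abs_realEntry_le _ _ _
        have b3 := hA (i.subst q p)
        have b4 := hAH (i.subst q p)
        have c1 : |(e p - 2 ^ h * W p) * a p| ≤ 1 * 2 ^ h := by
          rw [abs_mul]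
          exact mul_le_mul b1 b4 (abs_nonneg _) zero_le_one
        have c2 : |2 ^ h * (W p * (a p - 2 ^ h * ψ (i.subst q p)))| ≤ 2 ^ h * (1 * 1) := by
          rw [abs_mul, abs_mul, abs_of_pos hH]
          exact mul_le_mul_of_nonneg_left (mul_le_mul b2 b3 (abs_nonneg _) zero_le_one) hH.le
        refine (abs_add_le _ _).trans ?_
        linarith
      · rw [nsmul_eq_mul, Finset.card_univ]
        calc _ ≤ 8 * (2 * 2 ^ h : ℝ) :=
              mul_le_mul_of_nonneg_right (S.card_idx_le g) (by positivity)
          _ = _ := by ring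
    have e4 : |2 ^ h * (((A' i : ℝ) - 2 ^ h) - 2 ^ h * ∑ p, W p * ψ (i.subst q p))| ≤ 2 ^ h := by
      rw [abs_mul, abs_of_pos hH]
      exact mul_le_of_le_one_right hH.le hi'
    rw [e1]
    refine (abs_sub _ _).trans ?_
    push_cast
    linarith

/-- An order of basis states in which those with first qubit `0` come first. -/
def Idx.rank {w : ℕ} (i : Idx w) : ℕ := i.num % 2 * 2 ^ (w + 1) + i.num

theorem Idx.num_injective {w : ℕ} : Function.Injective (Idx.num (w := w)) :=
  Function.LeftInverse.injective (g := Idx.ofNum w) Idx.ofNum_num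

theorem Idx.rank_injective {w : ℕ} : Function.Injective (Idx.rank (w := w)) := by
  intro i j hij
  refine Idx.num_injective ?_
  have h := congrArg (· % 2 ^ (w + 1)) hij
  simpa [rank, Nat.mod_eq_of_lt i.num_lt, Nat.mod_eq_of_lt j.num_lt] using h

theorem Idx.num_mod_two {w : ℕ} (i : Idx w) (hw : 0 < w) : i.num % 2 = (i.1 ⟨0, hw⟩).toNat := by
  have := congrArg Bool.toNat (congrFun (congrArg Prod.fst i.ofNum_num) ⟨0, hw⟩)
  rw [← this]
  simp only [ofNum]
  rw [toNat_testBit_eq, pow_zero, Nat.div_one]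

/-- If the circuit accepts with probability at least `2 / 3`, then there is a proof that passes all
checks. -/
theorem exists_roundOK (O : Oracle) (C : Circuit S) (x : List Bool) {E : Entries S}
    (hE : E.Approx) {h : ℕ} (hh : 2 ≤ h) (hw : 0 < C.width) (hwh : C.width + 1 ≤ h)
    (hT : C.gates.length ≤ h) (hacc : 2 / 3 ≤ C.acceptProb O x) :
    ∃ π : List Bool, π.length = 2 ^ (4 * (2 * h + 1)) ∧
      ∀ R < 2 ^ h * 2 ^ h, RoundOK O π E h C (initIdx C.width x).num R := by
  classical
  have hH : (0 : ℝ) < 2 ^ h := by positivity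
  have hH4 : 4 ≤ 2 ^ h := (show 4 = 2 ^ 2 by norm_num) ▸ Nat.pow_le_pow_right (by norm_num) hh
  have hHh : h < 2 ^ h := Nat.lt_two_pow_self
  have hκ : 2 ^ (2 * h + 1) = 2 * (2 ^ h * 2 ^ h) := by ring
  have hW2 : 2 ^ (C.width + 1) ≤ 2 ^ h := Nat.pow_le_pow_right (by norm_num) hwh
  have hMH : 4 * 2 ^ h ≤ 2 ^ h * 2 ^ h := Nat.mul_le_mul_right _ hH4
  let ψ := C.stateAt O x
  choose F N s hN1 hN hs hFM hN0 hF using fun t => exists_intervals (p := fun i => ψ t i ^ 2)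
    (fun i => sq_nonneg _) (C.sum_stateAt_sq O x t) (2 ^ h * 2 ^ h) (Idx.rank_injective)
  let A : ℕ → Idx C.width → ℕ := fun t i => ⌊2 ^ h + 2 ^ h * ψ t i⌋₊
  have hψ1 : ∀ t i, |ψ t i| ≤ 1 := fun t i => by
    have : ψ t i ^ 2 ≤ 1 := (Finset.single_le_sum (f := fun i => ψ t i ^ 2)
      (fun i _ => sq_nonneg _) (Finset.mem_univ i)).trans (C.sum_stateAt_sq O x t).le
    exact abs_le_of_sq_le_sq (by linarith) (by norm_num)
  have hA : ∀ t i, |((A t i : ℝ) - 2 ^ h) - 2 ^ h * ψ t i| ≤ 1 := fun t i => by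
    have h0 := (abs_le.1 (hψ1 t i)).1
    have h1 := Nat.floor_le (a := 2 ^ h + 2 ^ h * ψ t i) (by nlinarith)
    have h2 := Nat.lt_floor_add_one (2 ^ h + 2 ^ h * ψ t i)
    rw [abs_le]
    constructor <;> linarith
  have hAH : ∀ t i, |(A t i : ℝ) - 2 ^ h| ≤ 2 ^ h := fun t i => by
    obtain ⟨h0, h0'⟩ := abs_le.1 (hψ1 t i)
    have h1 := Nat.floor_le (a := 2 ^ h + 2 ^ h * ψ t i) (by nlinarith)
    have h2 : (0 : ℝ) ≤ A t i := Nat.cast_nonneg _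
    rw [abs_le]
    constructor <;> nlinarith
  have hA2 : ∀ t i, A t i ≤ 2 * 2 ^ h := fun t i => by
    have := (abs_le.1 (hAH t i)).2
    have h2 : (A t i : ℝ) ≤ (2 * 2 ^ h : ℕ) := by push_cast; linarith
    exact_mod_cast h2
  -- Inner nodes are sums of the integer leaf weights, so the consistency checks along paths hold
  -- exactly.
  let node : ℕ → ℕ → ℕ → ℕ := fun d t p => ∑ i with i.num % 2 ^ d = p, N t i
  have hnode : ∀ d t p, node d t p ≤ 2 ^ h * 2 ^ h := fun d t p => by
    rw [← hN1 t]
    exact Finset.sum_le_sum_of_subset (Finset.subset_univ _)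
  let val : ℕ → ℕ → ℕ → ℕ := fun a t z => match a with
    | 0 => A t (Idx.ofNum C.width z)
    | 1 => F t (Idx.ofNum C.width z)
    | 2 => (s t z).num
    | d + 3 => node d t z
  obtain ⟨π, hπ, hval⟩ := exists_proof_of_fields val (2 * h + 1)
  rw [hκ] at hval
  refine ⟨π, hπ, ?_⟩
  have fA : ∀ t ≤ C.gates.length, ∀ i : Idx C.width, ampl π h t i.num = A t i := by
    intro t ht i
    have := i.num_lt
    have h2 := hA2 t i
    have e : val 0 t i.num = A t i := by simp only [val, Idx.ofNum_num]
    rw [← e]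
    exact hval 0 (by omega) t (by omega) i.num (by omega) (by omega)
  have fF : ∀ t ≤ C.gates.length, ∀ i : Idx C.width, start π h t i.num = F t i := by
    intro t ht i
    have := i.num_lt
    have h2 := hFM t i
    have e : val 1 t i.num = F t i := by simp only [val, Idx.ofNum_num]
    rw [← e]
    exact hval 1 (by omega) t (by omega) i.num (by omega) (by omega)
  have fS : ∀ t ≤ C.gates.length, ∀ R < 2 ^ h * 2 ^ h, sample π h t R = (s t R).num := by
    intro t ht R hR
    have := (s t R).num_lt
    have e : val 2 t R = (s t R).num := rfl
    rw [← e]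
    exact hval 2 (by omega) t (by omega) R (by omega) (by omega)
  have fG : ∀ d ≤ C.width + 1, ∀ t ≤ C.gates.length, ∀ p < 2 ^ h * 2 ^ h,
      weight π h d t p = node d t p := by
    intro d hd t ht p hp
    have := hnode d t p
    rw [weight, Nat.add_comm 3 d]
    have e : val (d + 3) t p = node d t p := rfl
    rw [← e]
    exact hval (d + 3) (by omega) t (by omega) p (by omega) (by omega)
  have hleaf : ∀ t (i : Idx C.width), node (C.width + 1) t i.num = N t i := by
    intro t i
    have : (Finset.univ.filter fun j : Idx C.width => j.num % 2 ^ (C.width + 1) = i.num) = {i} := by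
      ext j
      simp [Nat.mod_eq_of_lt j.num_lt, Idx.num_injective.eq_iff]
    simp only [node]
    rw [this, Finset.sum_singleton]
  have hsplit : ∀ d t p, p < 2 ^ d →
      node d t p = node (d + 1) t p + node (d + 1) t (p + 2 ^ d) := by
    intro d t p hp
    simp only [node]
    rw [← Finset.sum_union]
    · refine Finset.sum_congr ?_ fun _ _ => rfl
      ext i
      have h4 := Nat.mod_pow_succ (x := i.num) (b := 2) (k := d)
      have h5 : i.num % 2 ^ d < 2 ^ d := Nat.mod_lt _ (by positivity)
      simp only [Finset.mem_union, Finset.mem_filter, Finset.mem_univ, true_and]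
      rcases Nat.mod_two_eq_zero_or_one (i.num / 2 ^ d) with h | h <;> rw [h] at h4 <;> omega
    · rw [Finset.disjoint_left]
      intro z hz hz'
      have e1 := (Finset.mem_filter.1 hz).2
      have e2 := (Finset.mem_filter.1 hz').2
      have : 0 < 2 ^ d := by positivity
      omega
  have hver : ∀ t ≤ C.gates.length, ∀ i : Idx C.width,
      Verified π h (C.width + 1) t i.num := by
    intro t ht i
    refine ⟨?_, fun d hd => ?_, near_of_abs_le ?_⟩
    · rw [fG 0 (by omega) t ht 0 (by omega), ← hN1 t]
      simp [node, Nat.mod_one]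
    · have h5 : i.num % 2 ^ d < 2 ^ d := Nat.mod_lt _ (by positivity)
      have h6 : 2 ^ (d + 1) ≤ 2 ^ h := Nat.pow_le_pow_right (by norm_num) (by omega)
      rw [pow_succ] at h6
      rw [fG d hd.le t ht _ (by omega), fG (d + 1) hd t ht _ (by omega),
        fG (d + 1) hd t ht _ (by omega), hsplit d t _ h5]
    · have := i.num_lt
      rw [fG _ le_rfl t ht _ (by omega), fA t ht, hleaf]
      have h1 := hA t i
      have h2 := hN t i
      have h3 := hAH t i
      have h4 := hψ1 t i
      have h5 : (4 : ℝ) ≤ 2 ^ h := by exact_mod_cast hH4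
      push_cast at h2 ⊢
      -- Factored as a difference of squares. Together with the error of at most `1` in `N t i` this
      -- stays below the tolerance `4 * 2 ^ h`.
      have h6 : |((A t i : ℝ) - 2 ^ h) ^ 2 - (2 ^ h * ψ t i) ^ 2| ≤ 2 * 2 ^ h := by
        have : ((A t i : ℝ) - 2 ^ h) ^ 2 - (2 ^ h * ψ t i) ^ 2 =
          (((A t i : ℝ) - 2 ^ h) - 2 ^ h * ψ t i) * (((A t i : ℝ) - 2 ^ h) + 2 ^ h * ψ t i) := by
          ring
        rw [this, abs_mul]
        have h7 : |((A t i : ℝ) - 2 ^ h) + 2 ^ h * ψ t i| ≤ 2 ^ h + 2 ^ h * 1 := by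
          refine (abs_add_le _ _).trans (add_le_add h3 ?_)
          rw [abs_mul, abs_of_pos hH]
          gcongr
        nlinarith [abs_nonneg (((A t i : ℝ) - 2 ^ h) - 2 ^ h * ψ t i)]
      rw [abs_le] at h2 h6 ⊢
      constructor <;> nlinarith
  intro R hR
  have hmod : ∀ t ≤ C.gates.length, sample π h t R % 2 ^ (C.width + 1) = (s t R).num :=
    fun t ht => by rw [fS t ht R hR, Nat.mod_eq_of_lt (s t R).num_lt]
  refine ⟨fun t ht => ?_, fun t ht G hG => ?_⟩
  · have ht : t ≤ C.gates.length := by omega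
    have hlt := (s t R).num_lt
    rw [hmod t ht, fF t ht, fG _ le_rfl t ht _ (by omega), hleaf]
    refine ⟨hver t ht _, (hs t R hR).1, (hs t R hR).2, ?_, ?_⟩
    · rintro rfl
      have h2 := hs 0 R hR
      -- Any state other than the input has probability zero at time `0`, hence an empty interval.
      by_contra hne
      have h3 : s 0 R ≠ initIdx C.width x := fun h => hne (by rw [h])
      have h4 := hN0 0 (s 0 R) (by simp [ψ, C.stateAt_zero, Pi.single_eq_of_ne h3])
      omega
    · rintro rfl hR6
      -- If the selected state has first qubit `1`, all accepting states precede it, so its interval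
      -- starts above `2 / 3 * M - 1`. For `M ≥ 16`, that is `2 ≤ h`, this contradicts `R < 3 / 5 *
      -- M`.
      by_contra hodd
      have hodd : (s C.gates.length R).num % 2 = 1 := by omega
      have h1 := hF C.gates.length (s C.gates.length R)
      have h2 : C.acceptProb O x ≤ ∑ j with j.rank < (s C.gates.length R).rank,
          ψ C.gates.length j ^ 2 := by
        rw [C.acceptProb_eq]
        refine Finset.sum_le_sum_of_subset_of_nonneg (fun i hi => ?_) fun i _ _ => sq_nonneg _
        have h3 := (Finset.mem_filter.1 hi).2 ⟨0, hw⟩ rfl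
        have h4 := i.num_mod_two hw
        have h5 := i.num_lt
        rw [h3] at h4
        simp only [Finset.mem_filter, Finset.mem_univ, true_and, Idx.rank, h4, hodd]
        simp
        omega
      have h3 := (hs C.gates.length R hR).1
      have h4 : (F C.gates.length (s C.gates.length R) : ℝ) ≤ R := by exact_mod_cast h3
      have h5 : 10 * (R : ℝ) < 6 * (2 ^ h * 2 ^ h) := by exact_mod_cast hR6
      have h6 : (4 : ℝ) ≤ 2 ^ h := by exact_mod_cast hH4
      push_cast at h1
      nlinarith [mul_le_mul_of_nonneg_left (hacc.trans h2) (mul_pos hH hH).le]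
  · have h1 := C.stateAt_succ O x hG
    rw [hmod (t + 1) ht, Idx.ofNum_num]
    have e1 : (fun i : Idx C.width => ampl π h t i.num) = A t := funext fun i => fA t ht.le i
    have e2 : (fun i : Idx C.width => ampl π h (t + 1) i.num) = A (t + 1) :=
      funext fun i => fA (t + 1) ht i
    rw [e1, e2]
    exact Gate.rowOK_of_close hE (hver t ht.le) G (hA t) (hAH t)
      (fun i => by rw [← h1]; exact hA (t + 1) i) _

end OraclePCP

namespace OraclePCP
open World
variable {S : GateSet}

/-! ### Determinism and coins -/

theorem Exec.unique {O : Oracle} {π : List Bool} {P : Prog} {s t t' : State}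
    (run : Exec O π P s t) (run' : Exec O π P s t') : t = t' := by
  induction run generalizing t' with
  | coin s i b ρ h =>
    cases run' with
    | coin _ _ b' ρ' h2 =>
      rw [h] at h2
      injection h2 with h3 h4
      rw [h3, h4]
  | seq _ _ ih1 ih2 =>
    cases run' with
    | seq a b => obtain rfl := ih1 a; exact ih2 b
  | ite_true h _ ih =>
    cases run' with
    | ite_true _ a => exact ih a
    | ite_false h2 _ => exact absurd h2 h
  | ite_false h _ ih =>
    cases run' with
    | ite_true h2 _ => exact absurd h h2
    | ite_false _ a => exact ih a
  | loop_step h _ _ ih1 ih2 =>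
    cases run' with
    | loop_step _ a b => obtain rfl := ih1 a; exact ih2 b
    | loop_done h2 => exact absurd h2 h
  | loop_done h =>
    cases run' with
    | loop_step h2 _ _ => exact absurd h h2
    | loop_done _ => rfl
  | _ => cases run'; rfl

/-- The number with binary digits `l`, most significant first, appended to those of `a`. -/
def pushBits (a : ℕ) (l : List Bool) : ℕ := l.foldl (fun a b => 2 * a + b.toNat) a

theorem pushBits_lt (a : ℕ) (l : List Bool) : pushBits a l < (a + 1) * 2 ^ l.length := by
  induction l generalizing a with
  | nil => simp [pushBits]
  | cons b l ih =>
    have h := ih (2 * a + b.toNat)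
    have hb := b.toNat_lt
    rw [List.length_cons, pow_succ]
    calc pushBits a (b :: l) = pushBits (2 * a + b.toNat) l := rfl
      _ < _ := h
      _ ≤ 2 * (a + 1) * 2 ^ l.length := by gcongr; omega
      _ = _ := by ring

theorem pushBits_injective {a a' : ℕ} {l l' : List Bool} (hl : l.length = l'.length)
    (h : pushBits a l = pushBits a' l') : a = a' ∧ l = l' := by
  induction l generalizing a a' l' with
  | nil =>
    obtain rfl := List.length_eq_zero_iff.1 hl.symm
    exact ⟨h, rfl⟩
  | cons b l ih =>
    cases l' with
    | nil => simp at hl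
    | cons b' l' =>
      obtain ⟨h1, h2⟩ := ih (by simpa using hl) (show pushBits (2 * a + b.toNat) l =
        pushBits (2 * a' + b'.toNat) l' from h)
      have hb := b.toNat_lt
      have hb' := b'.toNat_lt
      exact ⟨by omega, by rw [h2, toNat_injective (by omega : b.toNat = b'.toNat)]⟩

/-- Coins as a number. -/
def coinNum {r : ℕ} (ρ : Fin r → Bool) : Fin (2 ^ r) :=
  ⟨pushBits 0 (List.ofFn ρ), by simpa using pushBits_lt 0 (List.ofFn ρ)⟩

theorem coinNum_bijective (r : ℕ) : Function.Bijective (coinNum (r := r)) := by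
  rw [Fintype.bijective_iff_injective_and_card]
  refine ⟨fun ρ ρ' h => List.ofFn_injective (pushBits_injective (by simp) (Fin.ext_iff.1 h)).2, ?_⟩
  simp

/-- Append as many coin flips as register `2` says to the number in register `1`. -/
def Prog.flip : Prog :=
  .loop 2 (.seq (.coin 3) (.seq (.op .add 1 1 1) (.seq (.op .add 1 1 3) (.seq (.const 3 1)
    (.op .sub 2 2 3)))))

theorem exec_flip (O : Oracle) (π : List Bool) (B : ℕ) (s : State)
    (hs : s.reg 2 = s.coins.length) (hB : (s.reg 1).size + s.coins.length ≤ B) :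
    ∃ t, Exec O π .flip s t ∧ t.reg 0 = s.reg 0 ∧ t.reg 1 = pushBits (s.reg 1) s.coins ∧
      t.time ≤ s.time + s.coins.length * (6 * B + 15) + (B + 1) := by
  generalize hl : s.coins = l at hs hB
  induction l generalizing s with
  | nil =>
    exact ⟨_, .loop_done hs, rfl, rfl, by simp [hs]⟩
  | cons b l ih =>
    simp only [List.length_cons] at hs hB
    let s0 : State := { s with time := s.time + 1 + (s.reg 2).size }
    obtain ⟨t1, e1, r1, c1, τ1⟩ : ∃ t, Exec O π (.coin 3) s0 t ∧
        t.reg = Function.update s.reg 3 b.toNat ∧ t.coins = l ∧ t.time = s0.time + 1 :=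
      ⟨_, .coin s0 3 b l hl, rfl, rfl, rfl⟩
    obtain ⟨t2, e2, r2, c2, τ2⟩ := exec_op (O := O) (π := π) t1 .add 1 1 1
    obtain ⟨t3, e3, r3, c3, τ3⟩ := exec_op (O := O) (π := π) t2 .add 1 1 3
    obtain ⟨t4, e4, r4, c4, τ4⟩ := exec_const (O := O) (π := π) t3 3 1
    obtain ⟨t5, e5, r5, c5, τ5⟩ := exec_op (O := O) (π := π) t4 .sub 2 2 3
    have v1 : t5.reg 1 = 2 * s.reg 1 + b.toNat := by
      simp [r5, r4, r3, r2, r1, Function.update, Op.eval]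
      omega
    have v2 : t5.reg 2 = l.length := by
      simp [r5, r4, r3, r2, r1, Function.update, Op.eval, hs]
    have v0 : t5.reg 0 = s.reg 0 := by simp [r5, r4, r3, r2, r1, Function.update]
    have z1 : (2 * s.reg 1 + b.toNat).size ≤ (s.reg 1).size + 1 := by
      rw [Nat.size_le, pow_succ]
      have := Nat.lt_size_self (s.reg 1)
      have := b.toNat_lt
      omega
    have z2 : (s.reg 1 + s.reg 1).size ≤ (s.reg 1).size + 1 := by
      rw [Nat.size_le, pow_succ]
      have := Nat.lt_size_self (s.reg 1)
      omega
    have z3 := size_toNat_le b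
    have z4 : (s.reg 2).size ≤ B := (size_le_self _).trans (by omega)
    obtain ⟨t6, e6, w0, w1, τ6⟩ := ih t5 (by rw [c5, c4, c3, c2, c1]) v2 (by rw [v1]; omega)
    refine ⟨t6, .loop_step (by omega) (.seq e1 (.seq e2 (.seq e3 (.seq e4 e5)))) e6,
      w0.trans v0, ?_, ?_⟩
    · rw [w1, v1]
      rfl
    · simp [r4, r3, r2, r1, Function.update, Op.eval] at τ2 τ3 τ4 τ5
      simp only [s0] at τ1
      rw [List.length_cons, Nat.add_mul]
      omega

/-! ### From decision procedures to verifiers -/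

/-- Inputs with a proof string. -/
structure Input (O : Oracle) where
  prf : List Bool
  x : List Bool

instance (O : Oracle) : World (Input O) where
  orc _ := O
  prf := Input.prf
  len a := a.x.length

/-- Inputs with a proof string and a number that stands for `r` coins. -/
structure CoinInput (O : Oracle) (r : Polynomial ℕ) where
  prf : List Bool
  x : List Bool
  ρ : ℕ
  lt : ρ < 2 ^ r.eval x.length

instance (O : Oracle) (r : Polynomial ℕ) : World (CoinInput O r) where
  orc _ := O
  prf := CoinInput.prf
  len a := a.x.length

/-- The variables of a verifier: the input, and the coins. -/
def CoinInput.vars {O : Oracle} {r : Polynomial ℕ} : ℕ → CoinInput O r → ℕ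
  | 0, a => encodeStr a.x
  | _ + 1, a => a.ρ

/-- A property of inputs and coins that is decided in polynomial time is decided by a verifier. -/
theorem PD.exists_verifier {O : Oracle} {r : Polynomial ℕ} {ok : CoinInput O r → Prop}
    (h : PD CoinInput.vars ok) : ∃ (V : Prog) (T : Polynomial ℕ), ∀ (x π : List Bool)
      (ρ : Fin (r.eval x.length) → Bool), ∃ t : State, Runs O π V x ρ t ∧
        t.time ≤ T.eval x.length ∧ (t.reg 0 = 1 ↔ ok ⟨π, x, coinNum ρ, (coinNum ρ).2⟩) := by
  classical
  obtain ⟨T0, P0, h0⟩ : PT (fun _ (a : Input O) => encodeStr a.x)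
      fun a => r.eval a.x.length :=
    (PT.strLength (PT.var _ 0 ((PolyB.len.add (.const 1)).mono fun a =>
      (size_encodeStr a.x).le))).eval r
  obtain ⟨T1, P1, h1⟩ := h.ite (.const _ 1) (.const _ 0)
  -- Register `0` keeps the input and register `1` collects the coins. Register `2` first holds the
  -- number of coins to flip and later the verdict, which is finally copied to register `0`.
  refine ⟨.seq (P0 (fun _ => 0) 2) (.seq .flip (.seq
    (P1 (fun i => match i with | 0 => 0 | _ + 1 => 1) 2) (.seq (.const 3 0) (.op .add 0 2 3)))),
    T0 + r * (6 * r + 15) + r + T1 + 10, fun x π ρ => ?_⟩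
  obtain ⟨t1, e1, r1⟩ := (h0 ⟨π, x⟩).2 (fun _ => 0) 2
    (State.start (encodeStr x) (List.ofFn ρ)) fun i => ⟨by simp, by simp [State.start]⟩
  have c1 : t1.coins = List.ofFn ρ := r1.coins
  have v0 : t1.reg 0 = encodeStr x := (r1.low 0 (by simp)).trans (by simp [State.start])
  have v1 : t1.reg 1 = 0 := (r1.low 1 (by simp)).trans (by simp [State.start])
  obtain ⟨t2, e2, w0, w1, τ2⟩ := exec_flip O π (r.eval x.length) t1
    (by rw [r1.val, c1, List.length_ofFn]) (by rw [v1, c1, List.length_ofFn]; simp)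
  rw [v0] at w0
  rw [v1, c1] at w1
  rw [c1, List.length_ofFn] at τ2
  obtain ⟨t3, e3, r3⟩ := (h1 ⟨π, x, coinNum ρ, (coinNum ρ).2⟩).2
    (fun i => match i with | 0 => 0 | _ + 1 => 1) 2 t2 (by
      rintro (_ | i)
      · exact ⟨by simp, w0⟩
      · exact ⟨by simp, w1⟩)
  obtain ⟨t4, e4, m4, c4, τ4⟩ := exec_const (O := O) (π := π) t3 3 0
  obtain ⟨t5, e5, m5, c5, τ5⟩ := exec_op (O := O) (π := π) t4 .add 0 2 3
  have v3 := r3.val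
  refine ⟨t5, .seq e1 (.seq e2 (.seq e3 (.seq e4 e5))), ?_, ?_⟩
  · have a1 := r1.time
    have a3 := r3.time
    have a4 : t4.reg 2 = t3.reg 2 := by simp [m4]
    have a5 : t4.reg 3 = 0 := by simp [m4]
    have a6 : (t3.reg 2).size ≤ 1 := by rw [v3]; beta_reduce; split_ifs <;> simp
    rw [a4, a5] at τ5
    simp only [State.start, Nat.size_zero, show len (⟨π, x⟩ : Input O) = x.length from rfl,
      show len (⟨π, x, coinNum ρ, (coinNum ρ).2⟩ : CoinInput O r) = x.length from rfl,
      Polynomial.eval_add, Polynomial.eval_mul, Polynomial.eval_ofNat] at *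
    omega
  · simp only [m5, m4, Function.update, Op.eval]
    simp [v3]

theorem mem_AdPCP_of_PD {O : Oracle} {r ℓ : Polynomial ℕ} {s c : ℕ → ℝ}
    {ok : CoinInput O r → Prop} (h : PD CoinInput.vars ok) {L : PromiseProblem}
    (hyes : ∀ x ∈ L.yes, ∃ π : List Bool, π.length ≤ 2 ^ ℓ.eval x.length ∧ c x.length ≤
      (Nat.card { n : Fin (2 ^ r.eval x.length) // ok ⟨π, x, n, n.2⟩ } : ℝ) / 2 ^ r.eval x.length)
    (hno : ∀ x ∈ L.no, ∀ π : List Bool,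
      (Nat.card { n : Fin (2 ^ r.eval x.length) // ok ⟨π, x, n, n.2⟩ } : ℝ) / 2 ^ r.eval x.length ≤
        s x.length) :
    ∃ p : Polynomial ℕ, L ∈ AdPCP O s c (fun n => p.eval n) (fun n => p.eval n)
      (fun n => r.eval n) (fun n => ℓ.eval n) := by
  obtain ⟨V, T, hV⟩ := h.exists_verifier
  have key : ∀ x π, verifierAcceptProb O π V x (r.eval x.length) =
      (Nat.card { n : Fin (2 ^ r.eval x.length) // ok ⟨π, x, n, n.2⟩ } : ℝ) /
        2 ^ r.eval x.length := by
    intro x π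
    rw [verifierAcceptProb]
    congr 2
    -- Coins correspond bijectively to numbers, and since runs are deterministic, an accepting run
    -- exists exactly if the run found above accepts.
    refine Nat.card_congr ((Equiv.ofBijective _ (coinNum_bijective _)).subtypeEquiv fun ρ => ?_)
    obtain ⟨t, ht, _, hok⟩ := hV x π ρ
    rw [Equiv.ofBijective_apply, ← hok]
    constructor
    · rintro ⟨t', ht', h1⟩
      rwa [Exec.unique ht ht']
    · exact fun h1 => ⟨t, ht, h1⟩
  refine ⟨T, V, T, fun x π ρ => ?_, fun x hx => ?_, fun x hx π => ?_⟩
  · obtain ⟨t, ht, hτ, _⟩ := hV x π ρ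
    have h1 := ht.proofQueries_le
    have h2 := ht.oracleQueries_le
    simp only [State.start] at h1 h2
    exact ⟨t, ht, hτ, by beta_reduce; omega, by beta_reduce; omega⟩
  · obtain ⟨π, hπ, h1⟩ := hyes x hx
    exact ⟨π, hπ, by rwa [key]⟩
  · rw [key]
    exact hno x hx π

/-! ### The verifier for circuits -/

theorem PolyTimeReal.exists_unaryPT {v : ℝ} (h : PolyTimeReal v) : ∃ f g : ℕ → ℕ,
    UnaryPT f ∧ UnaryPT g ∧ ∀ k, |v - ((f k : ℝ) - g k) / 2 ^ k| ≤ 1 / 2 ^ k :=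
  let ⟨_, hP⟩ := h
  let ⟨_, hF, hpt, _⟩ := hP.exists_unaryPT
  ⟨_, _, hpt 0, hpt 1, hF⟩

theorem GateSet.PolyTimeComputable.exists_entries (hS : S.PolyTimeComputable) :
    ∃ E : Entries S, E.Approx ∧ ∀ g r p, UnaryPT (E.pos g r p) ∧ UnaryPT (E.neg g r p) := by
  have h : ∀ g (r p : Idx (S.arity g)), ∃ f f' : ℕ → ℕ, UnaryPT f ∧ UnaryPT f' ∧
      ∀ k, |S.realEntry g r p - ((f k : ℝ) - f' k) / 2 ^ k| ≤ 1 / 2 ^ k := by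
    intro g r p
    obtain ⟨h1, h2⟩ := hS g r.1 p.1
    unfold GateSet.realEntry
    split_ifs
    · exact h1.exists_unaryPT
    · exact h2.exists_unaryPT
    · obtain ⟨f, f', a, b, c⟩ := h2.exists_unaryPT
      refine ⟨f', f, b, a, fun k => ?_⟩
      rw [← abs_neg]
      convert c k using 2
      ring
  choose f f' h1 h2 h3 using h
  exact ⟨⟨f, f'⟩, h3, fun g r p => ⟨h1 g r p, h2 g r p⟩⟩

theorem Uniform.exists_unaryPT {C : ℕ → Circuit S} (h : Uniform C) :
    (UnaryPT fun n => encodeStr (C n).encode) ∧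
      ∃ B : Polynomial ℕ, ∀ n, (C n).encode.length ≤ B.eval n := by
  obtain ⟨P, hP⟩ := h
  obtain ⟨F, hF, hpt, B, hB⟩ := hP.exists_unaryPT
  have h1 : (fun n => (F n).reg 0) = fun n => encodeStr (C n).encode := funext hF
  refine ⟨fun V k => h1 ▸ hpt 0 V k, B, fun n => ?_⟩
  have := hB n 0
  rw [hF, size_encodeStr] at this
  omega

theorem num_initIdx {w : ℕ} {x : List Bool} (hx : x.length ≤ w) :
    (initIdx w x).num = encodeStr x - 2 ^ x.length := by
  rw [encodeStr_eq_sum, Nat.add_sub_cancel, Idx.num]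
  refine (Finset.sum_subset_zero_on_sdiff (Finset.range_mono (by omega)) (fun j hj => ?_)
    fun j hj => ?_).symm
  · simp only [Finset.mem_sdiff, Finset.mem_range] at hj
    have : x.getD j false = false := List.getD_eq_default _ _ (by omega)
    simp only [Idx.digits, initIdx]
    split_ifs <;> simp_all
  · have : j < w := by have := Finset.mem_range.1 hj; omega
    simp [Idx.digits, initIdx, this]

/-- The number of `n < M ^ K` all of whose digits in base `M` satisfy `p`. -/
theorem card_digits (M K : ℕ) (p : ℕ → Prop) [DecidablePred p] :
    Nat.card { n : Fin (M ^ K) // ∀ k < K, p (n / M ^ k % M) } =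
      ((Finset.range M).filter p).card ^ K := by
  have e1 : Nat.card { n : Fin (M ^ K) // ∀ k < K, p (n / M ^ k % M) } =
      Nat.card { f : Fin K → Fin M // ∀ k, p (f k) } :=
    -- The base `M` digits of a number below `M ^ K` range independently over all values, so one
    -- long random number supplies `K` independent rounds.
    Nat.card_congr ((finFunctionFinEquiv (m := M) (n := K)).symm.subtypeEquiv fun n =>
      ⟨fun h k => h k k.2, fun h k hk => h ⟨k, hk⟩⟩)
  have e2 : Nat.card { f : Fin K → Fin M // ∀ k, p (f k) } =
      Nat.card (Fin K → { R : Fin M // p R }) :=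
    Nat.card_congr (Equiv.subtypePiEquivPi (p := fun _ (R : Fin M) => p R))
  have e3 : Nat.card { R : Fin M // p R } = ((Finset.range M).filter p).card := by
    rw [Nat.card_eq_fintype_card, Fintype.card_subtype]
    refine Finset.card_bij (fun R _ => (R : ℕ)) (fun R hR => by simpa using hR)
      (fun R _ R' _ h => Fin.ext h) fun R hR => ?_
    obtain ⟨h1, h2⟩ := Finset.mem_filter.1 hR
    exact ⟨⟨R, Finset.mem_range.1 h1⟩, by simpa using h2, rfl⟩
  rw [e1, e2, Nat.card_fun, e3]
  simp

/-- From `1 - 1 / m ≤ exp (-1 / m)` and `2 ≤ exp 1`. -/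
theorem one_sub_inv_pow_le {m : ℕ} (hm : 0 < m) (e : ℕ) :
    (1 - 1 / (m : ℝ)) ^ (m * e) ≤ 1 / 2 ^ e := by
  have hm' : (1 : ℝ) ≤ m := by exact_mod_cast hm
  have h0 : 0 ≤ 1 - 1 / (m : ℝ) := by
    rw [sub_nonneg, div_le_one (by linarith)]
    exact hm'
  have h1 : (1 - 1 / (m : ℝ)) ^ m ≤ 1 / 2 := by
    calc (1 - 1 / (m : ℝ)) ^ m ≤ Real.exp (-(1 / m)) ^ m :=
          pow_le_pow_left₀ h0 (Real.one_sub_le_exp_neg _) m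
      _ = (Real.exp 1)⁻¹ := by
          rw [← Real.exp_nat_mul, ← Real.exp_neg]
          congr 1
          field_simp
      _ ≤ 1 / 2 := by
          rw [← one_div]
          have := Real.exp_one_gt_d9
          exact one_div_le_one_div_of_le (by norm_num) (by linarith)
  rw [pow_mul, ← one_div_pow]
  exact pow_le_pow_left₀ (pow_nonneg h0 m) h1 e

theorem mem_AdPCP_of_mem_BQP (hS : S.PolyTimeComputable) (O : Oracle) (e : Polynomial ℕ)
    (L : PromiseProblem) (hL : L ∈ BQP S O) : ∃ p q r ℓ : Polynomial ℕ,
      L ∈ AdPCP O (fun n => 1 / 2 ^ e.eval n) (fun _ => 1) (fun n => p.eval n) (fun n => q.eval n)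
        (fun n => r.eval n) (fun n => ℓ.eval n) := by
  classical
  obtain ⟨C, hC, hwidth, hyes, hno⟩ := hL
  obtain ⟨E, hE, hEpt⟩ := hS.exists_entries
  obtain ⟨hCpt, B, hB⟩ := hC.exists_unaryPT
  -- `B` bounds the width and the number of gates. `m` is `1 / δ`, large enough for `1000 * (T + 1)
  -- ^ 2 * δ ≤ 1`; the precision `h` achieves `64 * 2 ^ (width + 1) ≤ η * 2 ^ h` with `η = δ / 100`.
  -- There are `K` rounds with `2 * h` coins each.
  let h : Polynomial ℕ := 3 * B + 26
  let m : Polynomial ℕ := 1000 * (B + 2) ^ 2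
  let K : Polynomial ℕ := m * e
  let r : Polynomial ℕ := 2 * h * K
  let ℓ : Polynomial ℕ := 4 * (2 * h + 1)
  have hh : ∀ n, h.eval n = 3 * B.eval n + 26 := fun n => by simp [h]
  have hm : ∀ n, m.eval n = 1000 * (B.eval n + 2) ^ 2 := fun n => by simp [m]
  have hK : ∀ n, K.eval n = m.eval n * e.eval n := fun n => by simp [K]
  have hr : ∀ n, 2 ^ r.eval n = (2 ^ h.eval n * 2 ^ h.eval n) ^ K.eval n := fun n => by
    rw [← pow_add, ← pow_mul]
    simp only [r, Polynomial.eval_mul, Polynomial.eval_add, two_mul]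
  let good : List Bool → List Bool → ℕ → Prop := fun π x R =>
    RoundOK O π E (h.eval x.length) (C x.length) (initIdx (C x.length).width x).num R
  let ok : CoinInput O r → Prop := fun a => ∀ k < K.eval a.x.length, good a.prf a.x
    (a.ρ / (2 ^ h.eval a.x.length * 2 ^ h.eval a.x.length) ^ k %
      (2 ^ h.eval a.x.length * 2 ^ h.eval a.x.length))
  have hok : PD CoinInput.vars ok := by
    have hlen : PolyB fun a : CoinInput O r => a.x.length := PolyB.len
    have hx : PT CoinInput.vars fun a : CoinInput O r => encodeStr a.x :=
      PT.var _ 0 ((PolyB.len.add (.const 1)).mono fun a => (size_encodeStr a.x).le)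
    have hρ : PT CoinInput.vars fun a : CoinInput O r => a.ρ :=
      PT.var _ 1 ((hlen.eval r).mono fun a => Nat.size_le.2 a.lt)
    have hn := hx.strLength
    have hhp := hn.eval h
    have hhb := hlen.eval h
    have hH := hhp.two_pow hhb
    have hz : PT CoinInput.vars fun a : CoinInput O r =>
        (initIdx (C a.x.length).width a.x).num :=
      (hx.sub (hn.two_pow hlen)).congr fun a => (num_initIdx (hwidth _).1).symm
    refine PD.ball (fun a k => good a.prf a.x
      (a.ρ / (2 ^ h.eval a.x.length * 2 ^ h.eval a.x.length) ^ k %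
      (2 ^ h.eval a.x.length * 2 ^ h.eval a.x.length))) (hn.eval K) (hlen.eval K)
      fun V' hi lift => ?_
    have hMk : PT V' fun p : Ext (fun a : CoinInput O r => K.eval a.x.length) =>
        (2 ^ h.eval p.base.x.length * 2 ^ h.eval p.base.x.length) ^ p.idx :=
      (((lift _ (hhp.add hhp)).mul hi).two_pow ((hhb.add hhb).ext.mul (hlen.eval K).idx)).congr
        fun p => by rw [← pow_add, ← pow_mul]
    exact PD.roundOK hEpt (lift _ (hCpt _ _ hn hlen)) (lift _ hhp) hhb.ext (lift _ hz)
      (((lift _ hρ).div hMk).mod (lift _ (hH.mul hH)))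
  have hcount : ∀ x π, (Nat.card { n : Fin (2 ^ r.eval x.length) // ok ⟨π, x, n, n.2⟩ } : ℝ) /
      2 ^ r.eval x.length = ((((Finset.range (2 ^ h.eval x.length * 2 ^ h.eval x.length)).filter
        (good π x)).card : ℝ) / (2 ^ h.eval x.length * 2 ^ h.eval x.length)) ^
          K.eval x.length := by
    intro x π
    rw [div_pow]
    congr 1
    · rw [← Nat.cast_pow, ← card_digits]
      congr 1
      exact Nat.card_congr ((finCongr (hr x.length)).subtypeEquiv fun n => Iff.rfl)
    · exact_mod_cast hr x.length
  refine Exists.elim (mem_AdPCP_of_PD (ℓ := ℓ) (s := fun n => 1 / 2 ^ e.eval n) (c := fun _ => 1)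
    (L := L) hok (fun x hx => ?_) fun x hx π => ?_) fun p hp => ⟨p, p, r, ℓ, hp⟩
  · have h1 := hh x.length
    have h2 := (C x.length).width_le
    have h3 := ((C x.length).gates_length_lt.le).trans (C x.length).length_tokens_le
    have h4 := hB x.length
    obtain ⟨π, hπ, hall⟩ := exists_roundOK O (C x.length) x hE (h := h.eval x.length) (by omega)
      (hwidth _).2 (by omega) (by omega) (hyes x hx)
    refine ⟨π, by rw [hπ]; simp [ℓ], ?_⟩
    rw [hcount, Finset.filter_true_of_mem fun R hR => hall R (Finset.mem_range.1 hR),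
      Finset.card_range]
    push_cast
    rw [div_self (by positivity), one_pow]
  · have h1 := hh x.length
    have h2 := (C x.length).width_le
    have h3 := ((C x.length).gates_length_lt.le).trans (C x.length).length_tokens_le
    have h4 := hB x.length
    rw [hcount, hK]
    have hmpos : 0 < m.eval x.length := by rw [hm]; positivity
    refine le_trans (pow_le_pow_left₀ (by positivity) ?_ _) (one_sub_inv_pow_le hmpos _)
    -- A round that passes with probability above `1 - 1 / m` would force the circuit to accept with
    -- probability above `1 / 3`.
    by_contra hlt
    push Not at hlt
    rw [lt_div_iff₀ (by positivity)] at hlt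
    have hb : (0 : ℝ) < ((B.eval x.length : ℕ) : ℝ) + 2 := by positivity
    have hmr : ((m.eval x.length : ℕ) : ℝ) = 1000 * (((B.eval x.length : ℕ) : ℝ) + 2) ^ 2 := by
      rw [hm]
      push_cast
      ring
    refine absurd (acceptProb_gt_of_roundOK O π (C x.length) x hE (h.eval x.length)
      (δ := 1 / m.eval x.length) (η := 1 / m.eval x.length / 100) ?_ ?_ ?_ ?_ _
      (fun R hR => ⟨Finset.mem_range.1 (Finset.mem_filter.1 hR).1, (Finset.mem_filter.1 hR).2⟩)
      hlt.le) (not_lt.2 (hno x hx))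
    · positivity
    · linarith
    · rw [hmr, mul_one_div, div_le_one (by positivity)]
      have : ((C x.length).gates.length : ℝ) ≤ B.eval x.length := by exact_mod_cast h3.trans h4
      gcongr
      linarith
    · have h5 : B.eval x.length + 2 ≤ 2 ^ (B.eval x.length + 1) := by
        have : B.eval x.length + 1 < 2 ^ (B.eval x.length + 1) := Nat.lt_two_pow_self
        omega
      have h6 : 64 * 2 ^ ((C x.length).width + 1) * (1000 * (B.eval x.length + 2) ^ 2 * 100) ≤
          2 ^ h.eval x.length := by
        -- Here `1000 ≤ 2 ^ 10`, `100 ≤ 2 ^ 7` and `B + 2 ≤ 2 ^ (B + 1)`; the exponents add up to `6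
        -- + 10 + 7 + 3 * (B + 1) = 3 * B + 26`.
        calc _ ≤ 2 ^ 6 * 2 ^ (B.eval x.length + 1) *
              (2 ^ 10 * (2 ^ (B.eval x.length + 1)) ^ 2 * 2 ^ 7) := by
              gcongr
              · norm_num
              · norm_num
              · omega
              · norm_num
              · norm_num
          _ = 2 ^ h.eval x.length := by
              rw [h1]
              ring
      have h7 : (64 * 2 ^ ((C x.length).width + 1) *
          (1000 * (((B.eval x.length : ℕ) : ℝ) + 2) ^ 2 * 100)) ≤ 2 ^ h.eval x.length := by
        exact_mod_cast h6
      rw [hmr, div_div, one_div_mul_eq_div, le_div_iff₀ (by positivity)]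
      exact h7

end OraclePCP

theorem mainTheorem1 (S : OraclePCP.GateSet) (hS : S.PolyTimeComputable)
    (O : OraclePCP.Oracle) (e : Polynomial ℕ) (L : OraclePCP.PromiseProblem)
    (hL : L ∈ OraclePCP.BQP S O) :
    ∃ p q r ℓ : Polynomial ℕ,
      L ∈ OraclePCP.AdPCP O (fun n => 1 / 2 ^ (e.eval n)) (fun _ => 1)
        (fun n => p.eval n) (fun n => q.eval n) (fun n => r.eval n) (fun n => ℓ.eval n) :=
  OraclePCP.mem_AdPCP_of_mem_BQP hS O e L hL
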